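/- Let $N\ge 2$ and let $X=\{X(t),t\in\mathbb{R}^N\}$ be an isotropic Gaussian random field with $\mathbb{E}X(t)=0$ and $\mathrm{Cov}[X(s),X(t)]=\rho(\|t-s\|^2)$, $\rho(0)=1$, $\rho:[0,\infty)\to\mathbb{R}$. Subscripts denote partial derivatives, $\nabla X$ and $\nabla^2X$ are the gradient and the Hessian, and $\nabla^2X$ is identified with the vector of its $N(N+1)/2$ entries on and above the diagonal. Assume that $X$ is *qualified*: almost surely $X$ has partial derivatives up to second order; the sixth derivative of $\rho$ at $0$ exists; the law of $(\nabla^2X(t),\nabla X(t),X(t),\nabla X(0),X(0))$ is non-degenerate for every $t\ne0$; and the law of $(X_{111}(0),\nabla X(0))$ is non-degenerate, where $X_{111}(0)$ is the third mean-square derivative of $X$ at $0$ along the first axis. Put $L=N(N+1)/2+2$. For $t\neq 0$ let $\Sigma(t)\in\mathbb{R}^{L\times L}$ be the covariance matrix of the conditional (Gaussian) law of $(\nabla^2X(t),X(t),X(0))$ given $\nabla X(t)=\nabla X(0)=0$. Assume moreover that $X$ is *qualified under perturbation*: one can choose for every $t\ne0$ an eigen-decomposition $\Sigma(t)=P(t)\Lambda(t)P(t)^T$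 with $P(t)$ orthogonal and $\Lambda(t)$ diagonal with decreasing diagonal entries, such that for every unit vector $v\in\mathbb{R}^N$, the limits of $P(rv)$ and $\Lambda(rv)$ as $r\downarrow0$ exist, with these limits as values at $r=0$ both functions of $r$ are continuous on $[0,\delta]$ for some $\delta>0$, and as $r\downarrow 0$, $P(rv)=P_0+P_1r+o(r)$ and $\Lambda(rv)=\Lambda_0+\Lambda_1r+\Lambda_2r^2+o(r^2)$ for some constant matrices $P_j$ and constant diagonal matrices $\Lambda_j$. Let $\tilde\delta>0$ be such that $\rho$ is four times continuously differentiable on $[0,\tilde\delta^2]$ and, for all $x\in(0,\tilde\delta^2]$, $$\rho'(x)<0\quad\text{and}\quad \rho'(x)^2+2\rho'(x)\rho''(x)x+4\rho''(x)^2x^2<\rho'(0)^2 .$$ For $0\le k\le N$ let $D_k$ be the set of non-degenerate symmetric $N\times N$ matrices with exactly $k$ negative eigenvalues (counted with multiplicity). For $u>0$ and $t\neq0$ let $$f_{u,k}(t)=\frac{p_t(0,0)}{P(X(0)>u)\,p(0)}\int_{x,z>u}\int_{D_k}|\det x''|\;p_t(x'',x,z\mid 0,0)\,dx''\,dx\,dz$$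 be the density of the mean measure of the non-degenerate critical points of $X$ above $u$ with index $k$, conditional on $\nabla X(0)=0$ and $X(0)>u$; here $p$, $p_t(\cdot,\cdot)$ and $p_t(\cdot\mid0,0)$ are the Gaussian densities of $\nabla X(0)$, of $(\nabla X(t),\nabla X(0))$, and of $(\nabla^2X(t),X(t),X(0))$ given $\nabla X(t)=\nabla X(0)=0$. Let $$\Psi_u(t)=\frac{\sum_{k=0}^{N-2}f_{u,k}(t)}{f_{u,N-1}(t)+f_{u,N}(t)}$$ (the denominator is positive). Then: (i) for every $u>0$ the limit $\Psi_u(0):=\lim_{\|t\|\to0}\Psi_u(t)$ exists, and thus $\Psi_u$ is well defined and continuous on $\mathbb{R}^N$; (ii) $\displaystyle\max_{\|t\|\le\tilde\delta}\Psi_u(t)\to0$ as $u\to\infty$. -/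

import Mathlib

open MeasureTheory ProbabilityTheory Filter Topology Asymptotics

namespace CritPair

/-! ### Vectorized symmetric matrices, number of negative eigenvalues, Gaussian densities -/

/-- Index set of the entries on and above the diagonal of a symmetric `N × N` matrix; it has
`N (N + 1) / 2` elements. -/
abbrev HessIdx (N : ℕ) : Type := {p : Fin N × Fin N // p.1 ≤ p.2}

/-- The symmetric matrix with prescribed entries on and above the diagonal. -/
def matri {N : ℕ} (x : HessIdx N → ℝ) : Matrix (Fin N) (Fin N) ℝ :=
  Matrix.of fun i j => x ⟨(min i j, max i j), min_le_max⟩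

theorem matri_isHermitian {N : ℕ} (x : HessIdx N → ℝ) : (matri x).IsHermitian := by
  ext i j
  simp [matri, Matrix.conjTranspose_apply, min_comm, max_comm]

/-- The number of negative eigenvalues of `matri x`, counted with multiplicity. -/
noncomputable def negIndex {N : ℕ} (x : HessIdx N → ℝ) : ℕ :=
  (Finset.univ.filter fun i => (matri_isHermitian x).eigenvalues i < 0).card

/-- The vectorized symmetric matrices that are non-degenerate and have exactly `k` negative
eigenvalues. -/
def indexSet (N k : ℕ) : Set (HessIdx N → ℝ) :=
  {x | (matri x).det ≠ 0 ∧ negIndex x = k}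

/-- The density of the centered Gaussian law with (positive definite) covariance matrix `C`. -/
noncomputable def gaussDensity {ι : Type*} [Fintype ι] [DecidableEq ι] (C : Matrix ι ι ℝ)
    (x : ι → ℝ) : ℝ :=
  (Real.sqrt ((2 * Real.pi) ^ Fintype.card ι * C.det))⁻¹ *
    Real.exp (-(1 / 2) * (x ⬝ᵥ (C⁻¹.mulVec x)))

/-! ### Derivatives of a random field and their covariances -/

section Field

variable {N : ℕ} {Ω : Type*} [MeasurableSpace Ω]

/-- The `i`-th standard basis vector. -/
noncomputable abbrev basisVec (i : Fin N) : EuclideanSpace ℝ (Fin N) := EuclideanSpace.single i 1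

/-- The pathwise partial derivative `X_i(t)`. -/
noncomputable def partial1 (X : EuclideanSpace ℝ (Fin N) → Ω → ℝ) (i : Fin N)
    (t : EuclideanSpace ℝ (Fin N)) (ω : Ω) : ℝ :=
  lineDeriv ℝ (fun s => X s ω) t (basisVec i)

/-- The pathwise second partial derivative `X_{ij}(t)`. -/
noncomputable def partial2 (X : EuclideanSpace ℝ (Fin N) → Ω → ℝ) (i j : Fin N)
    (t : EuclideanSpace ℝ (Fin N)) (ω : Ω) : ℝ :=
  lineDeriv ℝ (fun s => partial1 X i s ω) t (basisVec j)

/-- The (cross-)covariance matrix of two random vectors. -/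
noncomputable def covMat {ι κ : Type*} (P : Measure Ω) (Y : ι → Ω → ℝ) (Z : κ → Ω → ℝ) :
    Matrix ι κ ℝ :=
  Matrix.of fun a b => cov[Y a, Z b; P]

/-- Index set of the random vector `(∇²X(t), X(t), X(0))`; it has `N (N + 1) / 2 + 2` elements,
and `inr 0`, `inr 1` are the indices of `X(t)`, `X(0)`. -/
abbrev MainIdx (N : ℕ) : Type := HessIdx N ⊕ Fin 2

/-- The random vector `(∇²X(t), X(t), X(0))`, with `∇²X(t)` vectorized. -/
noncomputable def mainVec (X : EuclideanSpace ℝ (Fin N) → Ω → ℝ) (t : EuclideanSpace ℝ (Fin N)) :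
    MainIdx N → Ω → ℝ :=
  Sum.elim (fun p => partial2 X p.1.1 p.1.2 t) ![X t, X 0]

/-- The random vector `(∇X(t), ∇X(0))`. -/
noncomputable def gradVec (X : EuclideanSpace ℝ (Fin N) → Ω → ℝ) (t : EuclideanSpace ℝ (Fin N)) :
    Fin N ⊕ Fin N → Ω → ℝ :=
  Sum.elim (fun i => partial1 X i t) (fun i => partial1 X i 0)

/-- The covariance matrix of the (Gaussian) conditional law of `(∇²X(t), X(t), X(0))`
given `∇X(t) = ∇X(0) = 0`. -/
noncomputable def condCov (P : Measure Ω) (X : EuclideanSpace ℝ (Fin N) → Ω → ℝ)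
    (t : EuclideanSpace ℝ (Fin N)) : Matrix (MainIdx N) (MainIdx N) ℝ :=
  covMat P (mainVec X t) (mainVec X t) -
    covMat P (mainVec X t) (gradVec X t) * (covMat P (gradVec X t) (gradVec X t))⁻¹ *
      covMat P (gradVec X t) (mainVec X t)

/-! ### Hypotheses on the field -/

/-- `X` is a centered Gaussian random field with `Cov[X(s), X(t)] = ρ(‖t - s‖²)` and `ρ(0) = 1`,
with the smoothness and non-degeneracy assumptions of a *qualified* field. Only the values of `ρ`
on `[0, ∞)` matter, so its derivatives are taken within `[0, ∞)`. -/
structure IsQualified (P : Measure Ω) (X : EuclideanSpace ℝ (Fin N) → Ω → ℝ) (ρ : ℝ → ℝ) :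
    Prop where
  two_le : 2 ≤ N
  gaussian : IsGaussianProcess X P
  centered : ∀ t, ∫ ω, X t ω ∂P = 0
  cov_eq : ∀ s t, cov[X s, X t; P] = ρ (‖t - s‖ ^ 2)
  rho_zero : ρ 0 = 1
  /-- Almost surely, all partial derivatives of first and second order exist everywhere. -/
  partials : ∀ᵐ ω ∂P, ∀ t, ∀ i,
    LineDifferentiableAt ℝ (fun s => X s ω) t (basisVec i) ∧
      ∀ j, LineDifferentiableAt ℝ (fun s => partial1 X i s ω) t (basisVec j)
  /-- The sixth derivative of `ρ` at `0` exists (so the fifth one exists near `0`). -/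
  sixth_deriv : (∃ δ > 0, ∀ k < 5, ∀ x ∈ Set.Icc 0 (δ ^ 2),
      DifferentiableWithinAt ℝ (iteratedDerivWithin k ρ (Set.Ici 0)) (Set.Ici 0) x) ∧
    DifferentiableWithinAt ℝ (iteratedDerivWithin 5 ρ (Set.Ici 0)) (Set.Ici 0) 0
  /-- The law of `(∇²X(t), X(t), X(0), ∇X(t), ∇X(0))` is non-degenerate for `t ≠ 0`. -/
  nondeg : ∀ t ≠ 0, (covMat P (Sum.elim (mainVec X t) (gradVec X t))
    (Sum.elim (mainVec X t) (gradVec X t))).PosDef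
  /-- The law of `(X₁₁₁(0), ∇X(0))` is non-degenerate, where `X₁₁₁(0)` is the mean square
  derivative of `X₁₁` at `0` along the first coordinate axis. -/
  nondeg_third : ∃ Y : Ω → ℝ, MemLp Y 2 P ∧
    Tendsto (fun h : ℝ => eLpNorm (fun ω =>
        h⁻¹ * (partial2 X ⟨0, by omega⟩ ⟨0, by omega⟩ (h • basisVec ⟨0, by omega⟩) ω -
          partial2 X ⟨0, by omega⟩ ⟨0, by omega⟩ 0 ω) - Y ω) 2 P) (𝓝[≠] 0) (𝓝 0) ∧
    (covMat P (Sum.elim (fun _ : Unit => Y) (fun i => partial1 X i 0))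
      (Sum.elim (fun _ : Unit => Y) (fun i => partial1 X i 0))).PosDef

/-- `X` is *qualified under perturbation*: it is qualified, and the conditional covariance matrices
`Σ(t)`, `t ≠ 0`, have eigen-decompositions `Σ(t) = Q(t) diag(l(t)) Q(t)ᵀ`, with `Q(t)` orthogonal
and `l(t)` the eigenvalues in decreasing order, such that along every ray `r ↦ r u`, `‖u‖ = 1`,
both `Q` and `l` have a limit at `r = 0`, are continuous on some `[0, δ]`, `δ > 0`, and have
expansions of order `1` and `2` respectively as `r ↓ 0`. -/
structure IsQualifiedPert (P : Measure Ω) (X : EuclideanSpace ℝ (Fin N) → Ω → ℝ) (ρ : ℝ → ℝ) :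
    Prop extends IsQualified P X ρ where
  perturbation : ∃ (Q : EuclideanSpace ℝ (Fin N) →
        Matrix (MainIdx N) (Fin (N * (N + 1) / 2 + 2)) ℝ)
      (l : EuclideanSpace ℝ (Fin N) → Fin (N * (N + 1) / 2 + 2) → ℝ),
    (∀ t ≠ 0, (Q t).transpose * Q t = 1 ∧ Q t * (Q t).transpose = 1 ∧ Antitone (l t) ∧
      condCov P X t = Q t * Matrix.diagonal (l t) * (Q t).transpose) ∧
    ∀ u : EuclideanSpace ℝ (Fin N), ‖u‖ = 1 →
      ∃ (Q0 Q1 : Matrix (MainIdx N) (Fin (N * (N + 1) / 2 + 2)) ℝ)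
        (l0 l1 l2 : Fin (N * (N + 1) / 2 + 2) → ℝ),
        Tendsto (fun r : ℝ => Q (r • u)) (𝓝[>] 0) (𝓝 Q0) ∧
        Tendsto (fun r : ℝ => l (r • u)) (𝓝[>] 0) (𝓝 l0) ∧
        (∃ δ > 0,
          ContinuousOn (Function.update (fun r : ℝ => Q (r • u)) 0 Q0) (Set.Icc 0 δ) ∧
          ContinuousOn (Function.update (fun r : ℝ => l (r • u)) 0 l0) (Set.Icc 0 δ)) ∧
        (∀ a i, (fun r : ℝ => Q (r • u) a i - (Q0 a i + Q1 a i * r))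
          =o[𝓝[>] 0] (fun r : ℝ => r)) ∧
        (∀ i, (fun r : ℝ => l (r • u) i - (l0 i + l1 i * r + l2 i * r ^ 2))
          =o[𝓝[>] 0] (fun r : ℝ => r ^ 2))

/-- `ρ` is four times continuously differentiable on `[0, d²]`. -/
def SmoothCond (ρ : ℝ → ℝ) (d : ℝ) : Prop :=
  ContDiffOn ℝ 4 ρ (Set.Icc 0 (d ^ 2))

/-- For `x ∈ (0, d²]`: `ρ'(x) < 0` and
`ρ'(x)² + 2 ρ'(x) ρ''(x) x + 4 ρ''(x)² x² < ρ'(0)²`. -/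
def SignCond (ρ : ℝ → ℝ) (d : ℝ) : Prop :=
  ∀ x ∈ Set.Ioc 0 (d ^ 2),
    iteratedDerivWithin 1 ρ (Set.Icc 0 (d ^ 2)) x < 0 ∧
    iteratedDerivWithin 1 ρ (Set.Icc 0 (d ^ 2)) x ^ 2 +
        2 * iteratedDerivWithin 1 ρ (Set.Icc 0 (d ^ 2)) x *
          iteratedDerivWithin 2 ρ (Set.Icc 0 (d ^ 2)) x * x +
        4 * iteratedDerivWithin 2 ρ (Set.Icc 0 (d ^ 2)) x ^ 2 * x ^ 2 <
      iteratedDerivWithin 1 ρ (Set.Icc 0 (d ^ 2)) 0 ^ 2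

/-! ### Densities of critical points -/

/-- The density `f_{u,k}(t)`, `t ≠ 0`, of the mean measure of the non-degenerate critical points of
`X` above `u` with index `k`, conditional on `∇X(0) = 0` and `X(0) > u`:
`P(X(0) > u)⁻¹ p(0)⁻¹ p_t(0, 0) ∫_{x, z > u} ∫_{x'' ∈ D_k} |det x''| p_t(x'', x, z | 0, 0)`,
where `p`, `p_t(·, ·)` and `p_t(· | 0, 0)` are the densities of `∇X(0)`, of `(∇X(t), ∇X(0))` and of
`(∇²X(t), X(t), X(0))` given `∇X(t) = ∇X(0) = 0`. -/
noncomputable def critDensity (P : Measure Ω) (X : EuclideanSpace ℝ (Fin N) → Ω → ℝ)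
    (u : ℝ) (k : ℕ) (t : EuclideanSpace ℝ (Fin N)) : ℝ :=
  (P.real {ω | u < X 0 ω})⁻¹ *
    (gaussDensity (covMat P (fun i => partial1 X i 0) (fun i => partial1 X i 0)) 0)⁻¹ *
    gaussDensity (covMat P (gradVec X t) (gradVec X t)) 0 *
    ∫ w in {w : MainIdx N → ℝ | u < w (Sum.inr 0) ∧ u < w (Sum.inr 1) ∧
        (fun p => w (Sum.inl p)) ∈ indexSet N k},
      |(matri fun p => w (Sum.inl p)).det| * gaussDensity (condCov P X t) w

/-- `Ψ_u(t) = (∑_{k ≤ N - 2} f_{u,k}(t)) / (f_{u,N-1}(t) + f_{u,N}(t))`, for `t ≠ 0`. -/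
noncomputable def psi (P : Measure Ω) (X : EuclideanSpace ℝ (Fin N) → Ω → ℝ)
    (u : ℝ) (t : EuclideanSpace ℝ (Fin N)) : ℝ :=
  (∑ k ∈ Finset.range (N - 1), critDensity P X u k t) /
    (critDensity P X u (N - 1) t + critDensity P X u N t)

end Field

end CritPair

namespace CritPair

/-! ### The number of negative eigenvalues of a symmetric matrix -/

/-! The prefactor of `critDensity` does not depend on the index k, so `psi` is a quotient of
integrals of |det x''| against the conditional Gaussian law. This law degenerates as t → 0: with t =
r e, the conditions X_e(0) = X_e(t) = 0 force the second derivative in direction e to be of order r.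
A congruence x'' ↦ B x'' Bᵀ preserves the index (Sylvester) and multiplies |det x''| by (det B)² for
all k alike, so the quotient is unchanged. Take for B a rotation of e to the first axis followed by
a scaling of that axis by r^(-1/2); the radial entry is then divided by r. By isotropy the
transformed covariance `peakMatrix` depends on r only (`congMat_condGram`), and written through
Taylor remainders of ρ' and ρ'' it is continuous up to r = 0 (`taylorCoeff`).

For (i): the matrix at r = 0 is singular, but its law still charges neighbourhoods of points with
negative definite Hessian and positive values (`ChargesMaxima`). Along such a direction the
determinant is a nonzero polynomial, so the discontinuities of the integrand form a null set. Weak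
continuity of Gaussian laws then gives the limit, with a positive denominator (`tendsto_critRatio`).

For (ii): split the Gaussian vector into g β plus a residual, where g is the normalized sum X(t) +
X(0) and the residual is independent of g. The Hessian part of β is diagonal, and its tangential
entries are negative by the inequality assumed on ρ (`peakCoeff_add_neg`). Above level u the
variable g is of order at least u, so the tangential block is negative definite, and the index at
least N - 1, unless the residual is also of order u. This costs an exponential factor of any
prescribed rate (`exists_sum_critInt_le`), whereas a typical residual makes the denominator at least
a fixed multiple of the probability that g lies in a unit window near the threshold
(`exists_critInt_add_ge`). The ratio is thus at most K' exp(-u), with constants uniform in r by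
compactness (`exists_peakBounds`).

All covariances are computed by regarding the field and its derivatives as vectors in L²
(`exists_isHilbertField`); almost sure derivatives are mean square derivatives because everything
stays in a Gaussian space. -/

theorem toQuadraticForm'_apply {ι : Type*} [Fintype ι] [DecidableEq ι] (M : Matrix ι ι ℝ)
    (v : ι → ℝ) : M.toQuadraticForm' v = v ⬝ᵥ M.mulVec v := by
  simp [Matrix.toQuadraticForm', Matrix.toLinearMap₂'_apply']

/-- Congruent matrices define equivalent quadratic forms. -/
theorem equivalent_of_congruent {ι : Type*} [Fintype ι] [DecidableEq ι] (M B : Matrix ι ι ℝ)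
    (hB : B.det ≠ 0) :
    (B * M * B.transpose).toQuadraticForm'.Equivalent M.toQuadraticForm' := by
  have hu : IsUnit B.transpose.det := by simpa using hB
  refine ⟨⟨Matrix.toLinearEquiv' B.transpose (Matrix.invertibleOfIsUnitDet _ hu), fun v => ?_⟩⟩
  change M.toQuadraticForm' (Matrix.toLinearEquiv' B.transpose _ v) = _
  have h : (Matrix.toLinearEquiv' B.transpose (Matrix.invertibleOfIsUnitDet _ hu)) v
      = B.transpose.mulVec v := rfl
  rw [h, toQuadraticForm'_apply, toQuadraticForm'_apply, ← Matrix.mulVec_mulVec,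
    ← Matrix.mulVec_mulVec, Matrix.dotProduct_mulVec v B, ← Matrix.mulVec_transpose]

theorem toQuadraticForm'_diagonal {ι : Type*} [Fintype ι] [DecidableEq ι] (l : ι → ℝ) :
    (Matrix.diagonal l).toQuadraticForm' = QuadraticMap.weightedSumSquares ℝ l := by
  ext v
  rw [toQuadraticForm'_apply, QuadraticMap.weightedSumSquares_apply]
  simp only [dotProduct, Matrix.mulVec_diagonal, smul_eq_mul]
  exact Finset.sum_congr rfl fun i _ => by ring

/-- The spectral theorem is a congruence by an orthogonal matrix, so the signature can be read off
the eigenvalues. -/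
theorem equivalent_weightedSumSquares_eigenvalues {ι : Type*} [Fintype ι] [DecidableEq ι]
    {M : Matrix ι ι ℝ} (hM : M.IsHermitian) :
    M.toQuadraticForm'.Equivalent (QuadraticMap.weightedSumSquares ℝ hM.eigenvalues) := by
  set U : Matrix ι ι ℝ := (hM.eigenvectorUnitary : Matrix ι ι ℝ) with hU
  have h1 : M = U * Matrix.diagonal hM.eigenvalues * U.transpose := by
    have := hM.spectral_theorem
    rw [Unitary.conjStarAlgAut_apply] at this
    simpa [Matrix.star_eq_conjTranspose, Function.comp_def] using this
  have h2 : U.det ≠ 0 := by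
    have h3 : U.transpose * U = 1 := by
      simpa [Matrix.star_eq_conjTranspose] using
        Matrix.mem_unitaryGroup_iff'.1 hM.eigenvectorUnitary.2
    intro h0
    have := congrArg Matrix.det h3
    rw [Matrix.det_mul, h0, mul_zero, Matrix.det_one] at this
    exact zero_ne_one this
  have h4 := equivalent_of_congruent (Matrix.diagonal hM.eigenvalues) U h2
  rwa [← h1, toQuadraticForm'_diagonal] at h4

variable {N : ℕ}

/-- Trades the eigenvalue count for `sigNeg`, which is invariant under congruence and defined by
maximal definite subspaces. -/
theorem negIndex_eq_sigNeg (x : HessIdx N → ℝ) : negIndex x = sigNeg (matri x).toQuadraticForm' := by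
  rw [QuadraticForm.sigNeg_of_equiv_weightedSumSquares
    (equivalent_weightedSumSquares_eigenvalues (matri_isHermitian x)), negIndex,
    Set.ncard_eq_toFinset_card']
  congr 1
  ext i
  simp

theorem det_matri_ne_zero_iff (x : HessIdx N → ℝ) : (matri x).det ≠ 0 ↔
    N ≤ sigNeg (matri x).toQuadraticForm' + sigPos (matri x).toQuadraticForm' := by
  have he := equivalent_weightedSumSquares_eigenvalues (matri_isHermitian x)
  rw [QuadraticForm.sigNeg_of_equiv_weightedSumSquares he,
    QuadraticForm.sigPos_of_equiv_weightedSumSquares he,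
    (matri_isHermitian x).det_eq_prod_eigenvalues]
  set l := (matri_isHermitian x).eigenvalues
  have h1 : {i | l i < 0}.ncard + {i | 0 < l i}.ncard = {i | l i ≠ 0}.ncard := by
    rw [← Set.ncard_union_eq]
    · congr 1
      ext i
      simp [lt_or_lt_iff_ne]
    · rw [Set.disjoint_left]
      intro i hi hi'
      simp only [Set.mem_ofPred_eq] at hi hi'
      exact lt_asymm hi hi'
  rw [h1]
  have h2 := Set.ncard_add_ncard_compl {i | l i ≠ 0}
  rw [Nat.card_fin] at h2
  have h3 : (∏ i, ((l i : ℝ) : ℝ)) ≠ 0 ↔ {i | l i ≠ 0}ᶜ = ∅ := by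
    rw [Finset.prod_ne_zero_iff, Set.compl_empty_iff, Set.eq_univ_iff_forall]
    simp
  have h4 : {i | l i ≠ 0}ᶜ = ∅ ↔ {i | l i ≠ 0}ᶜ.ncard = 0 :=
    (Set.ncard_eq_zero (Set.toFinite _)).symm
  have h5 : (∏ i, (RCLike.ofReal (l i) : ℝ)) = ∏ i, l i := by simp
  rw [h5, h3, h4]
  omega

theorem negIndex_le (x : HessIdx N → ℝ) : negIndex x ≤ N := by
  have := Finset.card_filter_le (Finset.univ : Finset (Fin N))
    (fun i => (matri_isHermitian x).eigenvalues i < 0)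
  simpa [negIndex] using this

theorem sigNeg_add_sigPos_le (Q : QuadraticForm ℝ (Fin N → ℝ)) : sigNeg Q + sigPos Q ≤ N := by
  have := QuadraticForm.sigPos_add_sigNeg_add_radical (Q := Q)
  simp at this
  omega

/-- As `sigNeg` and `sigPos` add up to at most N, two lower bounds with sum N force equality and
exclude the eigenvalue zero. Lower bounds are what is stable under perturbation, hence the openness
of `indexSet`. -/
theorem indexSet_eq {k : ℕ} (hk : k ≤ N) : indexSet N k =
    {x | k ≤ sigNeg (matri x).toQuadraticForm'} ∩
      {x | N - k ≤ sigPos (matri x).toQuadraticForm'} := by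
  ext x
  simp only [indexSet, Set.mem_ofPred_eq, Set.mem_inter_iff, det_matri_ne_zero_iff,
    negIndex_eq_sigNeg]
  have := sigNeg_add_sigPos_le (matri x).toQuadraticForm'
  omega

theorem continuous_matri : Continuous (matri : (HessIdx N → ℝ) → Matrix (Fin N) (Fin N) ℝ) := by
  refine continuous_matrix fun i j => ?_
  exact continuous_apply _

/-- Positive definiteness on a fixed subspace is an open condition. -/
theorem isOpen_le_sigPos {Y : Type*} [TopologicalSpace Y] (M : Y → Matrix (Fin N) (Fin N) ℝ)
    (hM : Continuous M) (k : ℕ) : IsOpen {y | k ≤ sigPos (M y).toQuadraticForm'} := by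
  rw [isOpen_iff_mem_nhds]
  intro y hy
  obtain ⟨V, hV, hpos⟩ := exists_finrank_eq_sigPos_and_posDef (M y).toQuadraticForm'
  have hK : IsCompact ((V : Set (Fin N → ℝ)) ∩ Metric.sphere 0 1) :=
    (isCompact_sphere 0 1).inter_left V.closed_of_finiteDimensional
  have hc : Continuous fun z : Y × (Fin N → ℝ) => z.2 ⬝ᵥ (M z.1).mulVec z.2 :=
    continuous_snd.dotProduct ((hM.comp continuous_fst).matrix_mulVec continuous_snd)
  -- The unit sphere of V is compact, so strict positivity of the form on it survives a small change
  -- of y.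
  have h1 : ∀ᶠ y' in 𝓝 y, ∀ v ∈ (V : Set (Fin N → ℝ)) ∩ Metric.sphere 0 1,
      0 < v ⬝ᵥ (M y').mulVec v := by
    refine hK.eventually_forall_of_forall_eventually fun v hv => ?_
    refine hc.continuousAt.eventually_const_lt ?_
    have h0 : v ≠ 0 := by
      rintro rfl
      simpa using hv.2
    have := hpos ⟨v, hv.1⟩ (by simpa using h0)
    rwa [QuadraticMap.restrict_apply, toQuadraticForm'_apply] at this
  filter_upwards [h1] with y' hy'
  refine (show k ≤ Module.finrank ℝ V from by rw [hV]; exact hy).trans (le_sigPos_of_posDef _ ?_)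
  intro v hv
  rw [QuadraticMap.restrict_apply, toQuadraticForm'_apply]
  have hv0 : (v : Fin N → ℝ) ≠ 0 := by simpa using hv
  have hn : 0 < ‖(v : Fin N → ℝ)‖ := norm_pos_iff.2 hv0
  have h2 := hy' (‖(v : Fin N → ℝ)‖⁻¹ • (v : Fin N → ℝ)) ⟨V.smul_mem _ v.2, by
    simp [norm_smul, hn.ne']⟩
  rw [Matrix.mulVec_smul, smul_dotProduct, dotProduct_smul, smul_eq_mul, smul_eq_mul] at h2
  have h3 : 0 < ‖(v : Fin N → ℝ)‖⁻¹ := inv_pos.2 hn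
  exact (mul_pos_iff_of_pos_left h3).1 ((mul_pos_iff_of_pos_left h3).1 h2)

theorem sigNeg_eq_sigPos_neg (M : Matrix (Fin N) (Fin N) ℝ) :
    sigNeg M.toQuadraticForm' = sigPos (-M).toQuadraticForm' := by
  rw [← sigPos_neg]
  congr 1
  ext v
  rw [_root_.neg_apply, toQuadraticForm'_apply, toQuadraticForm'_apply, Matrix.neg_mulVec,
    dotProduct_neg]

theorem isOpen_indexSet (k : ℕ) : IsOpen (indexSet N k) := by
  rcases le_or_gt k N with hk | hk
  · rw [indexSet_eq hk]
    refine IsOpen.inter ?_ (isOpen_le_sigPos _ continuous_matri _)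
    simp only [sigNeg_eq_sigPos_neg]
    exact isOpen_le_sigPos _ continuous_matri.neg _
  · have : indexSet N k = ∅ := by
      ext x
      have := negIndex_le x
      simp only [indexSet, Set.mem_ofPred_eq, Set.mem_empty_iff_false, iff_false, not_and]
      omega
    rw [this]
    exact isOpen_empty

/-- **Sylvester's law of inertia** for `indexSet`. -/
theorem mem_indexSet_iff_of_congruent {x y : HessIdx N → ℝ} {B : Matrix (Fin N) (Fin N) ℝ}
    (hB : B.det ≠ 0) (h : matri y = B * matri x * B.transpose) (k : ℕ) :
    y ∈ indexSet N k ↔ x ∈ indexSet N k := by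
  have he := equivalent_of_congruent (matri x) B hB
  rw [← h] at he
  simp only [indexSet, Set.mem_ofPred_eq, negIndex_eq_sigNeg, he.sigNeg_eq, det_matri_ne_zero_iff,
    he.sigPos_eq]

/-- A symmetric matrix that is negative definite on a coordinate hyperplane has at least `n`
negative eigenvalues. -/
theorem le_negIndex_of_neg_on_hyperplane {n : ℕ} (x : HessIdx (n + 1) → ℝ)
    (h : ∀ v : Fin (n + 1) → ℝ, v 0 = 0 → v ≠ 0 → v ⬝ᵥ (matri x).mulVec v < 0) :
    n ≤ negIndex x := by
  rw [negIndex_eq_sigNeg]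
  set V : Submodule ℝ (Fin (n + 1) → ℝ) := LinearMap.ker (LinearMap.proj 0) with hV
  have h1 : ((-(matri x).toQuadraticForm').restrict V).PosDef := by
    intro v hv
    rw [QuadraticMap.restrict_apply, _root_.neg_apply, toQuadraticForm'_apply]
    have := h v (LinearMap.mem_ker.1 v.2) (by simpa using hv)
    linarith
  refine le_trans ?_ (le_sigNeg_of_negDef _ h1)
  have h2 := LinearMap.finrank_range_add_finrank_ker
    (LinearMap.proj 0 : (Fin (n + 1) → ℝ) →ₗ[ℝ] ℝ)
  have h3 : LinearMap.range (LinearMap.proj 0 : (Fin (n + 1) → ℝ) →ₗ[ℝ] ℝ) = ⊤ :=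
    LinearMap.range_eq_top.2 (LinearMap.proj_surjective 0)
  rw [h3, finrank_top, Module.finrank_self, Module.finrank_fin_fun, ← hV] at h2
  omega

theorem mem_indexSet_of_negDef {x : HessIdx N → ℝ}
    (h : ∀ v : Fin N → ℝ, v ≠ 0 → v ⬝ᵥ (matri x).mulVec v < 0) : x ∈ indexSet N N := by
  have h1 : ((-(matri x).toQuadraticForm').restrict ⊤).PosDef := by
    intro v hv
    rw [QuadraticMap.restrict_apply, _root_.neg_apply, toQuadraticForm'_apply]
    have := h v (by simpa using hv)
    linarith
  have h2 := le_sigNeg_of_negDef _ h1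
  rw [finrank_top, Module.finrank_fin_fun] at h2
  rw [indexSet_eq le_rfl]
  exact ⟨h2, by simp⟩

theorem mem_indexSet_negIndex {x : HessIdx N → ℝ} (h : (matri x).det ≠ 0) :
    x ∈ indexSet N (negIndex x) := ⟨h, rfl⟩

end CritPair

namespace CritPair

/-! ### Centered Gaussian laws as images of the standard Gaussian law -/

section GaussLaw

set_option linter.unusedSectionVars false

variable {ι κ : Type*} [Fintype ι] [Fintype κ] [DecidableEq ι] [DecidableEq κ]

/-- The standard Gaussian law on `ι → ℝ`. -/
noncomputable def gaussPi (ι : Type*) [Fintype ι] : Measure (ι → ℝ) :=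
  Measure.pi fun _ => gaussianReal 0 1

instance : IsProbabilityMeasure (gaussPi ι) := by unfold gaussPi; infer_instance

instance : IsGaussian (gaussPi ι) := by
  have h : gaussPi ι = (stdGaussian (EuclideanSpace ℝ ι)).map
      (PiLp.continuousLinearEquiv 2 ℝ fun _ : ι => ℝ) := by
    rw [← map_pi_eq_stdGaussian, Measure.map_map (by fun_prop) (by fun_prop)]
    exact Measure.map_id.symm
  rw [h]
  exact isGaussian_map_equiv _

theorem gaussPi_eq_withDensity : gaussPi ι =
    volume.withDensity fun x => ENNReal.ofReal (∏ i, gaussianPDFReal 0 1 (x i)) := by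
  refine Measure.pi_eq fun s hs => ?_
  rw [withDensity_apply _ (MeasurableSet.univ_pi hs)]
  have hint : Integrable (fun x : ι → ℝ => ∏ i, gaussianPDFReal 0 1 (x i)) :=
    Integrable.fintype_prod fun _ => integrable_gaussianPDFReal 0 1
  rw [← ofReal_integral_eq_lintegral_ofReal hint.integrableOn
    (ae_of_all _ fun x => Finset.prod_nonneg fun i _ => gaussianPDFReal_nonneg _ _ _),
    ← integral_indicator (MeasurableSet.univ_pi hs)]
  have h1 : (Set.univ.pi s).indicator (fun x : ι → ℝ => ∏ i, gaussianPDFReal 0 1 (x i)) =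
      fun x => ∏ i, (s i).indicator (gaussianPDFReal 0 1) (x i) := by
    ext x
    by_cases hx : x ∈ Set.univ.pi s
    · rw [Set.indicator_of_mem hx]
      exact Finset.prod_congr rfl fun i _ =>
        (Set.indicator_of_mem (hx i (Set.mem_univ i)) _).symm
    · rw [Set.indicator_of_notMem hx]
      simp only [Set.mem_univ_pi, not_forall] at hx
      obtain ⟨i, hi⟩ := hx
      exact (Finset.prod_eq_zero (Finset.mem_univ i) (Set.indicator_of_notMem hi _)).symm
  rw [h1, integral_fintype_prod_volume_eq_prod
    (f := fun i y => (s i).indicator (gaussianPDFReal 0 1) y)]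
  rw [ENNReal.ofReal_prod_of_nonneg]
  · refine Finset.prod_congr rfl fun i _ => ?_
    rw [integral_indicator (hs i), ← gaussianReal_apply_eq_integral 0 one_ne_zero]
  · exact fun i _ => integral_nonneg fun y => Set.indicator_nonneg
      (fun z _ => gaussianPDFReal_nonneg _ _ _) _

theorem gaussPi_absolutelyContinuous : gaussPi ι ≪ volume := by
  rw [gaussPi_eq_withDensity]
  exact withDensity_absolutelyContinuous _ _

theorem integral_gaussPi (f : (ι → ℝ) → ℝ) :
    ∫ x, f x ∂gaussPi ι = ∫ x, (∏ i, gaussianPDFReal 0 1 (x i)) * f x := by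
  have hm : Measurable fun x : ι → ℝ => ENNReal.ofReal (∏ i, gaussianPDFReal 0 1 (x i)) := by
    refine ENNReal.measurable_ofReal.comp (Finset.measurable_fun_prod _ fun i _ => ?_)
    exact (measurable_gaussianPDFReal 0 1).comp (measurable_pi_apply i)
  rw [gaussPi_eq_withDensity, integral_withDensity_eq_integral_toReal_smul hm
    (ae_of_all _ fun x => ENNReal.ofReal_lt_top)]
  refine integral_congr_ae (ae_of_all _ fun x => ?_)
  simp only [smul_eq_mul]
  rw [ENNReal.toReal_ofReal (Finset.prod_nonneg fun i _ => gaussianPDFReal_nonneg _ _ _)]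

theorem prod_gaussianPDFReal (x : ι → ℝ) : ∏ i, gaussianPDFReal 0 1 (x i) =
    (Real.sqrt ((2 * Real.pi) ^ Fintype.card ι))⁻¹ * Real.exp (-(1 / 2) * (x ⬝ᵥ x)) := by
  simp only [gaussianPDFReal, NNReal.coe_one, mul_one, sub_zero]
  rw [Finset.prod_mul_distrib, Finset.prod_const, Finset.card_univ, ← Real.exp_sum, inv_pow,
    Real.sqrt_eq_rpow, Real.sqrt_eq_rpow, ← Real.rpow_natCast_mul (by positivity),
    ← Real.rpow_mul_natCast (by positivity), mul_comm (1 / 2 : ℝ)]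
  congr 2
  rw [dotProduct, Finset.mul_sum]
  exact Finset.sum_congr rfl fun i _ => by ring

open scoped MatrixOrder in
theorem exists_mul_transpose_eq {C : Matrix ι ι ℝ} (hC : C.PosSemidef) :
    ∃ A : Matrix ι ι ℝ, A * A.transpose = C := by
  obtain ⟨B, hB⟩ := CStarAlgebra.nonneg_iff_eq_star_mul_self.mp hC.nonneg
  refine ⟨B.transpose, ?_⟩
  rw [hB, Matrix.transpose_transpose, Matrix.star_eq_conjTranspose,
    Matrix.conjTranspose_eq_transpose_of_trivial]

theorem charFunDual_gaussianReal (L : StrongDual ℝ ℝ) :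
    charFunDual (gaussianReal 0 1) L = Complex.exp (-((L 1) ^ 2 : ℝ) / 2) := by
  have h : charFunDual (gaussianReal 0 1) L = charFun (gaussianReal 0 1) (L 1) := by
    rw [charFunDual_apply, charFun_apply_real]
    refine integral_congr_ae (ae_of_all _ fun x => ?_)
    have : L x = L 1 * x := by
      conv_lhs => rw [← mul_one x, ← smul_eq_mul, map_smul, smul_eq_mul, mul_comm]
    simp only [this, Complex.ofReal_mul]
  rw [h, charFun_gaussianReal]
  congr 1
  push_cast
  simp
  ring

/-- The characteristic function sees B only through B Bᵀ. This frees all later arguments from the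
choice of a square root of the covariance. -/
theorem charFunDual_map_mulVec (B : Matrix ι κ ℝ) (L : StrongDual ℝ (ι → ℝ)) :
    charFunDual ((gaussPi κ).map B.mulVec) L =
      Complex.exp (-((fun i => L (Pi.single i 1)) ⬝ᵥ
        (B * B.transpose).mulVec fun i => L (Pi.single i 1) : ℝ) / 2) := by
  have h0 : B.mulVec = ⇑(LinearMap.toContinuousLinearMap B.mulVecLin) := rfl
  rw [h0, charFunDual_map, gaussPi, charFunDual_pi]
  set l : ι → ℝ := fun i => L (Pi.single i 1) with hl
  have hL : ∀ w, L w = l ⬝ᵥ w := by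
    intro w
    conv_lhs => rw [pi_eq_sum_univ' w]
    rw [map_sum, dotProduct]
    refine Finset.sum_congr rfl fun i _ => ?_
    rw [map_smul, smul_eq_mul, mul_comm]
  have h1 : ∀ j, charFunDual (gaussianReal 0 1)
      ((L ∘L LinearMap.toContinuousLinearMap B.mulVecLin) ∘L
        ContinuousLinearMap.single ℝ (fun _ : κ => ℝ) j)
      = Complex.exp (-(((B.transpose.mulVec l) j) ^ 2 : ℝ) / 2) := by
    intro j
    rw [charFunDual_gaussianReal]
    congr 4
    simp only [ContinuousLinearMap.comp_apply, LinearMap.coe_toContinuousLinearMap',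
      Matrix.mulVecLin_apply, ContinuousLinearMap.single_apply, hL, Matrix.mulVec_single_one,
      Matrix.mulVec]
    rw [dotProduct_comm]
    rfl
  simp_rw [h1]
  rw [← Complex.exp_sum]
  congr 1
  rw [← Matrix.mulVec_mulVec, Matrix.dotProduct_mulVec, ← Matrix.mulVec_transpose, dotProduct]
  push_cast
  rw [← Finset.sum_div, Finset.sum_neg_distrib]
  congr 2
  exact Finset.sum_congr rfl fun j _ => by ring

/-- The two matrices may have different numbers of columns; this is used for one-dimensional
marginals and for splitting off an independent direction. -/
theorem map_mulVec_gaussPi_congr {κ' : Type*} [Fintype κ'] [DecidableEq κ'] {B : Matrix ι κ ℝ}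
    {B' : Matrix ι κ' ℝ} (h : B * B.transpose = B' * B'.transpose) :
    (gaussPi κ).map B.mulVec = (gaussPi κ').map B'.mulVec := by
  have hB : Measurable B.mulVec := (Continuous.matrix_mulVec continuous_const continuous_id).measurable
  have hB' : Measurable B'.mulVec :=
    (Continuous.matrix_mulVec continuous_const continuous_id).measurable
  have := Measure.isProbabilityMeasure_map (μ := gaussPi κ) hB.aemeasurable
  have := Measure.isProbabilityMeasure_map (μ := gaussPi κ') hB'.aemeasurable
  refine Measure.ext_of_charFunDual (funext fun L => ?_)
  rw [charFunDual_map_mulVec, charFunDual_map_mulVec, h]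

open Classical in
/-- A square root of a positive semidefinite matrix. -/
noncomputable def factor (C : Matrix ι ι ℝ) : Matrix ι ι ℝ :=
  -- With the default value 0, `gaussLaw C` is a Dirac mass when C is not positive semidefinite, so
  -- it is a probability measure for every C.
  if h : ∃ A : Matrix ι ι ℝ, A * A.transpose = C then h.choose else 0

theorem factor_mul_transpose {C : Matrix ι ι ℝ} (hC : C.PosSemidef) :
    factor C * (factor C).transpose = C := by
  have h := exists_mul_transpose_eq hC
  rw [factor, dif_pos h]
  exact h.choose_spec

/-- The centered Gaussian law with covariance matrix `C`. -/
noncomputable def gaussLaw (C : Matrix ι ι ℝ) : Measure (ι → ℝ) :=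
  (gaussPi ι).map (factor C).mulVec

theorem measurable_mulVec (B : Matrix ι κ ℝ) : Measurable B.mulVec :=
  (Continuous.matrix_mulVec continuous_const continuous_id).measurable

instance (C : Matrix ι ι ℝ) : IsProbabilityMeasure (gaussLaw C) :=
  Measure.isProbabilityMeasure_map (measurable_mulVec _).aemeasurable

theorem gaussLaw_eq_map {C : Matrix ι ι ℝ} {B : Matrix ι κ ℝ} (h : B * B.transpose = C) :
    gaussLaw C = (gaussPi κ).map B.mulVec := by
  have hC : C.PosSemidef := by
    rw [← h]
    simpa using Matrix.posSemidef_self_mul_conjTranspose B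
  exact map_mulVec_gaussPi_congr (by rw [factor_mul_transpose hC, h])

theorem integral_gaussLaw {C : Matrix ι ι ℝ} {B : Matrix ι κ ℝ} (h : B * B.transpose = C)
    {F : (ι → ℝ) → ℝ} (hF : Measurable F) :
    ∫ w, F w ∂gaussLaw C = ∫ x, F (B.mulVec x) ∂gaussPi κ := by
  rw [gaussLaw_eq_map h, integral_map (measurable_mulVec _).aemeasurable
    hF.aestronglyMeasurable]

/-- Change of variables w = B x with |det B| = √(det C). It connects the densities in `critDensity`
with `gaussLaw`, which still makes sense for the singular limit covariance. -/
theorem integral_gaussLaw_of_posDef {C : Matrix ι ι ℝ} (hC : C.PosDef) {F : (ι → ℝ) → ℝ}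
    (hF : Measurable F) :
    ∫ w, F w ∂gaussLaw C = ∫ w, F w * gaussDensity C w := by
  have hB := factor_mul_transpose hC.posSemidef
  set B := factor C
  have hdet : C.det = B.det ^ 2 := by rw [← hB, Matrix.det_mul, Matrix.det_transpose, sq]
  have hB0 : B.det ≠ 0 := by
    intro h0
    have := hC.det_pos
    rw [hdet, h0] at this
    norm_num at this
  have hBu : IsUnit B.det := isUnit_iff_ne_zero.2 hB0
  have hG : Measurable fun w : ι → ℝ => (∏ i, gaussianPDFReal 0 1 (B⁻¹.mulVec w i)) * F w := by
    refine Measurable.mul (Finset.measurable_fun_prod _ fun i _ => ?_) hF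
    exact (measurable_gaussianPDFReal 0 1).comp
      ((measurable_pi_apply i).comp (measurable_mulVec _))
  have h1 : ∫ x, F (B.mulVec x) ∂gaussPi ι = ∫ x, (fun w : ι → ℝ =>
      (∏ i, gaussianPDFReal 0 1 (B⁻¹.mulVec w i)) * F w) (B.mulVec x) := by
    rw [integral_gaussPi]
    refine integral_congr_ae (ae_of_all _ fun x => ?_)
    simp only [Matrix.mulVec_mulVec, Matrix.nonsing_inv_mul B hBu, Matrix.one_mulVec]
  rw [integral_gaussLaw hB hF, h1,
    ← integral_map (μ := volume) (measurable_mulVec B).aemeasurable hG.aestronglyMeasurable,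
    show B.mulVec = ⇑(Matrix.toLin' B) from rfl,
    Real.map_matrix_volume_pi_eq_smul_volume_pi hB0, integral_smul_measure,
    ENNReal.toReal_ofReal (abs_nonneg _), ← integral_smul]
  refine integral_congr_ae (ae_of_all _ fun w => ?_)
  simp only [smul_eq_mul]
  rw [prod_gaussianPDFReal, gaussDensity, hdet]
  have h2 : C⁻¹ = B⁻¹.transpose * B⁻¹ := by
    rw [← hB, Matrix.mul_inv_rev, Matrix.transpose_nonsing_inv]
  have h3 : B⁻¹.mulVec w ⬝ᵥ B⁻¹.mulVec w = w ⬝ᵥ C⁻¹.mulVec w := by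
    rw [h2, ← Matrix.mulVec_mulVec, Matrix.dotProduct_mulVec w, Matrix.vecMul_transpose]
  rw [h3, Real.sqrt_mul (by positivity), Real.sqrt_sq_eq_abs, mul_inv, abs_inv]
  ring

/-! ### Integrability and weak continuity -/

/-- Fernique's theorem provides an integrable exp(C‖x‖²), and completing the square dominates the
linear exponent. -/
theorem integrable_exp_norm_gaussPi (c : ℝ) : Integrable (fun x => Real.exp (c * ‖x‖)) (gaussPi ι) := by
  obtain ⟨C, hC, hi⟩ := IsGaussian.exists_integrable_exp_sq (gaussPi ι)
  refine (hi.const_mul (Real.exp (c ^ 2 / (4 * C)))).mono'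
    (by fun_prop) (ae_of_all _ fun x => ?_)
  rw [Real.norm_eq_abs, abs_of_pos (Real.exp_pos _), ← Real.exp_add, Real.exp_le_exp]
  have h : c ^ 2 / (4 * C) + C * ‖x‖ ^ 2 - c * ‖x‖ = (c - 2 * C * ‖x‖) ^ 2 / (4 * C) := by
    field_simp
    ring
  have h2 : 0 ≤ (c - 2 * C * ‖x‖) ^ 2 / (4 * C) := by positivity
  linarith

theorem one_add_pow_le_exp {y : ℝ} (hy : 0 ≤ y) (m : ℕ) : (1 + y) ^ m ≤ Real.exp (m * y) := by
  rw [Real.exp_nat_mul]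
  exact pow_le_pow_left₀ (by linarith) (by linarith [Real.add_one_le_exp y]) _

theorem norm_mulVec_le_of_entries {B : Matrix ι κ ℝ} {K : ℝ} (hK : ∀ i j, |B i j| ≤ K)
    (hK0 : 0 ≤ K) (x : κ → ℝ) : ‖B.mulVec x‖ ≤ K * Fintype.card κ * ‖x‖ := by
  rw [pi_norm_le_iff_of_nonneg (by positivity)]
  intro i
  rw [Matrix.mulVec, dotProduct, Real.norm_eq_abs]
  refine (Finset.abs_sum_le_sum_abs _ _).trans ?_
  have : ∀ j ∈ Finset.univ, |B i j * x j| ≤ K * ‖x‖ := fun j _ => by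
    rw [abs_mul]
    exact mul_le_mul (hK i j) (norm_le_pi_norm x j) (abs_nonneg _) hK0
  refine (Finset.sum_le_sum this).trans ?_
  rw [Finset.sum_const, Finset.card_univ, nsmul_eq_mul]
  linarith

/-- The square of an entry is at most C i i, and |a| ≤ 1 + a². Bounded covariances therefore have
bounded square roots. -/
theorem abs_entry_le_of_mul_transpose {A : Matrix ι κ ℝ} {C : Matrix ι ι ℝ}
    (h : A * A.transpose = C) (i : ι) (j : κ) : |A i j| ≤ 1 + C i i := by
  have h1 : A i j ^ 2 ≤ C i i := by
    rw [← h, Matrix.mul_apply]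
    simp only [Matrix.transpose_apply, ← sq]
    exact Finset.single_le_sum (f := fun k => A i k ^ 2) (fun k _ => sq_nonneg _)
      (Finset.mem_univ j)
  have h2 : |A i j| ^ 2 = A i j ^ 2 := sq_abs _
  nlinarith [abs_nonneg (A i j), sq_nonneg (|A i j| - 1)]

/-- Weak continuity of centered Gaussian laws in the covariance matrix, against functions of
polynomial growth that are almost everywhere continuous for the limit law. -/
theorem tendsto_integral_gaussLaw {α : Type*} {l : Filter α} [l.IsCountablyGenerated]
    {C : α → Matrix ι ι ℝ} {C₀ : Matrix ι ι ℝ} (hC : Tendsto C l (𝓝 C₀))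
    (hpos : ∀ᶠ a in l, (C a).PosSemidef) {F : (ι → ℝ) → ℝ} (hF : Measurable F) {K : ℝ} {m : ℕ}
    (hb : ∀ w, |F w| ≤ K * (1 + ‖w‖) ^ m) (hc : ∀ᵐ w ∂gaussLaw C₀, ContinuousAt F w) :
    Tendsto (fun a => ∫ w, F w ∂gaussLaw (C a)) l (𝓝 (∫ w, F w ∂gaussLaw C₀)) := by
  -- The chosen square roots need not depend continuously on the covariance. Being bounded, they
  -- converge along a subsequence to some A with A Aᵀ = C₀, and any such A represents the limit law.
  refine tendsto_of_subseq_tendsto fun ns hns => ?_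
  have hCn : Tendsto (fun n => C (ns n)) atTop (𝓝 C₀) := hC.comp hns
  obtain ⟨n₀, hn₀⟩ := (eventually_atTop.1 (hns.eventually hpos))
  have hKex : ∃ K' : ℝ, 0 ≤ K' ∧ ∀ n ≥ n₀, ∀ i j, |factor (C (ns n)) i j| ≤ K' := by
    have h1 : ∀ i, ∃ k : ℝ, ∀ n, C (ns n) i i ≤ k := fun i => by
      have : Tendsto (fun n => C (ns n) i i) atTop (𝓝 (C₀ i i)) :=
        ((continuous_apply_apply i i).tendsto C₀).comp hCn
      obtain ⟨k, hk⟩ := this.bddAbove_range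
      exact ⟨k, fun n => hk ⟨n, rfl⟩⟩
    choose k hk using h1
    refine ⟨∑ i, (1 + |k i|), by positivity, fun n hn i j => ?_⟩
    refine (abs_entry_le_of_mul_transpose (factor_mul_transpose (hn₀ n hn)) i j).trans ?_
    refine le_trans ?_ (Finset.single_le_sum (f := fun i => 1 + |k i|) (fun k _ => by positivity)
      (Finset.mem_univ i))
    have := hk i n
    have := le_abs_self (k i)
    linarith
  obtain ⟨K', hK'0, hK'⟩ := hKex
  have hcomp : IsCompact (Set.pi Set.univ fun _ : ι => Set.pi Set.univ fun _ : ι =>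
      Set.Icc (-K') K') := isCompact_univ_pi fun _ => isCompact_univ_pi fun _ => isCompact_Icc
  obtain ⟨A₁, -, φ, hφ, hA₁⟩ := hcomp.tendsto_subseq (x := fun n => (fun i j => factor (C (ns (n + n₀))) i j : ι → ι → ℝ))
    (fun n i _ j _ => abs_le.1 (hK' _ (by omega) i j))
  set A : Matrix ι ι ℝ := A₁
  have hA : Tendsto (fun n => factor (C (ns (φ n + n₀)))) atTop (𝓝 A) := hA₁
  have hAA : A * A.transpose = C₀ := by
    have h1 : Tendsto (fun n => factor (C (ns (φ n + n₀))) *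
        (factor (C (ns (φ n + n₀)))).transpose) atTop (𝓝 (A * A.transpose)) := by
      have hcont : Continuous fun M : Matrix ι ι ℝ => M * M.transpose :=
        continuous_id.matrix_mul continuous_id.matrix_transpose
      exact (hcont.tendsto A).comp hA
    have h2 : Tendsto (fun n => C (ns (φ n + n₀))) atTop (𝓝 C₀) :=
      hCn.comp ((tendsto_add_atTop_nat n₀).comp hφ.tendsto_atTop)
    refine tendsto_nhds_unique h1 (h2.congr fun n => ?_)
    rw [factor_mul_transpose (hn₀ _ (by omega))]
  refine ⟨fun n => φ n + n₀, ?_⟩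
  rw [integral_gaussLaw hAA hF]
  have hcong : ∀ n, ∫ w, F w ∂gaussLaw (C (ns (φ n + n₀))) =
      ∫ x, F ((factor (C (ns (φ n + n₀)))).mulVec x) ∂gaussPi ι := fun n =>
    integral_gaussLaw (factor_mul_transpose (hn₀ _ (by omega))) hF
  simp_rw [hcong]
  set M : ℝ := K' * Fintype.card ι with hM
  -- Polynomial growth is dominated by exp(m M ‖x‖), uniformly over the bounded square roots.
  refine tendsto_integral_of_dominated_convergence
    (fun x => |K| * Real.exp (m * M * ‖x‖)) (fun n =>
      (hF.comp (measurable_mulVec _)).aestronglyMeasurable)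
    ((integrable_exp_norm_gaussPi _).const_mul _) (fun n => ae_of_all _ fun x => ?_) ?_
  · rw [Real.norm_eq_abs]
    refine (hb _).trans ?_
    have h1 := norm_mulVec_le_of_entries (hK' (φ n + n₀) (by omega)) hK'0 x
    rw [← hM] at h1
    have h2 := one_add_pow_le_exp
      (norm_nonneg ((factor (C (ns (φ n + n₀)))).mulVec x)) m
    refine mul_le_mul (le_abs_self K) (h2.trans ?_) (by positivity) (abs_nonneg _)
    rw [Real.exp_le_exp, mul_assoc]
    exact mul_le_mul_of_nonneg_left h1 (by positivity)
  · rw [gaussLaw_eq_map hAA] at hc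
    have hc' := ae_of_ae_map (measurable_mulVec _).aemeasurable hc
    filter_upwards [hc'] with x hx
    have hcont : Continuous fun M : Matrix ι ι ℝ => M.mulVec x :=
      continuous_id.matrix_mulVec continuous_const
    exact hx.tendsto.comp ((hcont.tendsto A).comp hA)

end GaussLaw

end CritPair

namespace CritPair

/-! ### Gaussian integrals over matrices of given index -/

variable {N : ℕ}

/-- The Hessian part of a vector. -/
abbrev hessPart (w : MainIdx N → ℝ) : HessIdx N → ℝ := fun p => w (Sum.inl p)

/-- The set of vectors `(x'', x, z)` with `x, z > u` and `x''` of index `k`. -/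
def critSet (N : ℕ) (u : ℝ) (k : ℕ) : Set (MainIdx N → ℝ) :=
  {w | u < w (Sum.inr 0) ∧ u < w (Sum.inr 1) ∧ hessPart w ∈ indexSet N k}

/-- `|det x''|` on `critSet`, extended by zero. -/
noncomputable def critFun (u : ℝ) (k : ℕ) : (MainIdx N → ℝ) → ℝ :=
  (critSet N u k).indicator fun w => |(matri (hessPart w)).det|

/-- The integral of `critFun` against the centered Gaussian law with covariance matrix `C`. -/
noncomputable def critInt (u : ℝ) (k : ℕ) (C : Matrix (MainIdx N) (MainIdx N) ℝ) : ℝ :=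
  ∫ w, critFun u k w ∂gaussLaw C

/-- The ratio of the integrals over index at most `N - 2` and over index `N - 1` or `N`. -/
noncomputable def critRatio (u : ℝ) (C : Matrix (MainIdx N) (MainIdx N) ℝ) : ℝ :=
  (∑ k ∈ Finset.range (N - 1), critInt u k C) / (critInt u (N - 1) C + critInt u N C)

theorem continuous_hessPart : Continuous (hessPart : (MainIdx N → ℝ) → HessIdx N → ℝ) :=
  continuous_pi fun _ => continuous_apply _

theorem continuous_det_hessPart :
    Continuous fun w : MainIdx N → ℝ => (matri (hessPart w)).det :=
  (continuous_matri.comp continuous_hessPart).matrix_det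

theorem isOpen_critSet (u : ℝ) (k : ℕ) : IsOpen (critSet N u k) := by
  refine (isOpen_lt continuous_const (continuous_apply _)).inter
    ((isOpen_lt continuous_const (continuous_apply _)).inter ?_)
  exact (isOpen_indexSet k).preimage continuous_hessPart

theorem measurable_critFun (u : ℝ) (k : ℕ) : Measurable (critFun (N := N) u k) :=
  continuous_det_hessPart.abs.measurable.indicator (isOpen_critSet u k).measurableSet

theorem critFun_nonneg (u : ℝ) (k : ℕ) (w : MainIdx N → ℝ) : 0 ≤ critFun u k w :=
  Set.indicator_nonneg (fun _ _ => abs_nonneg _) _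

theorem abs_det_le (w : MainIdx N → ℝ) :
    |(matri (hessPart w)).det| ≤ N.factorial * (1 + ‖w‖) ^ N := by
  have := Matrix.det_le (A := matri (hessPart w)) (abv := AbsoluteValue.abs) (x := 1 + ‖w‖)
    (fun i j => by
      have h1 : ‖w (Sum.inl ⟨(min i j, max i j), min_le_max⟩)‖ ≤ ‖w‖ := norm_le_pi_norm w _
      rw [Real.norm_eq_abs] at h1
      simp only [AbsoluteValue.abs_apply, matri, Matrix.of_apply]
      linarith)
  simpa [nsmul_eq_mul] using this

theorem critFun_le (u : ℝ) (k : ℕ) (w : MainIdx N → ℝ) :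
    critFun u k w ≤ |(matri (hessPart w)).det| :=
  Set.indicator_le_self' (fun _ _ => abs_nonneg _) _

theorem abs_critFun_le (u : ℝ) (k : ℕ) (w : MainIdx N → ℝ) :
    |critFun u k w| ≤ N.factorial * (1 + ‖w‖) ^ N := by
  rw [abs_of_nonneg (critFun_nonneg _ _ _)]
  exact (critFun_le u k w).trans (abs_det_le w)

theorem integrable_critFun (u : ℝ) (k : ℕ) {C : Matrix (MainIdx N) (MainIdx N) ℝ}  :
    Integrable (critFun u k) (gaussLaw C) := by
  rw [gaussLaw, integrable_map_measure (measurable_critFun u k).aestronglyMeasurable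
    (measurable_mulVec _).aemeasurable]
  set K := ∑ i, ∑ j, |factor C i j|
  have hK : ∀ i j, |factor C i j| ≤ K := fun i j =>
    (Finset.single_le_sum (f := fun j => |factor C i j|) (fun _ _ => abs_nonneg _)
      (Finset.mem_univ j)).trans (Finset.single_le_sum (f := fun i => ∑ j, |factor C i j|)
        (fun _ _ => Finset.sum_nonneg fun _ _ => abs_nonneg _) (Finset.mem_univ i))
  have hK0 : 0 ≤ K := Finset.sum_nonneg fun _ _ => Finset.sum_nonneg fun _ _ => abs_nonneg _
  refine ((integrable_exp_norm_gaussPi (N * (K * Fintype.card (MainIdx N)))).const_mul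
    (N.factorial : ℝ)).mono'
    ((measurable_critFun u k).comp (measurable_mulVec _)).aestronglyMeasurable
    (ae_of_all _ fun x => ?_)
  rw [Function.comp_apply, Real.norm_eq_abs]
  refine (abs_critFun_le _ _ _).trans (mul_le_mul_of_nonneg_left ?_ (by positivity))
  refine (one_add_pow_le_exp (norm_nonneg _) N).trans (Real.exp_le_exp.2 ?_)
  rw [mul_assoc]
  exact mul_le_mul_of_nonneg_left (norm_mulVec_le_of_entries hK hK0 x) (by positivity)

/-- The index is locally constant off the singular matrices, so the indicator can jump only where
the determinant vanishes or a value equals u. -/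
theorem continuousAt_critFun (u : ℝ) (k : ℕ) {w : MainIdx N → ℝ}
    (hdet : (matri (hessPart w)).det ≠ 0) (h0 : w (Sum.inr 0) ≠ u) (h1 : w (Sum.inr 1) ≠ u) :
    ContinuousAt (critFun u k) w := by
  have hcd := continuous_det_hessPart (N := N)
  by_cases hw : w ∈ critSet N u k
  · have h : critFun u k =ᶠ[𝓝 w] fun w => |(matri (hessPart w)).det| := by
      filter_upwards [(isOpen_critSet u k).mem_nhds hw] with w' hw'
      exact Set.indicator_of_mem hw' _
    exact (continuousAt_congr h).2 hcd.abs.continuousAt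
  · have h : critFun u k =ᶠ[𝓝 w] fun _ => 0 := by
      have hopen : ∀ᶠ w' in 𝓝 w, w' ∉ critSet N u k := by
        rcases lt_or_gt_of_ne h0 with h | h
        · filter_upwards [((continuous_apply (Sum.inr 0)).tendsto w).eventually_lt_const h]
            with w' hw' hmem
          exact lt_asymm hw' hmem.1
        rcases lt_or_gt_of_ne h1 with h' | h'
        · filter_upwards [((continuous_apply (Sum.inr 1)).tendsto w).eventually_lt_const h']
            with w' hw' hmem
          exact lt_asymm hw' hmem.2.1
        have hk : negIndex (hessPart w) ≠ k := fun hk => hw ⟨h, h', hdet, hk⟩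
        filter_upwards [continuous_hessPart.continuousAt.preimage_mem_nhds
          ((isOpen_indexSet _).mem_nhds (mem_indexSet_negIndex hdet))] with w' hw' hmem
        exact hk (hw'.2.symm.trans hmem.2.2.2)
      filter_upwards [hopen] with w' hw'
      exact Set.indicator_of_notMem hw' _
    exact (continuousAt_congr h).2 continuousAt_const

/-- A covariance matrix whose Gaussian law charges every neighbourhood of some vector
`(x'', x, z)` with `x''` negative definite and `x, z > 0`. -/
def ChargesMaxima (C : Matrix (MainIdx N) (MainIdx N) ℝ) : Prop :=
  C.PosSemidef ∧ ∃ v : MainIdx N → ℝ, 0 < C.mulVec v (Sum.inr 0) ∧ 0 < C.mulVec v (Sum.inr 1) ∧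
    ∀ e : Fin N → ℝ, e ≠ 0 → e ⬝ᵥ (matri (hessPart (C.mulVec v))).mulVec e < 0

theorem matri_add_smul (x y : HessIdx N → ℝ) (c : ℝ) :
    matri (x + c • y) = matri x + c • matri y := by
  ext i j
  simp [matri]

theorem det_ne_zero_of_neg {M : Matrix (Fin N) (Fin N) ℝ}
    (h : ∀ e : Fin N → ℝ, e ≠ 0 → e ⬝ᵥ M.mulVec e < 0) : M.det ≠ 0 := by
  intro h0
  obtain ⟨v, hv, hv0⟩ := Matrix.exists_mulVec_eq_zero_iff.2 h0
  have := h v hv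
  simp [hv0] at this

/-- det(A + y M) is a polynomial in y whose coefficient of degree N is det M. -/
theorem finite_setOf_det_add_smul_eq_zero {A M : Matrix (Fin N) (Fin N) ℝ} (hM : M.det ≠ 0) :
    {y : ℝ | (A + y • M).det = 0}.Finite := by
  set p : Polynomial ℝ := Matrix.det ((Polynomial.X : Polynomial ℝ) • M.map Polynomial.C +
    A.map Polynomial.C) with hp
  have hp0 : p ≠ 0 := by
    intro h0
    have := Polynomial.coeff_det_X_add_C_card M A
    rw [← hp, h0, Polynomial.coeff_zero] at this
    exact hM this.symm
  refine (p.rootSet_finite ℝ).subset fun y hy => ?_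
  rw [Polynomial.mem_rootSet]
  refine ⟨hp0, ?_⟩
  rw [Polynomial.aeval_def, Polynomial.eval₂_eq_eval_map, Algebra.algebraMap_self,
    Polynomial.map_id, hp, ← Polynomial.coe_evalRingHom, RingHom.map_det]
  have : (Polynomial.evalRingHom y).mapMatrix ((Polynomial.X : Polynomial ℝ) • M.map Polynomial.C +
      A.map Polynomial.C) = A + y • M := by
    ext i j
    simp [add_comm, mul_comm (M i j)]
  rw [this]
  exact hy

/-- Fubini along the direction ζ that the square root maps to C v: every parallel line meets the
exceptional set in finitely many points, because C v has an invertible Hessian part and nonzero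
value coordinates. No invertibility of C is needed. -/
theorem ae_gaussLaw_of_chargesMaxima {C : Matrix (MainIdx N) (MainIdx N) ℝ}
    (hC : ChargesMaxima C) (u : ℝ) : ∀ᵐ w ∂gaussLaw C,
      (matri (hessPart w)).det ≠ 0 ∧ w (Sum.inr 0) ≠ u ∧ w (Sum.inr 1) ≠ u := by
  obtain ⟨hpos, v, h0, h1, hneg⟩ := hC
  have hA := factor_mul_transpose hpos
  have hS : IsOpen {w : MainIdx N → ℝ | (matri (hessPart w)).det ≠ 0 ∧ w (Sum.inr 0) ≠ u ∧
      w (Sum.inr 1) ≠ u} :=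
    (isOpen_ne_fun continuous_det_hessPart continuous_const).inter
      ((isOpen_ne_fun (continuous_apply _) continuous_const).inter
        (isOpen_ne_fun (continuous_apply _) continuous_const))
  rw [gaussLaw, ae_map_iff (measurable_mulVec _).aemeasurable hS.measurableSet]
  refine gaussPi_absolutelyContinuous.ae_le ?_
  set ζ : MainIdx N → ℝ := (factor C).transpose.mulVec v with hζ
  have hAζ : (factor C).mulVec ζ = C.mulVec v := by rw [hζ, Matrix.mulVec_mulVec, hA]
  refine ae_mem_of_ae_add_linearMap_mem (LinearMap.toSpanSingleton ℝ _ ζ) volume volume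
    (s := {x | _}) (measurable_mulVec (factor C) hS.measurableSet) fun x => ?_
  set a := (factor C).mulVec x with ha
  set b := C.mulVec v with hb
  have hfin : ({y : ℝ | (matri (hessPart a) + y • matri (hessPart b)).det = 0} ∪
      ({y : ℝ | a (Sum.inr 0) + y * b (Sum.inr 0) = u} ∪
        {y : ℝ | a (Sum.inr 1) + y * b (Sum.inr 1) = u})).Finite := by
    refine (finite_setOf_det_add_smul_eq_zero (det_ne_zero_of_neg hneg)).union
      (Set.Finite.union ?_ ?_)
    · refine (Set.finite_singleton ((u - a (Sum.inr 0)) / b (Sum.inr 0))).subset fun y hy => ?_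
      simp only [Set.mem_ofPred_eq] at hy
      rw [Set.mem_singleton_iff, eq_div_iff h0.ne']
      linarith
    · refine (Set.finite_singleton ((u - a (Sum.inr 1)) / b (Sum.inr 1))).subset fun y hy => ?_
      simp only [Set.mem_ofPred_eq] at hy
      rw [Set.mem_singleton_iff, eq_div_iff h1.ne']
      linarith
  filter_upwards [hfin.countable.ae_notMem volume] with y hy
  have hlin : (factor C).mulVec (x + LinearMap.toSpanSingleton ℝ (MainIdx N → ℝ) ζ y) =
      a + y • b := by
    rw [LinearMap.toSpanSingleton_apply, Matrix.mulVec_add, Matrix.mulVec_smul, hAζ]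
  simp only [Set.mem_union, Set.mem_ofPred_eq, not_or] at hy
  change _ ∧ _ ∧ _
  rw [hlin]
  refine ⟨?_, by simpa using hy.2.1, by simpa using hy.2.2⟩
  have : hessPart (a + y • b) = hessPart a + y • hessPart b := rfl
  rw [this, matri_add_smul]
  exact hy.1

theorem critInt_nonneg (u : ℝ) (k : ℕ) (C : Matrix (MainIdx N) (MainIdx N) ℝ) :
    0 ≤ critInt u k C := integral_nonneg (critFun_nonneg u k)

/-- The point c C v lies in the range of the square root, so each of its neighbourhoods has positive
mass. A large c lifts both values above u, while scaling keeps the Hessian negative definite. -/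
theorem critInt_pos_of_chargesMaxima {C : Matrix (MainIdx N) (MainIdx N) ℝ}
    (hC : ChargesMaxima C) (u : ℝ) : 0 < critInt u N C := by
  obtain ⟨hpos, v, h0, h1, hneg⟩ := hC
  have hA := factor_mul_transpose hpos
  rw [critInt, integral_pos_iff_support_of_nonneg (critFun_nonneg u N) (integrable_critFun u N)]
  have h2 : critSet N u N ∩ {w | (matri (hessPart w)).det ≠ 0} ⊆
      Function.support (critFun u N) := by
    rintro w ⟨hw, hd⟩
    rw [Function.mem_support, critFun, Set.indicator_of_mem hw]
    exact abs_ne_zero.2 hd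
  refine lt_of_lt_of_le ?_ (measure_mono h2)
  have hopen : IsOpen (critSet N u N ∩ {w | (matri (hessPart w)).det ≠ 0}) :=
    (isOpen_critSet u N).inter (isOpen_ne_fun continuous_det_hessPart continuous_const)
  rw [gaussLaw, Measure.map_apply (measurable_mulVec _) hopen.measurableSet]
  have hopen' : IsOpen ((factor C).mulVec ⁻¹'
      (critSet N u N ∩ {w | (matri (hessPart w)).det ≠ 0})) :=
    hopen.preimage (Continuous.matrix_mulVec continuous_const continuous_id)
  have hopenpos : (gaussPi (MainIdx N)).IsOpenPosMeasure := by
    have : (gaussianReal 0 1).IsOpenPosMeasure :=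
      (gaussianReal_absolutelyContinuous' 0 one_ne_zero).isOpenPosMeasure
    unfold gaussPi
    infer_instance
  refine hopen'.measure_pos _ ?_
  obtain ⟨c, hc, hc0, hc1⟩ : ∃ c : ℝ, 0 < c ∧ u < c * C.mulVec v (Sum.inr 0) ∧
      u < c * C.mulVec v (Sum.inr 1) := by
    have t0 : ∀ᶠ c : ℝ in atTop, u < c * C.mulVec v (Sum.inr 0) :=
      (tendsto_id.atTop_mul_const h0).eventually_gt_atTop u
    have t1 : ∀ᶠ c : ℝ in atTop, u < c * C.mulVec v (Sum.inr 1) :=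
      (tendsto_id.atTop_mul_const h1).eventually_gt_atTop u
    obtain ⟨c, hc⟩ := ((eventually_gt_atTop 0).and (t0.and t1)).exists
    exact ⟨c, hc⟩
  have hneg' : ∀ e : Fin N → ℝ, e ≠ 0 →
      e ⬝ᵥ (matri (hessPart (c • C.mulVec v))).mulVec e < 0 := by
    intro e he
    have h3 : matri (hessPart (c • C.mulVec v)) = c • matri (hessPart (C.mulVec v)) := by
      ext i j
      simp [matri, hessPart]
    rw [h3, Matrix.smul_mulVec, dotProduct_smul, smul_eq_mul]
    exact mul_neg_of_pos_of_neg hc (hneg e he)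
  refine ⟨(factor C).transpose.mulVec (c • v), ?_⟩
  rw [Set.mem_preimage, Matrix.mulVec_mulVec, hA, Matrix.mulVec_smul]
  exact ⟨⟨by simpa using hc0, by simpa using hc1, mem_indexSet_of_negDef hneg'⟩,
    det_ne_zero_of_neg hneg'⟩

theorem tendsto_critInt {α : Type*} {l : Filter α} [l.IsCountablyGenerated]
    {C : α → Matrix (MainIdx N) (MainIdx N) ℝ} {C₀ : Matrix (MainIdx N) (MainIdx N) ℝ}
    (hC : Tendsto C l (𝓝 C₀)) (hpos : ∀ᶠ a in l, (C a).PosSemidef) (hC₀ : ChargesMaxima C₀)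
    (u : ℝ) (k : ℕ) : Tendsto (fun a => critInt u k (C a)) l (𝓝 (critInt u k C₀)) := by
  refine tendsto_integral_gaussLaw hC hpos (measurable_critFun u k) (abs_critFun_le u k) ?_
  filter_upwards [ae_gaussLaw_of_chargesMaxima hC₀ u] with w hw
  exact continuousAt_critFun u k hw.1 hw.2.1 hw.2.2

theorem tendsto_critRatio {α : Type*} {l : Filter α} [l.IsCountablyGenerated]
    {C : α → Matrix (MainIdx N) (MainIdx N) ℝ} {C₀ : Matrix (MainIdx N) (MainIdx N) ℝ}
    (hC : Tendsto C l (𝓝 C₀)) (hpos : ∀ᶠ a in l, (C a).PosSemidef) (hC₀ : ChargesMaxima C₀)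
    (u : ℝ) : Tendsto (fun a => critRatio u (C a)) l (𝓝 (critRatio u C₀)) := by
  refine Tendsto.div (tendsto_finsetSum _ fun k _ => tendsto_critInt hC hpos hC₀ u k)
    ((tendsto_critInt hC hpos hC₀ u _).add (tendsto_critInt hC hpos hC₀ u _)) ?_
  have := critInt_pos_of_chargesMaxima hC₀ u
  have := critInt_nonneg u (N - 1) C₀
  positivity

/-- Change of variables under a congruence of the Hessian part. -/
theorem critInt_congruence {T : Matrix (MainIdx N) (MainIdx N) ℝ} {B : Matrix (Fin N) (Fin N) ℝ}
    (hB : B.det ≠ 0)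
    (hT : ∀ w, matri (hessPart (T.mulVec w)) = B * matri (hessPart w) * B.transpose)
    (hT' : ∀ w i, T.mulVec w (Sum.inr i) = w (Sum.inr i))
    {C : Matrix (MainIdx N) (MainIdx N) ℝ} (hC : C.PosSemidef) (u : ℝ) (k : ℕ) :
    critInt u k (T * C * T.transpose) = B.det ^ 2 * critInt u k C := by
  have hA := factor_mul_transpose hC
  have hTA : (T * factor C) * (T * factor C).transpose = T * C * T.transpose := by
    rw [Matrix.transpose_mul, ← Matrix.mul_assoc, Matrix.mul_assoc T, hA]
  rw [critInt, critInt, integral_gaussLaw hTA (measurable_critFun u k),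
    integral_gaussLaw hA (measurable_critFun u k), ← integral_const_mul]
  refine integral_congr_ae (ae_of_all _ fun x => ?_)
  simp only
  rw [← Matrix.mulVec_mulVec]
  set w := (factor C).mulVec x
  have hmem : T.mulVec w ∈ critSet N u k ↔ w ∈ critSet N u k := by
    simp only [critSet, Set.mem_ofPred_eq, hT', mem_indexSet_iff_of_congruent hB (hT w)]
  have hd : |(matri (hessPart (T.mulVec w))).det| = B.det ^ 2 * |(matri (hessPart w)).det| := by
    rw [hT, Matrix.det_mul, Matrix.det_mul, Matrix.det_transpose, abs_mul, abs_mul,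
      mul_right_comm, abs_mul_abs_self, sq]
  by_cases hw : w ∈ critSet N u k
  · rw [critFun, Set.indicator_of_mem (hmem.2 hw), Set.indicator_of_mem hw, hd]
  · rw [critFun, Set.indicator_of_notMem (fun h => hw (hmem.1 h)), Set.indicator_of_notMem hw,
      mul_zero]

theorem critInt_eq_of_posDef {C : Matrix (MainIdx N) (MainIdx N) ℝ} (hC : C.PosDef) (u : ℝ)
    (k : ℕ) : critInt u k C = ∫ w in {w : MainIdx N → ℝ | u < w (Sum.inr 0) ∧ u < w (Sum.inr 1) ∧
        (fun p => w (Sum.inl p)) ∈ indexSet N k},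
      |(matri fun p => w (Sum.inl p)).det| * gaussDensity C w := by
  rw [critInt, integral_gaussLaw_of_posDef hC (measurable_critFun u k),
    show {w : MainIdx N → ℝ | u < w (Sum.inr 0) ∧ u < w (Sum.inr 1) ∧
        (fun p => w (Sum.inl p)) ∈ indexSet N k} = critSet N u k from rfl,
    ← integral_indicator (isOpen_critSet u k).measurableSet]
  refine integral_congr_ae (ae_of_all _ fun w => ?_)
  simp only [critFun]
  by_cases hw : w ∈ critSet N u k
  · rw [Set.indicator_of_mem hw, Set.indicator_of_mem hw]
  · rw [Set.indicator_of_notMem hw, Set.indicator_of_notMem hw, zero_mul]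

theorem chargesMaxima_of_posDef {C : Matrix (MainIdx N) (MainIdx N) ℝ} (hC : C.PosDef) :
    ChargesMaxima C := by
  refine ⟨hC.posSemidef, ?_⟩
  have hu : IsUnit C.det := isUnit_iff_ne_zero.2 hC.det_pos.ne'
  -- Chosen so that C v has Hessian part -I and both values equal to 1.
  refine ⟨C⁻¹.mulVec (Sum.elim (fun p => if p.1.1 = p.1.2 then -1 else 0) fun _ => 1), ?_⟩
  rw [Matrix.mulVec_mulVec, Matrix.mul_nonsing_inv C hu, Matrix.one_mulVec]
  refine ⟨by simp, by simp, fun e he => ?_⟩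
  have h1 : matri (hessPart (Sum.elim (fun p : HessIdx N => if p.1.1 = p.1.2 then (-1 : ℝ) else 0)
      fun _ : Fin 2 => (1 : ℝ))) = -1 := by
    ext i j
    simp only [matri, hessPart, Matrix.of_apply, Sum.elim_inl, Matrix.neg_apply, Matrix.one_apply,
      inf_eq_sup]
    split_ifs <;> simp
  rw [h1, Matrix.neg_mulVec, Matrix.one_mulVec, dotProduct_neg, neg_lt_zero]
  exact lt_of_le_of_ne (Finset.sum_nonneg fun i _ => mul_self_nonneg _)
    (Ne.symm (dotProduct_self_eq_zero.not.2 he))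

end CritPair

namespace CritPair

/-! ### One-dimensional Gaussian estimates -/

/-- Chernoff's bound: for g > y ≥ 0 the factor exp(y g - y²) is at least 1, and the moment
generating function is evaluated at a + y. -/
theorem setIntegral_exp_gaussianReal_le (a y : ℝ) :
    ∫ g in Set.Ioi y, Real.exp (a * g) ∂gaussianReal 0 1 ≤
      Real.exp (-(y ^ 2 / 2) + a * y + a ^ 2 / 2) ∨ y < 0 := by
  rcases lt_or_ge y 0 with hy | hy
  · exact Or.inr hy
  left
  have h1 : ∫ g, Real.exp (-(y ^ 2)) * Real.exp ((a + y) * g) ∂gaussianReal 0 1 =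
      Real.exp (-(y ^ 2 / 2) + a * y + a ^ 2 / 2) := by
    have := congrFun (mgf_id_gaussianReal (μ := 0) (v := 1)) (a + y)
    simp only [mgf, id_eq, NNReal.coe_one] at this
    rw [integral_const_mul, this, ← Real.exp_add]
    congr 1
    ring
  rw [← h1, ← integral_indicator measurableSet_Ioi]
  refine integral_mono_of_nonneg (ae_of_all _ fun g =>
    Set.indicator_nonneg (fun _ _ => (Real.exp_pos _).le) _)
    ((integrable_exp_mul_gaussianReal _).const_mul _) (ae_of_all _ fun g => ?_)
  by_cases hg : g ∈ Set.Ioi y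
  · simp only [Set.indicator_of_mem hg]
    rw [← Real.exp_add, Real.exp_le_exp]
    have : y < g := hg
    nlinarith
  · simp only [Set.indicator_of_notMem hg]
    positivity

theorem gaussianReal_Icc_ge {y b : ℝ} (hy : 0 ≤ y) (hb : 0 ≤ b) :
    (Real.sqrt (2 * Real.pi))⁻¹ * Real.exp (-(y + b + 1) ^ 2 / 2) ≤
      (gaussianReal 0 1).real (Set.Icc (y + b) (y + b + 1)) := by
  rw [measureReal_def, gaussianReal_apply_eq_integral 0 one_ne_zero, ENNReal.toReal_ofReal
    (integral_nonneg fun x => gaussianPDFReal_nonneg _ _ _)]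
  have h1 : ∫ _ in Set.Icc (y + b) (y + b + 1),
      (Real.sqrt (2 * Real.pi))⁻¹ * Real.exp (-(y + b + 1) ^ 2 / 2) =
      (Real.sqrt (2 * Real.pi))⁻¹ * Real.exp (-(y + b + 1) ^ 2 / 2) := by
    rw [setIntegral_const, Real.volume_real_Icc]
    simp
  rw [← h1]
  refine setIntegral_mono_on (integrable_const _) (integrable_gaussianPDFReal 0 1).integrableOn
    measurableSet_Icc fun x hx => ?_
  simp only [gaussianPDFReal, NNReal.coe_one, mul_one, sub_zero]
  refine mul_le_mul_of_nonneg_left (Real.exp_le_exp.2 ?_) (by positivity)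
  have h2 : x ^ 2 ≤ (y + b + 1) ^ 2 := pow_le_pow_left₀ (by linarith [hx.1]) hx.2 2
  linarith

/-- The exponential moment beyond a level is controlled by the probability of a fixed shifted
window, up to an exponential factor in the level. -/
theorem exists_setIntegral_exp_le (a b : ℝ) (hb : 0 ≤ b) : ∃ K : ℝ, 0 < K ∧ ∀ y ≥ 0,
    ∫ g in Set.Ioi y, Real.exp (a * g) ∂gaussianReal 0 1 ≤
      K * Real.exp ((a + b + 1) * y) *
        (gaussianReal 0 1).real (Set.Icc (y + b) (y + b + 1)) := by
  -- The exponent (y + b + 1)²/2 exceeds y²/2 by (b + 1) y + (b + 1)²/2: the first term goes into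
  -- the factor exponential in y, the second into the constant.
  refine ⟨Real.sqrt (2 * Real.pi) * Real.exp (a ^ 2 / 2 + (b + 1) ^ 2 / 2), by positivity,
    fun y hy => ?_⟩
  have h1 := (setIntegral_exp_gaussianReal_le a y).resolve_right (not_lt.2 hy)
  have h2 := gaussianReal_Icc_ge hy hb
  refine h1.trans (le_trans (le_of_eq ?_) (mul_le_mul_of_nonneg_left h2 (by positivity)))
  have h4 : Real.exp (-(y ^ 2 / 2) + a * y + a ^ 2 / 2) = Real.exp (a ^ 2 / 2 + (b + 1) ^ 2 / 2) *
      Real.exp ((a + b + 1) * y) * Real.exp (-(y + b + 1) ^ 2 / 2) := by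
    rw [← Real.exp_add, ← Real.exp_add]
    congr 1
    ring
  rw [h4]
  field_simp

theorem gaussianReal_Ioo_le (a b : ℝ) (hab : a ≤ b) :
    (gaussianReal 0 1).real (Set.Ioo a b) ≤ b - a := by
  rw [measureReal_def, gaussianReal_apply_eq_integral 0 one_ne_zero, ENNReal.toReal_ofReal
    (integral_nonneg fun x => gaussianPDFReal_nonneg _ _ _)]
  have h1 : ∫ _ in Set.Ioo a b, (1 : ℝ) = b - a := by
    rw [setIntegral_const, Real.volume_real_Ioo_of_le hab]
    simp
  rw [← h1]
  refine setIntegral_mono_on (integrable_gaussianPDFReal 0 1).integrableOn (integrable_const _)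
    measurableSet_Ioo fun x _ => ?_
  simp only [gaussianPDFReal, NNReal.coe_one, mul_one, sub_zero]
  have h2 : (Real.sqrt (2 * Real.pi))⁻¹ ≤ 1 := by
    refine inv_le_one_of_one_le₀ ?_
    rw [Real.one_le_sqrt]
    linarith [Real.pi_gt_three]
  have h3 : Real.exp (-x ^ 2 / 2) ≤ 1 := Real.exp_le_one_iff.2 (by nlinarith [sq_nonneg x])
  calc _ ≤ (1 : ℝ) * 1 := mul_le_mul h2 h3 (Real.exp_pos _).le zero_le_one
    _ = 1 := one_mul 1

section Marginals

variable {ι κ : Type*} [Fintype ι] [Fintype κ] [DecidableEq ι] [DecidableEq κ]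

/-- Anti-concentration of a linear functional of a standard Gaussian vector. -/
theorem gaussPi_abs_lt_le (a : ι → ℝ) {v : ℝ} (hv : 0 < v) (ha : a ⬝ᵥ a = v) (c : ℝ) {ε : ℝ}
    (hε : 0 ≤ ε) : (gaussPi ι).real {x | |c + a ⬝ᵥ x| < ε} ≤ 2 * ε / Real.sqrt v := by
  set B : Matrix Unit ι ℝ := Matrix.of fun _ => a
  set B' : Matrix Unit Unit ℝ := Matrix.of fun _ _ => Real.sqrt v
  have hBB : B * B.transpose = B' * B'.transpose := by
    ext i j
    simp only [Matrix.mul_apply, Matrix.transpose_apply, B, B', Matrix.of_apply,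
      Finset.univ_unique, Finset.sum_singleton]
    rw [Real.mul_self_sqrt hv.le, ← ha, dotProduct]
  have hlaw := map_mulVec_gaussPi_congr hBB
  have hms : MeasurableSet {y : Unit → ℝ | |c + y ()| < ε} := by
    refine measurableSet_lt ?_ measurable_const
    fun_prop
  have h1 : {x : ι → ℝ | |c + a ⬝ᵥ x| < ε} = B.mulVec ⁻¹' {y | |c + y ()| < ε} := rfl
  have hs : 0 < Real.sqrt v := Real.sqrt_pos.2 hv
  rw [h1, ← map_measureReal_apply (measurable_mulVec B) hms, hlaw,
    map_measureReal_apply (measurable_mulVec B') hms]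
  have h2 : B'.mulVec ⁻¹' {y : Unit → ℝ | |c + y ()| < ε} =
      (Function.eval ()) ⁻¹' Set.Ioo ((-ε - c) / Real.sqrt v) ((ε - c) / Real.sqrt v) := by
    ext x
    have : B'.mulVec x () = Real.sqrt v * x () := by
      simp [B', Matrix.mulVec, dotProduct]
    simp only [Set.mem_preimage, Set.mem_ofPred_eq, this, abs_lt, Function.eval, Set.mem_Ioo,
      div_lt_iff₀ hs, lt_div_iff₀ hs]
    constructor
    · rintro ⟨h3, h4⟩
      constructor <;> linarith
    · rintro ⟨h3, h4⟩
      constructor <;> linarith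
  have h3 : (gaussPi Unit).map (Function.eval ()) = gaussianReal 0 1 :=
    (measurePreserving_eval (fun _ : Unit => gaussianReal 0 1) ()).map_eq
  rw [h2, ← map_measureReal_apply (measurable_pi_apply _) measurableSet_Ioo, h3]
  refine (gaussianReal_Ioo_le _ _ ?_).trans (le_of_eq ?_)
  · gcongr
    linarith
  · field_simp
    ring

/-- Splitting off one independent direction of a centered Gaussian law. -/
theorem gaussLaw_rank_one_add {C : Matrix ι ι ℝ} {b : ι → ℝ} {A : Matrix ι κ ℝ}
    (h : Matrix.vecMulVec b b + A * A.transpose = C) : gaussLaw C =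
      ((gaussianReal 0 1).prod (gaussPi κ)).map fun p => p.1 • b + A.mulVec p.2 := by
  set B : Matrix ι (Unit ⊕ κ) ℝ := Matrix.of fun i => Sum.elim (fun _ => b i) (A i)
  have hB : B * B.transpose = C := by
    rw [← h]
    ext i j
    simp [B, Matrix.mul_apply, Fintype.sum_sum_type, Matrix.vecMulVec_apply]
  have hmp := (measurePreserving_sumPiEquivProdPi
    (fun _ : Unit ⊕ κ => gaussianReal 0 1))
  have hmp2 := (measurePreserving_eval (fun _ : Unit => gaussianReal 0 1) ()).prod
    (MeasurePreserving.id (gaussPi κ))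
  have hmp3 := hmp2.comp hmp
  have hG : Measurable fun p : ℝ × (κ → ℝ) => p.1 • b + A.mulVec p.2 := by
    have := measurable_mulVec A
    fun_prop
  rw [gaussLaw_eq_map hB, ← hmp3.map_eq, Measure.map_map hG hmp3.measurable]
  congr 1
  ext x i
  simp [B, Matrix.mulVec, dotProduct, Fintype.sum_sum_type, mul_comm,
    MeasurableEquiv.coe_sumPiEquivProdPi]

/-- The residual covariance after regression on the linear functional `q`. -/
theorem exists_regression {C : Matrix ι ι ℝ} (hC : C.PosSemidef) (q : ι → ℝ)
    (hq : 0 < q ⬝ᵥ C.mulVec q) : ∃ A : Matrix ι ι ℝ,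
    Matrix.vecMulVec ((Real.sqrt (q ⬝ᵥ C.mulVec q))⁻¹ • C.mulVec q)
      ((Real.sqrt (q ⬝ᵥ C.mulVec q))⁻¹ • C.mulVec q) + A * A.transpose = C := by
  set V := q ⬝ᵥ C.mulVec q with hV
  set b := (Real.sqrt V)⁻¹ • C.mulVec q with hb
  have hs : Real.sqrt V * Real.sqrt V = V := Real.mul_self_sqrt hq.le
  have hpos : (C - Matrix.vecMulVec b b).PosSemidef := by
    refine Matrix.PosSemidef.of_dotProduct_mulVec_nonneg ?_ fun v => ?_
    · refine hC.isHermitian.sub ?_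
      ext i j
      simp [Matrix.vecMulVec_apply, mul_comm]
    · have hA := factor_mul_transpose hC
      set A := factor C
      have h1 : ∀ x y, x ⬝ᵥ C.mulVec y = A.transpose.mulVec x ⬝ᵥ A.transpose.mulVec y := by
        intro x y
        rw [← hA, ← Matrix.mulVec_mulVec, Matrix.dotProduct_mulVec, ← Matrix.mulVec_transpose]
      -- Cauchy–Schwarz for the semidefinite form of C is exactly the positivity of the residual
      -- covariance.
      have h2 : (v ⬝ᵥ C.mulVec q) ^ 2 ≤ (v ⬝ᵥ C.mulVec v) * V := by
        rw [hV, h1, h1, h1]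
        simp only [dotProduct, ← sq]
        exact Finset.sum_mul_sq_le_sq_mul_sq _ _ _
      have h3 : v ⬝ᵥ b = (Real.sqrt V)⁻¹ * (v ⬝ᵥ C.mulVec q) := by
        rw [hb, dotProduct_smul, smul_eq_mul]
      rw [star_trivial, Matrix.sub_mulVec, dotProduct_sub, Matrix.vecMulVec_mulVec,
        dotProduct_smul, sub_nonneg]
      simp only [MulOpposite.smul_eq_mul_unop, MulOpposite.unop_op]
      rw [dotProduct_comm b v, h3, ← mul_mul_mul_comm, ← mul_inv, hs]
      rw [inv_mul_le_iff₀ hq]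
      nlinarith
  obtain ⟨A, hA⟩ := exists_mul_transpose_eq hpos
  exact ⟨A, by rw [hA]; abel⟩

end Marginals

end CritPair

namespace CritPair

/-! ### Bordered determinants -/

theorem abs_quadForm_le {N : ℕ} (x : HessIdx N → ℝ) (v : Fin N → ℝ) :
    |v ⬝ᵥ (matri x).mulVec v| ≤ N * ‖x‖ * (v ⬝ᵥ v) := by
  have h1 : |v ⬝ᵥ (matri x).mulVec v| ≤ ‖x‖ * (∑ i, |v i|) ^ 2 := by
    simp only [dotProduct, Matrix.mulVec]
    refine (Finset.abs_sum_le_sum_abs _ _).trans ?_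
    rw [sq, Finset.sum_mul, Finset.mul_sum]
    refine Finset.sum_le_sum fun i _ => ?_
    rw [abs_mul]
    calc |v i| * |∑ j, matri x i j * v j| ≤ |v i| * ∑ j, ‖x‖ * |v j| := by
          refine mul_le_mul_of_nonneg_left ((Finset.abs_sum_le_sum_abs _ _).trans
            (Finset.sum_le_sum fun j _ => ?_)) (abs_nonneg _)
          rw [abs_mul]
          exact mul_le_mul_of_nonneg_right (norm_le_pi_norm x _) (abs_nonneg _)
      _ = ‖x‖ * (|v i| * ∑ j, |v j|) := by rw [← Finset.mul_sum]; ring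
  have h2 : (∑ i, |v i|) ^ 2 ≤ N * (v ⬝ᵥ v) := by
    have := sq_sum_le_card_mul_sum_sq (s := Finset.univ) (f := fun i => |v i|)
    simp only [Finset.card_univ, Fintype.card_fin, sq_abs] at this
    simpa only [dotProduct, ← sq] using this
  calc _ ≤ ‖x‖ * (∑ i, |v i|) ^ 2 := h1
    _ ≤ ‖x‖ * (N * (v ⬝ᵥ v)) := mul_le_mul_of_nonneg_left h2 (norm_nonneg _)
    _ = _ := by ring

theorem dotProduct_self_nonneg' {ι : Type*} [Fintype ι] (v : ι → ℝ) : 0 ≤ v ⬝ᵥ v :=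
  Finset.sum_nonneg fun _ _ => mul_self_nonneg _

theorem dotProduct_self_pos {ι : Type*} [Fintype ι] {v : ι → ℝ} (hv : v ≠ 0) : 0 < v ⬝ᵥ v :=
  lt_of_le_of_ne (dotProduct_self_nonneg' v) (Ne.symm (dotProduct_self_eq_zero.not.2 hv))

/-- A positive definite matrix bounded below by `m ≥ 1` has determinant at least `1`. -/
theorem one_le_det_of_le {n : ℕ} {D : Matrix (Fin n) (Fin n) ℝ} (hD : D.IsHermitian) {m : ℝ}
    (hm : 1 ≤ m) (h : ∀ v, m * (v ⬝ᵥ v) ≤ v ⬝ᵥ D.mulVec v) : 1 ≤ D.det := by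
  have h1 : D.det = ∏ i, hD.eigenvalues i := by
    rw [hD.det_eq_prod_eigenvalues]
    simp
  rw [h1]
  rw [← Finset.prod_const_one (s := (Finset.univ : Finset (Fin n)))]
  refine Finset.prod_le_prod (fun _ _ => zero_le_one) fun i _ => ?_
  have h2 := h (hD.eigenvectorBasis i)
  have h3 : D.mulVec (hD.eigenvectorBasis i) = hD.eigenvalues i • ⇑(hD.eigenvectorBasis i) :=
    hD.mulVec_eigenvectorBasis i
  rw [h3, dotProduct_smul, smul_eq_mul] at h2
  have h4 : 0 < (⇑(hD.eigenvectorBasis i) : Fin n → ℝ) ⬝ᵥ ⇑(hD.eigenvectorBasis i) := by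
    refine dotProduct_self_pos fun h0 => ?_
    have := hD.eigenvectorBasis.orthonormal.ne_zero i
    exact this (by ext j; exact congrFun h0 j)
  exact hm.trans (le_of_mul_le_mul_right h2 h4)

/-- By the Schur complement, the absolute determinant is det D · |a + bᵀ D⁻¹ b|, where det D ≥ 1 and
0 ≤ bᵀ D⁻¹ b ≤ |b|²/m. -/
theorem det_bordered_ge {n : ℕ} {D : Matrix (Fin n) (Fin n) ℝ} (hD : D.IsHermitian) {m : ℝ}
    (hm : 1 ≤ m) (h : ∀ v, m * (v ⬝ᵥ v) ≤ v ⬝ᵥ D.mulVec v) (a : ℝ) (b : Fin n → ℝ) :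
    |a| - (b ⬝ᵥ b) / m ≤ |(Matrix.fromBlocks (-D) (Matrix.of fun i (_ : Unit) => b i)
      (Matrix.of fun (_ : Unit) i => b i) (Matrix.of fun _ _ => a)).det| := by
  have hdet := one_le_det_of_le hD hm h
  have hu : IsUnit D.det := isUnit_iff_ne_zero.2 (by linarith)
  have hnu : IsUnit (-D).det := by
    rw [← Matrix.isUnit_iff_isUnit_det]
    exact ((Matrix.isUnit_iff_isUnit_det D).2 hu).neg
  let hinv := Matrix.invertibleOfIsUnitDet (-D) hnu
  rw [Matrix.det_fromBlocks₁₁, abs_mul, Matrix.invOf_eq_nonsing_inv]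
  have h1 : (-D)⁻¹ = -D⁻¹ := by
    refine Matrix.inv_eq_right_inv ?_
    rw [neg_mul_neg, Matrix.mul_nonsing_inv D hu]
  set y := D⁻¹.mulVec b with hy
  have hDy : D.mulVec y = b := by
    rw [hy, Matrix.mulVec_mulVec, Matrix.mul_nonsing_inv D hu, Matrix.one_mulVec]
  have h2 : (Matrix.of (fun (_ : Unit) (_ : Unit) => a) - Matrix.of (fun (_ : Unit) i => b i) *
      (-D)⁻¹ * Matrix.of fun i (_ : Unit) => b i).det = a + b ⬝ᵥ y := by
    rw [Matrix.det_unique, h1, Matrix.mul_neg, Matrix.neg_mul, Matrix.mul_assoc]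
    simp only [Matrix.sub_apply, Matrix.neg_apply, Matrix.of_apply, Matrix.mul_apply, hy,
      dotProduct, Matrix.mulVec]
    ring
  have h3 : 0 ≤ b ⬝ᵥ y ∧ b ⬝ᵥ y ≤ (b ⬝ᵥ b) / m := by
    have h4 := h y
    rw [hDy, dotProduct_comm y b] at h4
    have h5 := dotProduct_self_nonneg' y
    have h6 : 0 ≤ b ⬝ᵥ y := le_trans (by positivity) h4
    refine ⟨h6, ?_⟩
    -- With y = D⁻¹ b, expanding |b - m y|² ≥ 0 and using m |y|² ≤ b·y yields m b·y ≤ |b|².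
    have h7 := dotProduct_self_nonneg' (b - m • y)
    simp only [sub_dotProduct, dotProduct_sub, smul_dotProduct, dotProduct_smul, smul_eq_mul,
      dotProduct_comm y b] at h7
    rw [le_div_iff₀ (by linarith)]
    nlinarith
  rw [h2, Matrix.det_neg, abs_mul, abs_pow, abs_neg, abs_one, one_pow, one_mul, abs_of_nonneg
    (zero_le_one.trans hdet)]
  have h8 : |a| - (b ⬝ᵥ b) / m ≤ |a + b ⬝ᵥ y| := by
    have := abs_sub_abs_le_abs_sub a (-(b ⬝ᵥ y))
    rw [sub_neg_eq_add, abs_neg, abs_of_nonneg h3.1] at this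
    linarith [h3.2]
  exact h8.trans (le_mul_of_one_le_left (abs_nonneg _) hdet)

/-- Moving the first coordinate to the end exhibits the strongly negative block as the leading one.
The determinant can then be small only if the corner entry is small. -/
theorem abs_det_matri_ge {n : ℕ} (x : HessIdx (n + 1) → ℝ) {m β : ℝ} (hm : 1 ≤ m)
    (h : ∀ v : Fin (n + 1) → ℝ, v 0 = 0 → v ⬝ᵥ (matri x).mulVec v ≤ -m * (v ⬝ᵥ v))
    (hβ : ∀ j : Fin n, |matri x j.succ 0| ≤ β) :
    |matri x 0 0| - n * β ^ 2 / m ≤ |(matri x).det| := by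
  set D : Matrix (Fin n) (Fin n) ℝ := Matrix.of fun i j => -matri x i.succ j.succ with hD
  have hsymm : ∀ i j, matri x i j = matri x j i := fun i j => by
    simp [matri, min_comm, max_comm]
  have hDh : D.IsHermitian := by
    ext i j
    simp [hD, hsymm j.succ]
  have hq : ∀ v : Fin n → ℝ, m * (v ⬝ᵥ v) ≤ v ⬝ᵥ D.mulVec v := by
    intro v
    have := h (Fin.cons 0 v) rfl
    simp only [dotProduct, Matrix.mulVec, Fin.sum_univ_succ, Fin.cons_zero, Fin.cons_succ,
      zero_mul, mul_zero, zero_add] at this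
    simp only [dotProduct, Matrix.mulVec, hD, Matrix.of_apply, neg_mul, Finset.sum_neg_distrib,
      mul_neg]
    linarith
  set e : Fin n ⊕ Unit ≃ Fin (n + 1) :=
    ((finSuccEquiv n).trans (Equiv.optionEquivSumPUnit _)).symm with he
  have he1 : ∀ i, e (Sum.inl i) = i.succ := fun i => by simp [he]
  have he2 : ∀ i, e (Sum.inr i) = 0 := fun i => by simp [he]
  have hdet : (matri x).det = (Matrix.fromBlocks (-D)
      (Matrix.of fun i (_ : Unit) => matri x i.succ 0)
      (Matrix.of fun (_ : Unit) i => matri x i.succ 0)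
      (Matrix.of fun _ _ => matri x 0 0)).det := by
    rw [← Matrix.det_submatrix_equiv_self e (matri x)]
    congr 1
    ext (i | i) (j | j)
    · simp [he1, hD]
    · simp [he1, he2]
    · simp [he1, he2, hsymm 0]
    · simp [he2]
  rw [hdet]
  refine le_trans ?_ (det_bordered_ge hDh hm hq _ _)
  have hb : (fun i : Fin n => matri x i.succ 0) ⬝ᵥ (fun i => matri x i.succ 0) ≤ n * β ^ 2 := by
    rw [dotProduct]
    have : ∀ i ∈ (Finset.univ : Finset (Fin n)),
        matri x i.succ 0 * matri x i.succ 0 ≤ β ^ 2 := fun i _ => by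
      rw [← abs_mul_abs_self, ← sq]
      exact pow_le_pow_left₀ (abs_nonneg _) (hβ i) 2
    simpa using Finset.sum_le_sum this
  have : ((fun i : Fin n => matri x i.succ 0) ⬝ᵥ fun i => matri x i.succ 0) / m ≤
      n * β ^ 2 / m := by gcongr
  linarith

end CritPair

namespace CritPair

/-! ### Uniform asymptotics of the ratio at high levels -/

/-- The covariance of a coordinate with the sum of the last two coordinates. -/
def sumCov {N : ℕ} (C : Matrix (MainIdx N) (MainIdx N) ℝ) (i : MainIdx N) : ℝ :=
  C i (Sum.inr 0) + C i (Sum.inr 1)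

/-- The variance of the sum of the last two coordinates. -/
def sumVar {N : ℕ} (C : Matrix (MainIdx N) (MainIdx N) ℝ) : ℝ :=
  sumCov C (Sum.inr 0) + sumCov C (Sum.inr 1)

/-- The index of the top left entry of the Hessian. -/
def cornerIdx (n : ℕ) : MainIdx (n + 1) := Sum.inl ⟨(0, 0), le_rfl⟩

/-- Quantitative conditions under which, at high levels, the block of the Hessian complementary
to the first axis is negative definite with overwhelming probability. -/
structure PeakBounds (n : ℕ) (K c : ℝ) (C : Matrix (MainIdx (n + 1)) (MainIdx (n + 1)) ℝ) :
    Prop where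
  posSemidef : C.PosSemidef
  le : ∀ i j, |C i j| ≤ K
  -- Equal variances make each of the two values regress on their sum with coefficient exactly 1/2.
  var_eq : C (Sum.inr 0) (Sum.inr 0) = C (Sum.inr 1) (Sum.inr 1)
  var_ge : c ≤ sumVar C
  offDiag : ∀ p : HessIdx (n + 1), p.1.1 ≠ p.1.2 → sumCov C (Sum.inl p) = 0
  diag : ∀ j : Fin n, sumCov C (Sum.inl ⟨(j.succ, j.succ), le_rfl⟩) ≤ -c
  -- The right-hand side is `sumVar C` times the residual variance of the corner entry given the sum
  -- of the two values.
  corner : c ≤ C (cornerIdx n) (cornerIdx n) * sumVar C - sumCov C (cornerIdx n) ^ 2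

namespace PeakBounds

variable {n : ℕ} {K c : ℝ} {C : Matrix (MainIdx (n + 1)) (MainIdx (n + 1)) ℝ}

theorem sumVar_le (h : PeakBounds n K c C) : sumVar C ≤ 4 * K := by
  have h1 := fun i j => (abs_le.1 (h.le i j)).2
  simp only [sumVar, sumCov]
  linarith [h1 (Sum.inr 0) (Sum.inr 0), h1 (Sum.inr 0) (Sum.inr 1), h1 (Sum.inr 1) (Sum.inr 0),
    h1 (Sum.inr 1) (Sum.inr 1)]

/-- Regression on the sum of the two values. The remainder A x is independent of the sum and does
not contribute to it, and its corner entry keeps a variance bounded below. -/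
theorem exists_split (hc : 0 < c) (h : PeakBounds n K c C) :
    ∃ A : Matrix (MainIdx (n + 1)) (MainIdx (n + 1)) ℝ,
      Matrix.vecMulVec ((Real.sqrt (sumVar C))⁻¹ • sumCov C)
        ((Real.sqrt (sumVar C))⁻¹ • sumCov C) + A * A.transpose = C ∧
      (∀ i j, |A i j| ≤ 1 + K) ∧
      (∀ x, A.mulVec x (Sum.inr 0) + A.mulVec x (Sum.inr 1) = 0) ∧
      c / (4 * K) ≤ A (cornerIdx n) ⬝ᵥ A (cornerIdx n) := by
  set q : MainIdx (n + 1) → ℝ := Sum.elim 0 1 with hq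
  have h1 : C.mulVec q = sumCov C := by
    ext i
    simp [hq, Matrix.mulVec, dotProduct, Fintype.sum_sum_type, sumCov]
  have h2 : q ⬝ᵥ C.mulVec q = sumVar C := by
    rw [h1]
    simp [hq, dotProduct, Fintype.sum_sum_type, sumVar]
  have hV : 0 < sumVar C := hc.trans_le h.var_ge
  obtain ⟨A, hA⟩ := exists_regression h.posSemidef q (h2 ▸ hV)
  rw [h2, h1] at hA
  have hs : Real.sqrt (sumVar C) ^ 2 = sumVar C := Real.sq_sqrt hV.le
  have hii : ∀ i, (A * A.transpose) i i = C i i - sumCov C i ^ 2 / sumVar C := by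
    intro i
    have := congrFun (congrFun hA i) i
    simp only [Matrix.add_apply, Matrix.vecMulVec_apply, Pi.smul_apply, smul_eq_mul] at this
    have h3 : (Real.sqrt (sumVar C))⁻¹ * sumCov C i * ((Real.sqrt (sumVar C))⁻¹ * sumCov C i) =
        sumCov C i ^ 2 / sumVar C := by
      rw [mul_mul_mul_comm, ← mul_inv, Real.mul_self_sqrt hV.le, sq]
      ring
    linarith
  refine ⟨A, hA, fun i j => ?_, fun x => ?_, ?_⟩
  · refine (abs_entry_le_of_mul_transpose rfl i j).trans ?_
    have h3 := (abs_le.1 (h.le i i)).2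
    have h4 : 0 ≤ sumCov C i ^ 2 / sumVar C := by positivity
    linarith [hii i]
  -- The rank one term already accounts for the whole variance of the sum, so the remainder has none
  -- left in that direction.
  · have h5 : A.transpose.mulVec q ⬝ᵥ A.transpose.mulVec q = 0 := by
      have h6 : q ⬝ᵥ (A * A.transpose).mulVec q = A.transpose.mulVec q ⬝ᵥ A.transpose.mulVec q := by
        rw [← Matrix.mulVec_mulVec, Matrix.dotProduct_mulVec, ← Matrix.mulVec_transpose]
      have h7 : q ⬝ᵥ C.mulVec q = _ := congrArg (fun M => q ⬝ᵥ M.mulVec q) hA.symm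
      simp only [Matrix.add_mulVec, dotProduct_add, h6, Matrix.vecMulVec_mulVec] at h7
      have h8 : ((Real.sqrt (sumVar C))⁻¹ • sumCov C) ⬝ᵥ q = Real.sqrt (sumVar C) := by
        rw [smul_dotProduct, dotProduct_comm, ← h1, h2, smul_eq_mul, inv_mul_eq_div,
          Real.div_sqrt]
      rw [h2, h8, dotProduct_smul, dotProduct_comm q, h8, MulOpposite.smul_eq_mul_unop,
        MulOpposite.unop_op, ← sq, hs] at h7
      linarith
    have h9 := dotProduct_self_eq_zero.1 h5
    have h10 : q ⬝ᵥ A.mulVec x = 0 := by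
      rw [Matrix.dotProduct_mulVec, ← Matrix.mulVec_transpose, h9, zero_dotProduct]
    simpa [hq, dotProduct, Fintype.sum_sum_type] using h10
  · have h11 : A (cornerIdx n) ⬝ᵥ A (cornerIdx n) = (A * A.transpose) (cornerIdx n) (cornerIdx n) :=
      rfl
    rw [h11, hii, le_sub_iff_add_le]
    have h12 := h.corner
    have h13 : c / (4 * K) ≤ c / sumVar C := div_le_div_of_nonneg_left hc.le hV h.sumVar_le
    have h14 : c / sumVar C + sumCov C (cornerIdx n) ^ 2 / sumVar C ≤
        C (cornerIdx n) (cornerIdx n) := by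
      rw [← add_div, div_le_iff₀ hV]
      linarith
    linarith

/-- The regression vector acts on the hyperplane orthogonal to the first axis as a negative
diagonal matrix. -/
theorem quadForm_sumCov_le (h : PeakBounds n K c C) {v : Fin (n + 1) → ℝ} (hv : v 0 = 0) :
    v ⬝ᵥ (matri (hessPart (sumCov C))).mulVec v ≤ -c * (v ⬝ᵥ v) := by
  have h1 : ∀ i j, matri (hessPart (sumCov C)) i j =
      if i = j then sumCov C (Sum.inl ⟨(i, i), le_rfl⟩) else 0 := by
    intro i j
    split_ifs with hij
    · subst hij
      simp [matri, hessPart]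
    · exact h.offDiag ⟨(min i j, max i j), min_le_max⟩ (by simpa using hij)
  simp only [dotProduct, Matrix.mulVec, h1, ite_mul, zero_mul, Finset.sum_ite_eq, Finset.mem_univ,
    if_true]
  rw [Finset.mul_sum]
  refine Finset.sum_le_sum fun i _ => ?_
  refine Fin.cases ?_ (fun j => ?_) i
  · simp [hv]
  · have := h.diag j
    nlinarith [mul_self_nonneg (v j.succ)]

theorem quadForm_le (h : PeakBounds n K c C) {s : ℝ} (hs : 0 ≤ s) (r : MainIdx (n + 1) → ℝ)
    {v : Fin (n + 1) → ℝ} (hv : v 0 = 0) :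
    v ⬝ᵥ (matri (hessPart (s • sumCov C + r))).mulVec v ≤
      (-(c * s) + (n + 1) * ‖r‖) * (v ⬝ᵥ v) := by
  have h1 : matri (hessPart (s • sumCov C + r)) =
      matri (hessPart r) + s • matri (hessPart (sumCov C)) := by
    rw [← matri_add_smul]
    congr 1
    ext p
    simp [hessPart, add_comm]
  have h2 := h.quadForm_sumCov_le hv
  have h3 := (abs_le.1 (abs_quadForm_le (hessPart r) v)).2
  have h4 : ‖hessPart r‖ ≤ ‖r‖ := by
    rw [pi_norm_le_iff_of_nonneg (norm_nonneg _)]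
    exact fun p => norm_le_pi_norm r _
  have h5 := dotProduct_self_nonneg' v
  rw [h1, Matrix.add_mulVec, dotProduct_add, Matrix.smul_mulVec, dotProduct_smul, smul_eq_mul]
  push_cast at h3
  have h6 : ((n : ℝ) + 1) * ‖hessPart r‖ * (v ⬝ᵥ v) ≤ (n + 1) * ‖r‖ * (v ⬝ᵥ v) := by gcongr
  nlinarith

/-- On the event `x, z > u` and index at most `n - 1`, the residual is large. -/
theorem sum_critFun_le (h : PeakBounds n K c C) {u s : ℝ} (r : MainIdx (n + 1) → ℝ)
    (hr : r (Sum.inr 0) + r (Sum.inr 1) = 0) (hV : 0 < sumVar C) (hu : 0 < u) :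
    ∑ k ∈ Finset.range n, critFun u k (s • sumCov C + r) ≤
      if 2 * u < s * sumVar C ∧ c * s ≤ (n + 1) * ‖r‖ then
        n * ((n + 1).factorial * (1 + ‖s • sumCov C + r‖) ^ (n + 1)) else 0 := by
  by_cases hw : u < (s • sumCov C + r) (Sum.inr 0) ∧ u < (s • sumCov C + r) (Sum.inr 1) ∧
      negIndex (hessPart (s • sumCov C + r)) < n
  · obtain ⟨hx, hz, hk⟩ := hw
    have h1 : 2 * u < s * sumVar C := by
      simp only [Pi.add_apply, Pi.smul_apply, smul_eq_mul] at hx hz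
      simp only [sumVar]
      linarith
    have hs : 0 < s := by
      by_contra hs
      nlinarith
    -- Otherwise the form is negative definite on the hyperplane v 0 = 0 and the index is at least
    -- n.
    have h2 : c * s ≤ (n + 1) * ‖r‖ := by
      by_contra hlt
      refine absurd (le_negIndex_of_neg_on_hyperplane (hessPart (s • sumCov C + r)) ?_)
        (not_le.2 hk)
      intro v hv hv0
      refine (h.quadForm_le hs.le r hv).trans_lt ?_
      exact mul_neg_of_neg_of_pos (by linarith) (dotProduct_self_pos hv0)
    rw [if_pos ⟨h1, h2⟩]
    refine (Finset.sum_le_card_nsmul _ _ _ fun k _ =>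
      (critFun_le u k _).trans (abs_det_le _)).trans ?_
    simp [nsmul_eq_mul]
  · have h0 : ∀ k ∈ Finset.range n, critFun u k (s • sumCov C + r) = 0 := by
      intro k hk
      refine Set.indicator_of_notMem (fun hmem => hw ⟨hmem.1, hmem.2.1, ?_⟩) _
      rw [hmem.2.2.2]
      exact Finset.mem_range.1 hk
    rw [Finset.sum_eq_zero h0]
    split_ifs <;> positivity

/-- Lower bound for the contribution of indices `n` and `n + 1`. -/
theorem critFun_add_ge (h : PeakBounds n K c C) {u s ε m : ℝ} (r : MainIdx (n + 1) → ℝ)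
    (hs : 0 ≤ s) (hr : ‖r‖ ≤ 1 / 4) (hu : u < s * sumVar C / 2 - 1 / 4)
    (hm : m ≤ c * s - (n + 1) / 4) (hm1 : 1 ≤ m) (hmε : n / (8 * ε) ≤ m) (hε : 0 < ε)
    (hcorner : ε ≤ |s * sumCov C (cornerIdx n) + r (cornerIdx n)|) :
    ε / 2 ≤ critFun u n (s • sumCov C + r) + critFun u (n + 1) (s • sumCov C + r) := by
  set w := s • sumCov C + r with hw
  have hsymm : C (Sum.inr 0) (Sum.inr 1) = C (Sum.inr 1) (Sum.inr 0) := by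
    have := h.posSemidef.isHermitian.apply (Sum.inr 0) (Sum.inr 1)
    simpa using this.symm
  have hri : ∀ i, |r i| ≤ 1 / 4 := fun i => (norm_le_pi_norm r i).trans hr
  have hV : sumCov C (Sum.inr 0) = sumVar C / 2 ∧ sumCov C (Sum.inr 1) = sumVar C / 2 := by
    have := h.var_eq
    simp only [sumVar, sumCov]
    constructor <;> linarith
  have hx : ∀ i : Fin 2, u < w (Sum.inr i) := by
    intro i
    have h1 := (abs_le.1 (hri (Sum.inr i))).1
    have h2 : sumCov C (Sum.inr i) = sumVar C / 2 := by
      fin_cases i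
      · exact hV.1
      · exact hV.2
    simp only [hw, Pi.add_apply, Pi.smul_apply, smul_eq_mul, h2]
    linarith
  have hneg : ∀ v : Fin (n + 1) → ℝ, v 0 = 0 →
      v ⬝ᵥ (matri (hessPart w)).mulVec v ≤ -m * (v ⬝ᵥ v) := by
    intro v hv
    refine (h.quadForm_le hs r hv).trans ?_
    refine mul_le_mul_of_nonneg_right ?_ (dotProduct_self_nonneg' v)
    have : ((n : ℝ) + 1) * ‖r‖ ≤ (n + 1) * (1 / 4) := by gcongr
    linarith
  have hdet : ε / 2 ≤ |(matri (hessPart w)).det| := by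
    -- The bordering entries have no component along the regression vector, by `offDiag`, so only
    -- the residual, at most 1/4, enters them.
    have h1 := abs_det_matri_ge (hessPart w) hm1 hneg (β := 1 / 4) (fun j => by
      have h2 : matri (hessPart w) j.succ 0 = w (Sum.inl ⟨(0, j.succ), Fin.zero_le _⟩) := by
        simp [matri, hessPart]
      have h3 := h.offDiag ⟨(0, j.succ), Fin.zero_le _⟩ (Fin.succ_ne_zero j).symm
      rw [h2, hw, Pi.add_apply, Pi.smul_apply, h3, smul_zero, zero_add]
      exact hri _)
    have h4 : matri (hessPart w) 0 0 = s * sumCov C (cornerIdx n) + r (cornerIdx n) := by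
      simp [matri, hessPart, hw, cornerIdx]
    rw [h4] at h1
    -- The bound n / (8ε) ≤ m was set so that the Schur correction n / (16 m) is at most half of ε.
    have h5 : (n : ℝ) * (1 / 4) ^ 2 / m ≤ ε / 2 := by
      rw [div_le_iff₀ (by positivity)] at hmε ⊢
      nlinarith
    linarith
  have hdet0 : (matri (hessPart w)).det ≠ 0 := by
    intro h0
    rw [h0, abs_zero] at hdet
    linarith
  have hidx := le_negIndex_of_neg_on_hyperplane (hessPart w) fun v hv hv0 =>
    (hneg v hv).trans_lt (by nlinarith [dotProduct_self_pos hv0])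
  have hle := negIndex_le (hessPart w)
  have hn1 := critFun_nonneg u n w
  have hn2 := critFun_nonneg u (n + 1) w
  rcases (show negIndex (hessPart w) = n ∨ negIndex (hessPart w) = n + 1 by omega) with hk | hk
  · have : critFun u n w = |(matri (hessPart w)).det| :=
      Set.indicator_of_mem (show w ∈ critSet (n + 1) u n from ⟨hx 0, hx 1, hdet0, hk⟩) _
    linarith
  · have : critFun u (n + 1) w = |(matri (hessPart w)).det| :=
      Set.indicator_of_mem (show w ∈ critSet (n + 1) u (n + 1) from ⟨hx 0, hx 1, hdet0, hk⟩) _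
    linarith

end PeakBounds

end CritPair

namespace CritPair

/-! ### Uniform bounds for the numerator and the denominator of the ratio. -/

namespace PeakBounds

variable {n : ℕ} {K c : ℝ}

theorem norm_regression_le {C : Matrix (MainIdx (n + 1)) (MainIdx (n + 1)) ℝ} (hc : 0 < c)
    (hK : 0 < K) (h : PeakBounds n K c C) :
    ‖(Real.sqrt (sumVar C))⁻¹ • sumCov C‖ ≤ 2 * K / Real.sqrt c := by
  rw [pi_norm_le_iff_of_nonneg (by positivity)]
  intro i
  have h1 : |sumCov C i| ≤ 2 * K := by
    have := abs_add_le (C i (Sum.inr 0)) (C i (Sum.inr 1))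
    simp only [sumCov]
    linarith [h.le i (Sum.inr 0), h.le i (Sum.inr 1)]
  have hs : 0 < Real.sqrt c := Real.sqrt_pos.2 hc
  have h2 : Real.sqrt c ≤ Real.sqrt (sumVar C) := Real.sqrt_le_sqrt h.var_ge
  rw [Pi.smul_apply, smul_eq_mul, Real.norm_eq_abs, abs_mul, abs_inv,
    abs_of_pos (hs.trans_le h2), inv_mul_eq_div]
  exact div_le_div₀ (by positivity) h1 hs h2

-- A low index forces ‖x‖ ≥ c₂ u for the residual variable x, so a factor exp(lam (‖x‖ - c₂ u)) ≥ 1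
-- may be inserted. Gaussian vectors have all exponential moments, so lam is arbitrary and the rate
-- κ as well. The window probability of g is kept as a factor in order to cancel against the
-- denominator.
set_option maxHeartbeats 1000000 in
theorem exists_sum_critInt_le (n : ℕ) (hc : 0 < c) (hK : 0 < K) (b κ : ℝ) (hb : 0 ≤ b) :
    ∃ K' : ℝ, 0 ≤ K' ∧ ∀ u > 0, ∀ C, PeakBounds n K c C →
      ∑ k ∈ Finset.range n, critInt u k C ≤ K' * Real.exp (-κ * u) *
        (gaussianReal 0 1).real (Set.Icc (2 * u / Real.sqrt (sumVar C) + b)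
          (2 * u / Real.sqrt (sumVar C) + b + 1)) := by
  set K₁ : ℝ := (1 + K) * Fintype.card (MainIdx (n + 1)) with hK₁
  have hsc : 0 < Real.sqrt c := Real.sqrt_pos.2 hc
  -- Exponent in g produced by the determinant: (1 + ‖w‖)^(n+1) ≤ exp((n+1)‖w‖), and the regression
  -- vector has norm at most 2K/√c.
  set a : ℝ := (n + 1) * (2 * K / Real.sqrt c) with ha
  obtain ⟨Kx, hKx, hx⟩ := exists_setIntegral_exp_le a b hb
  set c₂ : ℝ := c / (2 * K * ((n + 1) * K₁)) with hc₂
  have hc₂0 : 0 < c₂ := by positivity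
  -- As y ≤ 2u/√c, the factor exp(-lam c₂ u) absorbs exp((a + b + 1) y) and still leaves exp(-|κ|
  -- u).
  set lam : ℝ := ((a + b + 1) * (2 / Real.sqrt c) + |κ|) / c₂ with hlam
  have hlam0 : 0 ≤ lam := by positivity
  set M : ℝ := ∫ x, Real.exp (((n + 1) * K₁ + lam) * ‖x‖) ∂gaussPi (MainIdx (n + 1)) with hM
  refine ⟨n * (n + 1).factorial * M * Kx, by positivity, fun u hu C h => ?_⟩
  have hV : 0 < sumVar C := hc.trans_le h.var_ge
  have hs0 : 0 < Real.sqrt (sumVar C) := Real.sqrt_pos.2 hV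
  have hss : Real.sqrt (sumVar C) * Real.sqrt (sumVar C) = sumVar C := Real.mul_self_sqrt hV.le
  obtain ⟨A, hA, hA1, hA2, -⟩ := h.exists_split hc
  set y : ℝ := 2 * u / Real.sqrt (sumVar C) with hy
  have hy0 : 0 ≤ y := by positivity
  set L : ℝ := n * (n + 1).factorial * Real.exp (-(lam * c₂ * u)) with hL
  have hbound : ∀ p : ℝ × (MainIdx (n + 1) → ℝ),
      ∑ k ∈ Finset.range n, critFun u k
        (p.1 • ((Real.sqrt (sumVar C))⁻¹ • sumCov C) + A.mulVec p.2) ≤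
      L * ((Set.Ioi y).indicator (fun g => Real.exp (a * g)) p.1 *
        Real.exp (((n + 1) * K₁ + lam) * ‖p.2‖)) := by
    rintro ⟨g, x⟩
    simp only
    set r := A.mulVec x with hr
    have hrn : ‖r‖ ≤ K₁ * ‖x‖ := norm_mulVec_le_of_entries hA1 (by linarith) x
    set s := g * (Real.sqrt (sumVar C))⁻¹ with hs
    have hgs : g = s * Real.sqrt (sumVar C) := by rw [hs]; field_simp
    rw [smul_smul, ← hs]
    refine (h.sum_critFun_le r (hA2 x) hV hu).trans ?_
    split_ifs with hcond
    · obtain ⟨h1, h2⟩ := hcond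
      have hgy : y < g := by
        rw [hy, div_lt_iff₀ hs0, hgs, mul_assoc, hss]
        exact h1
      have hg0 : 0 ≤ g := hy0.trans hgy.le
      rw [Set.indicator_of_mem (show g ∈ Set.Ioi y from hgy), ← Real.exp_add, hL, mul_assoc _
        (Real.exp _), ← Real.exp_add, ← mul_assoc]
      refine mul_le_mul_of_nonneg_left ?_ (by positivity)
      refine (one_add_pow_le_exp (norm_nonneg _) _).trans (Real.exp_le_exp.2 ?_)
      have h3 : ‖s • sumCov C + r‖ ≤ g * (2 * K / Real.sqrt c) + K₁ * ‖x‖ := by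
        refine (norm_add_le _ _).trans (add_le_add ?_ hrn)
        rw [hs, ← smul_smul, norm_smul, Real.norm_eq_abs, abs_of_nonneg hg0]
        exact mul_le_mul_of_nonneg_left (h.norm_regression_le hc hK) hg0
      have h4 : c₂ * u ≤ ‖x‖ := by
        have h5 : 2 * u / (4 * K) ≤ s := by
          rw [div_le_iff₀ (by positivity)]
          have hs0' : 0 ≤ s := by positivity
          nlinarith [h.sumVar_le]
        have h6 : c * (2 * u / (4 * K)) ≤ (n + 1) * (K₁ * ‖x‖) :=
          (mul_le_mul_of_nonneg_left h5 hc.le).trans (h2.trans (by gcongr))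
        rw [hc₂, div_mul_eq_mul_div, div_le_iff₀ (by positivity)]
        have h7 : c * (2 * u / (4 * K)) * (2 * K) = c * u := by
          field_simp
          ring
        nlinarith
      push_cast
      rw [ha]
      nlinarith
    · have : 0 ≤ (Set.Ioi y).indicator (fun g => Real.exp (a * g)) g :=
        Set.indicator_nonneg (fun _ _ => (Real.exp_pos _).le) _
      positivity
  have hsum : ∑ k ∈ Finset.range n, critInt u k C = ∫ p, ∑ k ∈ Finset.range n, critFun u k
        (p.1 • ((Real.sqrt (sumVar C))⁻¹ • sumCov C) + A.mulVec p.2)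
        ∂(gaussianReal 0 1).prod (gaussPi (MainIdx (n + 1))) := by
    simp only [critInt]
    rw [← integral_finsetSum _ fun k _ => integrable_critFun u k, gaussLaw_rank_one_add hA,
      integral_map]
    · have := measurable_mulVec A
      fun_prop
    · exact (Finset.measurable_fun_sum _ fun k _ => measurable_critFun u k).aestronglyMeasurable
  rw [hsum]
  have hi1 : Integrable ((Set.Ioi y).indicator fun g => Real.exp (a * g)) (gaussianReal 0 1) :=
    (integrable_exp_mul_gaussianReal a).indicator measurableSet_Ioi
  have hi2 := integrable_exp_norm_gaussPi (ι := MainIdx (n + 1)) ((n + 1) * K₁ + lam)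
  have hI : ∫ p : ℝ × (MainIdx (n + 1) → ℝ), L * ((Set.Ioi y).indicator
      (fun g => Real.exp (a * g)) p.1 * Real.exp (((n + 1) * K₁ + lam) * ‖p.2‖))
      ∂(gaussianReal 0 1).prod (gaussPi (MainIdx (n + 1))) =
      L * ((∫ g in Set.Ioi y, Real.exp (a * g) ∂gaussianReal 0 1) * M) := by
    rw [integral_const_mul, integral_prod_mul (μ := gaussianReal 0 1)
      (ν := gaussPi (MainIdx (n + 1))) ((Set.Ioi y).indicator fun g => Real.exp (a * g))
      (fun x => Real.exp (((n + 1) * K₁ + lam) * ‖x‖)), integral_indicator measurableSet_Ioi]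
  refine (integral_mono_of_nonneg (ae_of_all _ fun p => Finset.sum_nonneg fun k _ =>
    critFun_nonneg u k _) ((hi1.mul_prod hi2).const_mul L) (ae_of_all _ hbound)).trans ?_
  rw [hI]
  have hfin := hx y hy0
  set G := (gaussianReal 0 1).real (Set.Icc (y + b) (y + b + 1))
  have h10 : Real.exp (-(lam * c₂ * u)) * Real.exp ((a + b + 1) * y) ≤ Real.exp (-κ * u) := by
    rw [← Real.exp_add, Real.exp_le_exp]
    have h11 : lam * c₂ = (a + b + 1) * (2 / Real.sqrt c) + |κ| := by
      rw [hlam]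
      field_simp
    have h12 : y ≤ 2 / Real.sqrt c * u := by
      rw [hy, div_mul_eq_mul_div]
      exact div_le_div_of_nonneg_left (by positivity) hsc (Real.sqrt_le_sqrt h.var_ge)
    have h13 : (a + b + 1) * y ≤ (a + b + 1) * (2 / Real.sqrt c * u) := by gcongr
    have h14 : κ * u ≤ |κ| * u := mul_le_mul_of_nonneg_right (le_abs_self κ) hu.le
    have h15 : ((a + b + 1) * (2 / Real.sqrt c) + |κ|) * u =
        (a + b + 1) * (2 / Real.sqrt c * u) + |κ| * u := by ring
    rw [h11, h15]
    linarith
  calc L * ((∫ g in Set.Ioi y, Real.exp (a * g) ∂gaussianReal 0 1) * M)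
      ≤ L * ((Kx * Real.exp ((a + b + 1) * y) * G) * M) := by gcongr
    _ = n * (n + 1).factorial * M * Kx * (Real.exp (-(lam * c₂ * u)) *
        Real.exp ((a + b + 1) * y)) * G := by rw [hL]; ring
    _ ≤ _ := by gcongr

-- If g lies in the window, x in a small ball, and the corner entry is at distance at least ε from
-- 0, then the integrand is at least ε/2. For each g in the window, anti-concentration of the corner
-- entry leaves at least half of the mass of the ball; Markov's inequality concludes.
set_option maxHeartbeats 1000000 in
theorem exists_critInt_add_ge (n : ℕ) (hc : 0 < c) (hK : 0 < K) :
    ∃ δ U : ℝ, 0 < δ ∧ ∀ u ≥ U, ∀ C, PeakBounds n K c C →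
      δ * (gaussianReal 0 1).real (Set.Icc (2 * u / Real.sqrt (sumVar C) + 1 / Real.sqrt c)
          (2 * u / Real.sqrt (sumVar C) + 1 / Real.sqrt c + 1)) ≤
        critInt u n C + critInt u (n + 1) C := by
  set K₁ : ℝ := (1 + K) * Fintype.card (MainIdx (n + 1)) with hK₁
  have hK₁0 : 0 < K₁ := by
    have : 0 < Fintype.card (MainIdx (n + 1)) := Fintype.card_pos
    positivity
  have hsc : 0 < Real.sqrt c := Real.sqrt_pos.2 hc
  set ρ : ℝ := 1 / (4 * K₁) with hρ
  have hopenpos : (gaussPi (MainIdx (n + 1))).IsOpenPosMeasure := by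
    have : (gaussianReal 0 1).IsOpenPosMeasure :=
      (gaussianReal_absolutelyContinuous' 0 one_ne_zero).isOpenPosMeasure
    unfold gaussPi
    infer_instance
  set cρ : ℝ := (gaussPi (MainIdx (n + 1))).real (Metric.closedBall 0 ρ) with hcρ
  have hcρ0 : 0 < cρ := by
    rw [hcρ, measureReal_def, ENNReal.toReal_pos_iff]
    exact ⟨Metric.measure_closedBall_pos _ _ (by positivity), measure_lt_top _ _⟩
  set v₀ : ℝ := c / (4 * K) with hv₀
  have hv₀0 : 0 < v₀ := by positivity
  have hsv : 0 < Real.sqrt v₀ := Real.sqrt_pos.2 hv₀0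
  -- Makes the anti-concentration bound 2ε/√v₀ equal to cρ/2, half of the mass of the ball.
  set ε : ℝ := cρ * Real.sqrt v₀ / 4 with hε
  have hε0 : 0 < ε := by positivity
  set m₀ : ℝ := max 1 (n / (8 * ε)) with hm₀
  refine ⟨ε / 2 * (cρ / 2), max 1 (2 * K / c * (m₀ + (n + 1) / 4)), by positivity,
    fun u hu C h => ?_⟩
  have hu1 : 1 ≤ u := (le_max_left _ _).trans hu
  have hu2 : 2 * K / c * (m₀ + (n + 1) / 4) ≤ u := (le_max_right _ _).trans hu
  have hV : 0 < sumVar C := hc.trans_le h.var_ge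
  have hs0 : 0 < Real.sqrt (sumVar C) := Real.sqrt_pos.2 hV
  have hss : Real.sqrt (sumVar C) * Real.sqrt (sumVar C) = sumVar C := Real.mul_self_sqrt hV.le
  obtain ⟨A, hA, hA1, -, hA3⟩ := h.exists_split hc
  -- Shifting g by 1/√c raises the sum of the values by at least 1, that is, each value by at least
  -- 1/2, which outweighs a residual of size 1/4.
  set b : ℝ := 1 / Real.sqrt c with hb
  set y : ℝ := 2 * u / Real.sqrt (sumVar C) with hy
  have hy0 : 0 ≤ y := by positivity
  set o := cornerIdx n with ho
  set β : MainIdx (n + 1) → ℝ := (Real.sqrt (sumVar C))⁻¹ • sumCov C with hβ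
  set μ := (gaussianReal 0 1).prod (gaussPi (MainIdx (n + 1))) with hμ
  set f : (MainIdx (n + 1) → ℝ) → ℝ := fun w => critFun u n w + critFun u (n + 1) w with hf
  set Wf : ℝ × (MainIdx (n + 1) → ℝ) → MainIdx (n + 1) → ℝ :=
    fun p => p.1 • β + A.mulVec p.2 with hWf
  have hWm : Measurable Wf := by
    have := measurable_mulVec A
    fun_prop
  have hfm : Measurable f := (measurable_critFun u n).add (measurable_critFun u (n + 1))
  have hfi : Integrable f (gaussLaw C) := (integrable_critFun u n).add (integrable_critFun u _)
  have hlaw : gaussLaw C = μ.map Wf := gaussLaw_rank_one_add hA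
  have hint : critInt u n C + critInt u (n + 1) C = ∫ p, f (Wf p) ∂μ := by
    rw [critInt, critInt, ← integral_add (integrable_critFun u n) (integrable_critFun u _), hlaw,
      integral_map hWm.aemeasurable hfm.aestronglyMeasurable]
  have hfi' : Integrable (fun p => f (Wf p)) μ := by
    rw [hlaw, integrable_map_measure hfm.aestronglyMeasurable hWm.aemeasurable] at hfi
    exact hfi
  set E : Set (ℝ × (MainIdx (n + 1) → ℝ)) := {p | p.1 ∈ Set.Icc (y + b) (y + b + 1) ∧
    p.2 ∈ Metric.closedBall 0 ρ ∧ ε ≤ |p.1 * β o + A o ⬝ᵥ p.2|} with hE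
  have hEm : MeasurableSet E := by
    refine (measurable_fst measurableSet_Icc).inter
      ((measurable_snd Metric.isClosed_closedBall.measurableSet).inter ?_)
    have : Continuous fun p : ℝ × (MainIdx (n + 1) → ℝ) => |p.1 * β o + A o ⬝ᵥ p.2| := by
      have : Continuous fun p : ℝ × (MainIdx (n + 1) → ℝ) => A o ⬝ᵥ p.2 :=
        continuous_const.dotProduct continuous_snd
      fun_prop
    exact (isClosed_le continuous_const this).measurableSet
  have hEsub : E ⊆ {p | ε / 2 ≤ f (Wf p)} := by
    rintro ⟨g, x⟩ ⟨hg, hx, hcor⟩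
    simp only at hg hx hcor
    change ε / 2 ≤ f (g • β + A.mulVec x)
    set s := g * (Real.sqrt (sumVar C))⁻¹ with hs
    have hgs : g = s * Real.sqrt (sumVar C) := by rw [hs]; field_simp
    have hg0 : 0 ≤ g := by
      have : 0 ≤ b := by positivity
      linarith [hg.1]
    have hxn : ‖x‖ ≤ ρ := by simpa using hx
    have hrn : ‖A.mulVec x‖ ≤ 1 / 4 := by
      refine (norm_mulVec_le_of_entries hA1 (by linarith) x).trans ?_
      rw [← hK₁]
      calc K₁ * ‖x‖ ≤ K₁ * ρ := by gcongr
        _ = 1 / 4 := by rw [hρ]; field_simp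
    have hsy : 2 * u / sumVar C ≤ s := by
      rw [hs, ← div_eq_mul_inv, div_le_div_iff₀ hV hs0]
      have h1 : y ≤ g := by
        have : 0 ≤ b := by positivity
        linarith [hg.1]
      rw [hy, div_le_iff₀ hs0] at h1
      refine (mul_le_mul_of_nonneg_right h1 hs0.le).trans (le_of_eq ?_)
      rw [mul_assoc, hss]
    have hus : u < s * sumVar C / 2 - 1 / 4 := by
      have h1 : s * sumVar C = g * Real.sqrt (sumVar C) := by
        conv_rhs => rw [hgs, mul_assoc, hss]
      have h2 : (y + b) * Real.sqrt (sumVar C) ≤ g * Real.sqrt (sumVar C) := by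
        gcongr
        exact hg.1
      have h3 : y * Real.sqrt (sumVar C) = 2 * u := by rw [hy]; field_simp
      have h4 : 1 ≤ b * Real.sqrt (sumVar C) := by
        rw [hb, div_mul_eq_mul_div, one_mul, le_div_iff₀ hsc, one_mul]
        exact Real.sqrt_le_sqrt h.var_ge
      rw [add_mul, h3] at h2
      rw [h1]
      linarith
    have hm : m₀ ≤ c * s - (n + 1) / 4 := by
      have h1 : u / (2 * K) ≤ s := by
        refine le_trans ?_ hsy
        rw [div_le_div_iff₀ (by positivity) hV]
        nlinarith [h.sumVar_le]
      have h2 : m₀ + (n + 1) / 4 ≤ c * (u / (2 * K)) := by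
        rw [div_mul_eq_mul_div, div_le_iff₀ hc] at hu2
        rw [← mul_div_assoc, le_div_iff₀ (by positivity)]
        linarith
      linarith [mul_le_mul_of_nonneg_left h1 hc.le]
    have hcor' : ε ≤ |s * sumCov C o + (A.mulVec x) o| := by
      have : s * sumCov C o = g * β o := by
        rw [hs, hβ, Pi.smul_apply, smul_eq_mul, mul_assoc]
      rw [this]
      exact hcor
    have := h.critFun_add_ge (A.mulVec x) (by positivity) hrn hus hm (le_max_left _ _)
      (le_max_right _ _) hε0 hcor'
    rw [hs, ← smul_smul] at this
    exact this
  have hEmeas : (cρ / 2) * (gaussianReal 0 1).real (Set.Icc (y + b) (y + b + 1)) ≤ μ.real E := by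
    have hsec : ∀ g ∈ Set.Icc (y + b) (y + b + 1),
        ENNReal.ofReal (cρ / 2) ≤ gaussPi (MainIdx (n + 1)) (Prod.mk g ⁻¹' E) := by
      intro g hg
      rw [ENNReal.ofReal_le_iff_le_toReal (measure_ne_top _ _), ← measureReal_def]
      have h1 : Metric.closedBall 0 ρ ⊆ (Prod.mk g ⁻¹' E) ∪
          {x : MainIdx (n + 1) → ℝ | |g * β o + A o ⬝ᵥ x| < ε} := by
        intro x hx
        by_cases hlt : |g * β o + A o ⬝ᵥ x| < ε
        · exact Or.inr hlt
        · exact Or.inl ⟨hg, hx, not_lt.1 hlt⟩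
      have h2 := (measureReal_mono (μ := gaussPi (MainIdx (n + 1))) h1).trans
        (measureReal_union_le _ _)
      have h3 := gaussPi_abs_lt_le (A o) (hv₀0.trans_le hA3) rfl (g * β o) hε0.le
      have h4 : 2 * ε / Real.sqrt (A o ⬝ᵥ A o) ≤ cρ / 2 := by
        have h5 : Real.sqrt v₀ ≤ Real.sqrt (A o ⬝ᵥ A o) := Real.sqrt_le_sqrt hA3
        rw [div_le_iff₀ (hsv.trans_le h5), hε]
        nlinarith
      linarith
    rw [measureReal_def, measureReal_def, ← ENNReal.toReal_ofReal (show 0 ≤ cρ / 2 by positivity),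
      ← ENNReal.toReal_mul]
    refine ENNReal.toReal_mono (measure_ne_top _ _) ?_
    rw [hμ, Measure.prod_apply hEm]
    calc ENNReal.ofReal (cρ / 2) * gaussianReal 0 1 (Set.Icc (y + b) (y + b + 1))
        = ∫⁻ _ in Set.Icc (y + b) (y + b + 1), ENNReal.ofReal (cρ / 2) ∂gaussianReal 0 1 := by
          rw [setLIntegral_const]
      _ ≤ ∫⁻ g in Set.Icc (y + b) (y + b + 1),
          gaussPi (MainIdx (n + 1)) (Prod.mk g ⁻¹' E) ∂gaussianReal 0 1 :=
          setLIntegral_mono' measurableSet_Icc hsec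
      _ ≤ _ := setLIntegral_le_lintegral _ _
  have hmarkov := mul_meas_ge_le_integral_of_nonneg (μ := μ) (ae_of_all _ fun p =>
    add_nonneg (critFun_nonneg u n (Wf p)) (critFun_nonneg u (n + 1) (Wf p))) hfi' (ε / 2)
  have hmono : μ.real E ≤ μ.real {p | ε / 2 ≤ f (Wf p)} := measureReal_mono hEsub
  rw [hint]
  refine le_trans ?_ hmarkov
  rw [mul_assoc]
  exact mul_le_mul_of_nonneg_left (hEmeas.trans hmono) (by positivity)

/-- Uniform exponential decay of the ratio. -/
theorem exists_critRatio_le (n : ℕ) (hc : 0 < c) (hK : 0 < K) :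
    ∃ K' U : ℝ, ∀ u ≥ U, ∀ C, PeakBounds n K c C → critRatio u C ≤ K' * Real.exp (-u) := by
  -- The shift 1/√c is the one of the lower bound, so both estimates carry the same window
  -- probability, which cancels; the rate is 1.
  obtain ⟨K', hK', h1⟩ := exists_sum_critInt_le n hc hK (1 / Real.sqrt c) 1 (by positivity)
  obtain ⟨δ, U, hδ, h2⟩ := exists_critInt_add_ge n hc hK
  refine ⟨K' / δ, max U 1, fun u hu C h => ?_⟩
  have hnum := h1 u (by linarith [le_max_right U 1]) C h
  have hden := h2 u ((le_max_left _ _).trans hu) C h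
  set G := (gaussianReal 0 1).real (Set.Icc (2 * u / Real.sqrt (sumVar C) + 1 / Real.sqrt c)
          (2 * u / Real.sqrt (sumVar C) + 1 / Real.sqrt c + 1))
  have hG : 0 < G := by
    refine lt_of_lt_of_le ?_ (gaussianReal_Icc_ge (y := 2 * u / Real.sqrt (sumVar C)) ?_ ?_)
    · positivity
    · have : 0 ≤ u := by linarith [le_max_right U 1]
      positivity
    · positivity
  rw [critRatio, Nat.add_sub_cancel, div_le_iff₀ (lt_of_lt_of_le (by positivity) hden)]
  refine hnum.trans ?_
  calc K' * Real.exp (-1 * u) * G = K' / δ * Real.exp (-u) * (δ * G) := by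
        rw [neg_one_mul]
        field_simp
    _ ≤ _ := mul_le_mul_of_nonneg_left hden (by positivity)

end PeakBounds

end CritPair

namespace CritPair

/-! ### Gaussian subspaces of L² and mean square differentiability. -/

section GaussianSpace

variable {Ω : Type*} [MeasurableSpace Ω] {P : Measure Ω}

/-- A closed linear space of square integrable random variables with centered Gaussian laws. -/
structure IsGaussianSpace (S : Submodule ℝ (Lp ℝ 2 P)) : Prop where
  closed : IsClosed (S : Set (Lp ℝ 2 P))
  mean : ∀ f ∈ S, ∫ ω, f ω ∂P = 0
  cos : ∀ f ∈ S, ∫ ω, Real.cos (f ω) ∂P = Real.exp (-(‖f‖ ^ 2 / 2))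

theorem norm_toLp_sq {f : Ω → ℝ} (hf : MemLp f 2 P) : ‖hf.toLp f‖ ^ 2 = ∫ ω, f ω ^ 2 ∂P := by
  rw [← real_inner_self_eq_norm_sq, L2.inner_def]
  refine integral_congr_ae ?_
  filter_upwards [hf.coeFn_toLp] with ω h
  simp [h, sq]

theorem inner_toLp {f g : Ω → ℝ} (hf : MemLp f 2 P) (hg : MemLp g 2 P) :
    inner ℝ (hf.toLp f) (hg.toLp g) = ∫ ω, f ω * g ω ∂P := by
  rw [L2.inner_def]
  refine integral_congr_ae ?_
  filter_upwards [hf.coeFn_toLp, hg.coeFn_toLp] with ω h h'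
  simp [h, h', mul_comm]

variable [IsProbabilityMeasure P]

/-- Convergence in L² gives almost sure convergence along a subsequence, and cos is bounded. The
identity E cos f = exp(-‖f‖²/2) is the only trace of Gaussianity needed, and it passes to closed
spans. -/
theorem isClosed_cos_eq :
    IsClosed {f : Lp ℝ 2 P | ∫ ω, Real.cos (f ω) ∂P = Real.exp (-(‖f‖ ^ 2 / 2))} := by
  refine IsSeqClosed.isClosed fun f g hf hfg => ?_
  obtain ⟨ns, hns, hae⟩ := (tendstoInMeasure_of_tendsto_Lp hfg).exists_seq_tendsto_ae
  have h1 : Tendsto (fun n => ∫ ω, Real.cos (f (ns n) ω) ∂P) atTop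
      (𝓝 (∫ ω, Real.cos (g ω) ∂P)) := by
    refine tendsto_integral_of_dominated_convergence (fun _ => 1)
      (fun n => Real.continuous_cos.comp_aestronglyMeasurable (Lp.aestronglyMeasurable _))
      (integrable_const 1) (fun n => ae_of_all _ fun ω => Real.abs_cos_le_one _) ?_
    filter_upwards [hae] with ω hω
    exact (Real.continuous_cos.tendsto _).comp hω
  have h2 : Tendsto (fun n => Real.exp (-(‖f (ns n)‖ ^ 2 / 2))) atTop
      (𝓝 (Real.exp (-(‖g‖ ^ 2 / 2)))) := by
    have : Continuous fun f : Lp ℝ 2 P => Real.exp (-(‖f‖ ^ 2 / 2)) := by fun_prop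
    exact (this.tendsto g).comp (hfg.comp hns.tendsto_atTop)
  refine tendsto_nhds_unique h1 (h2.congr fun n => ?_)
  exact (hf (ns n)).symm

theorem isClosed_mean_eq_zero : IsClosed {f : Lp ℝ 2 P | ∫ ω, f ω ∂P = 0} := by
  have h : ∀ f : Lp ℝ 2 P, ∫ ω, f ω ∂P
      = inner ℝ (indicatorConstLp 2 MeasurableSet.univ (measure_ne_top P _) (1 : ℝ)) f := by
    intro f
    rw [L2.inner_indicatorConstLp_one]
    simp
  simp_rw [h]
  exact isClosed_eq (by fun_prop) continuous_const

theorem integral_cos_of_hasGaussianLaw {f : Ω → ℝ} (hf : HasGaussianLaw f P)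
    (h0 : ∫ ω, f ω ∂P = 0) :
    ∫ ω, Real.cos (f ω) ∂P = Real.exp (-((∫ ω, f ω ^ 2 ∂P) / 2)) := by
  have h := hf.charFun_map_eq 1
  rw [charFun_apply, integral_map hf.aemeasurable (by fun_prop)] at h
  have hv : Var[f; P] = ∫ ω, f ω ^ 2 ∂P :=
    variance_of_integral_eq_zero hf.aemeasurable h0
  have hre := congrArg Complex.re h
  have hint : Integrable (fun ω => Complex.exp ((inner ℝ (f ω) (1 : ℝ) : ℝ) * Complex.I)) P := by
    refine Integrable.of_bound (C := 1) ?_ (ae_of_all _ fun ω => ?_)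
    · exact (by fun_prop : Continuous fun x : ℝ =>
        Complex.exp ((inner ℝ x (1 : ℝ) : ℝ) * Complex.I)).comp_aestronglyMeasurable
        hf.aemeasurable.aestronglyMeasurable
    · rw [Complex.norm_exp_ofReal_mul_I]
  rw [← RCLike.re_eq_complex_re, ← integral_re hint] at hre
  simp only [RCLike.re_eq_complex_re, Complex.exp_ofReal_mul_I_re] at hre
  convert hre using 1
  · simp
  · simp only [RCLike.inner_apply, conj_trivial, mul_one, h0, hv]
    rw [show (((0 : ℝ) : ℂ) * Complex.I - ((∫ ω, f ω ^ 2 ∂P : ℝ) : ℂ) / 2)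
      = ((-((∫ ω, f ω ^ 2 ∂P) / 2) : ℝ) : ℂ) by push_cast; ring, Complex.exp_ofReal_re]

/-- The closed linear span of a centered Gaussian process. -/
theorem isGaussianSpace_span {T : Type*} {X : T → Ω → ℝ} (hX : IsGaussianProcess X P)
    (h0 : ∀ t, ∫ ω, X t ω ∂P = 0) (hm : ∀ t, MemLp (X t) 2 P) :
    IsGaussianSpace (Submodule.span ℝ (Set.range fun t => (hm t).toLp (X t))).topologicalClosure := by
  have key : ∀ f ∈ Submodule.span ℝ (Set.range fun t => (hm t).toLp (X t)),
      ∫ ω, f ω ∂P = 0 ∧ ∫ ω, Real.cos (f ω) ∂P = Real.exp (-(‖f‖ ^ 2 / 2)) := by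
    intro f hf
    obtain ⟨c, rfl⟩ := Finsupp.mem_span_range_iff_exists_finsupp.1 hf
    have hmem : MemLp (fun ω => ∑ t ∈ c.support, c t • X t ω) 2 P :=
      memLp_finsetSum _ fun t _ => (hm t).const_smul (c t)
    have heq : (c.sum fun t a => a • (hm t).toLp (X t)) = hmem.toLp _ := by
      refine Lp.ext ?_
      refine EventuallyEq.trans ?_ hmem.coeFn_toLp.symm
      rw [Finsupp.sum]
      refine (Lp.coeFn_finsetSum _ _).trans ?_
      have : ∀ᵐ ω ∂P, ∀ t ∈ c.support, (c t • (hm t).toLp (X t) : Lp ℝ 2 P) ω = c t • X t ω := by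
        refine (ae_ball_iff c.support.countable_toSet).2 fun t _ => ?_
        filter_upwards [Lp.coeFn_smul (c t) ((hm t).toLp (X t)), (hm t).coeFn_toLp] with ω h h'
        rw [h, Pi.smul_apply, h']
      filter_upwards [this] with ω hω
      rw [Finset.sum_apply]
      exact Finset.sum_congr rfl hω
    have hg : HasGaussianLaw (fun ω => ∑ t ∈ c.support, c t • X t ω) P :=
      (hX.smul c).hasGaussianLaw_fun_sum
    have hz : ∫ ω, ∑ t ∈ c.support, c t • X t ω ∂P = 0 := by
      rw [integral_finsetSum]
      · simp [integral_const_mul, h0]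
      · exact fun t _ => ((hm t).integrable one_le_two).smul (c t)
    rw [heq, norm_toLp_sq, ← integral_cos_of_hasGaussianLaw hg hz]
    refine ⟨?_, integral_congr_ae ?_⟩
    · rw [integral_congr_ae hmem.coeFn_toLp, hz]
    · filter_upwards [hmem.coeFn_toLp] with ω h
      rw [h]
  refine ⟨Submodule.isClosed_topologicalClosure _, fun f hf => ?_, fun f hf => ?_⟩
  · exact closure_minimal (fun f hf => (key f hf).1) isClosed_mean_eq_zero hf
  · exact closure_minimal (fun f hf => (key f hf).2) isClosed_cos_eq hf

/-- In a Gaussian space, almost sure convergence implies convergence in `L²`. -/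
theorem IsGaussianSpace.tendsto_of_ae {S : Submodule ℝ (Lp ℝ 2 P)} (hS : IsGaussianSpace S)
    {α : Type*} {l : Filter α} [l.IsCountablyGenerated] [l.NeBot] {f : α → Ω → ℝ} {g : Ω → ℝ}
    (hf : ∀ a, MemLp (f a) 2 P) (hfS : ∀ a, (hf a).toLp (f a) ∈ S)
    (hfg : ∀ᵐ ω ∂P, Tendsto (fun a => f a ω) l (𝓝 (g ω))) :
    ∃ hg : MemLp g 2 P, hg.toLp g ∈ S ∧
      Tendsto (fun a => (hf a).toLp (f a)) l (𝓝 (hg.toLp g)) := by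
  -- Differences stay in S, so their norms can be read off E cos(f a - f b). This tends to 1 by
  -- bounded convergence, which makes the family Cauchy in L².
  have hcos : Tendsto (fun p : α × α =>
      Real.exp (-(‖(hf p.1).toLp (f p.1) - (hf p.2).toLp (f p.2)‖ ^ 2 / 2))) (l ×ˢ l) (𝓝 1) := by
    have h1 : ∀ p : α × α,
        Real.exp (-(‖(hf p.1).toLp (f p.1) - (hf p.2).toLp (f p.2)‖ ^ 2 / 2))
          = ∫ ω, Real.cos (f p.1 ω - f p.2 ω) ∂P := by
      intro p
      rw [← hS.cos _ (S.sub_mem (hfS p.1) (hfS p.2))]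
      refine integral_congr_ae ?_
      filter_upwards [Lp.coeFn_sub ((hf p.1).toLp (f p.1)) ((hf p.2).toLp (f p.2)),
        (hf p.1).coeFn_toLp, (hf p.2).coeFn_toLp] with ω h h' h''
      rw [h, Pi.sub_apply, h', h'']
    simp_rw [h1]
    have h2 : (1 : ℝ) = ∫ _, (1 : ℝ) ∂P := by simp
    rw [h2]
    refine tendsto_integral_filter_of_dominated_convergence (fun _ => 1)
      (Eventually.of_forall fun p => Real.continuous_cos.comp_aestronglyMeasurable
        ((hf p.1).aestronglyMeasurable.sub (hf p.2).aestronglyMeasurable))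
      (Eventually.of_forall fun p => ae_of_all _ fun ω => Real.abs_cos_le_one _)
      (integrable_const 1) ?_
    filter_upwards [hfg] with ω hω
    have h3 : Tendsto (fun p : α × α => f p.1 ω - f p.2 ω) (l ×ˢ l) (𝓝 (g ω - g ω)) :=
      (hω.comp tendsto_fst).sub (hω.comp tendsto_snd)
    rw [sub_self] at h3
    have h4 := (Real.continuous_cos.tendsto 0).comp h3
    rw [Real.cos_zero] at h4
    exact h4
  have hcauchy : Cauchy (map (fun a => (hf a).toLp (f a)) l) := by
    rw [cauchy_map_iff]
    refine ⟨inferInstance, tendsto_uniformity_iff_dist_tendsto_zero.2 ?_⟩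
    have h1 : Tendsto (fun p : α × α =>
        ‖(hf p.1).toLp (f p.1) - (hf p.2).toLp (f p.2)‖ ^ 2) (l ×ˢ l) (𝓝 0) := by
      have h2 := (((Real.continuousAt_log one_ne_zero).tendsto.comp hcos).const_mul (-2))
      simp only [Real.log_one, mul_zero] at h2
      refine h2.congr fun p => ?_
      simp only [Function.comp_apply, Real.log_exp]
      ring
    have h3 := (Real.continuous_sqrt.tendsto 0).comp h1
    rw [Real.sqrt_zero] at h3
    refine h3.congr fun p => ?_
    simp only [Function.comp_apply]
    rw [Real.sqrt_sq (norm_nonneg _), dist_eq_norm]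
  obtain ⟨G, hG⟩ := CompleteSpace.complete hcauchy
  have hG' : Tendsto (fun a => (hf a).toLp (f a)) l (𝓝 G) := hG
  obtain ⟨a, ha⟩ := exists_seq_tendsto l
  obtain ⟨ns, hns, hae⟩ := (tendstoInMeasure_of_tendsto_Lp (hG'.comp ha)).exists_seq_tendsto_ae
  have hGg : G =ᵐ[P] g := by
    have hall : ∀ᵐ ω ∂P, ∀ n, (hf (a (ns n))).toLp (f (a (ns n))) ω = f (a (ns n)) ω :=
      ae_all_iff.2 fun n => (hf _).coeFn_toLp
    filter_upwards [hae, hfg, hall] with ω h1 h2 h3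
    refine tendsto_nhds_unique h1 ((h2.comp (ha.comp hns.tendsto_atTop)).congr fun n => ?_)
    exact (h3 n).symm
  have hg : MemLp g 2 P := (memLp_congr_ae hGg).1 (Lp.memLp G)
  have hGeq : hg.toLp g = G := Lp.ext (hg.coeFn_toLp.trans hGg.symm)
  refine ⟨hg, ?_, hGeq ▸ hG'⟩
  rw [hGeq]
  exact hS.closed.mem_of_tendsto hG' (Eventually.of_forall hfS)

/-- Almost sure partial derivatives of a field in a Gaussian space are derivatives in `L²`. -/
theorem IsGaussianSpace.hasDerivAt_toLp {S : Submodule ℝ (Lp ℝ 2 P)} (hS : IsGaussianSpace S)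
    {E : Type*} [AddCommGroup E] [Module ℝ E] {Z : E → Ω → ℝ} {v : E}
    (hZ : ∀ t, MemLp (Z t) 2 P) (hZS : ∀ t, (hZ t).toLp (Z t) ∈ S)
    (hd : ∀ᵐ ω ∂P, ∀ t, LineDifferentiableAt ℝ (fun s => Z s ω) t v) :
    ∃ hW : ∀ t, MemLp (fun ω => lineDeriv ℝ (fun s => Z s ω) t v) 2 P,
      (∀ t, (hW t).toLp _ ∈ S) ∧
      ∀ t, HasDerivAt (fun h : ℝ => (hZ (t + h • v)).toLp (Z (t + h • v))) ((hW t).toLp _) 0 := by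
  have hf : ∀ (t : E) (h : ℝ), MemLp (fun ω => h⁻¹ • (Z (t + h • v) ω - Z t ω)) 2 P :=
    fun t h => ((hZ _).sub (hZ _)).const_smul h⁻¹
  have heq : ∀ (t : E) (h : ℝ), (hf t h).toLp _
      = h⁻¹ • ((hZ (t + h • v)).toLp (Z (t + h • v)) - (hZ t).toLp (Z t)) := fun t h => rfl
  have key : ∀ t, ∃ hg : MemLp (fun ω => lineDeriv ℝ (fun s => Z s ω) t v) 2 P,
      hg.toLp _ ∈ S ∧ Tendsto (fun h => (hf t h).toLp _) (𝓝[≠] 0) (𝓝 (hg.toLp _)) := by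
    intro t
    refine hS.tendsto_of_ae (hf t) (fun h => ?_) ?_
    · rw [heq]
      exact S.smul_mem _ (S.sub_mem (hZS _) (hZS _))
    · filter_upwards [hd] with ω hω
      exact (hω t).hasLineDerivAt.tendsto_slope_zero
  choose hW hWS hW' using key
  refine ⟨hW, hWS, fun t => ?_⟩
  rw [hasDerivAt_iff_tendsto_slope_zero]
  refine (hW' t).congr fun h => ?_
  rw [heq]
  simp

end GaussianSpace

end CritPair

namespace CritPair

/-! ### Isotropic fields with values in a Hilbert space; smoothness of ρ. -/

section Stationary

open scoped RealInnerProductSpace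

/-- An isotropic field with values in a Hilbert space, with its first and second partial
derivatives. -/
structure IsHilbertField {N : ℕ} {H : Type*} [NormedAddCommGroup H] [InnerProductSpace ℝ H]
    (ρ : ℝ → ℝ) (x : EuclideanSpace ℝ (Fin N) → H) (x1 : Fin N → EuclideanSpace ℝ (Fin N) → H)
    (x2 : Fin N → Fin N → EuclideanSpace ℝ (Fin N) → H) : Prop where
  cov : ∀ t s, ⟪x t, x s⟫ = ρ (‖t - s‖ ^ 2)
  deriv1 : ∀ i t, HasDerivAt (fun h : ℝ => x (t + h • basisVec i)) (x1 i t) 0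
  deriv2 : ∀ i j t, HasDerivAt (fun h : ℝ => x1 i (t + h • basisVec j)) (x2 i j t) 0

/-- `ρ` is three times continuously differentiable on `[0, ∞)`, with derivatives `ρ₁, ρ₂, ρ₃`. -/
structure HasDerivs (ρ ρ₁ ρ₂ ρ₃ : ℝ → ℝ) : Prop where
  d1 : ∀ x ∈ Set.Ici (0 : ℝ), HasDerivWithinAt ρ (ρ₁ x) (Set.Ici 0) x
  d2 : ∀ x ∈ Set.Ici (0 : ℝ), HasDerivWithinAt ρ₁ (ρ₂ x) (Set.Ici 0) x
  d3 : ∀ x ∈ Set.Ici (0 : ℝ), HasDerivWithinAt ρ₂ (ρ₃ x) (Set.Ici 0) x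
  cont : ContinuousOn ρ₃ (Set.Ici 0)

variable {N : ℕ} {H : Type*} [NormedAddCommGroup H] [InnerProductSpace ℝ H]
  {ρ : ℝ → ℝ} {x : EuclideanSpace ℝ (Fin N) → H} {x1 : Fin N → EuclideanSpace ℝ (Fin N) → H}
  {x2 : Fin N → Fin N → EuclideanSpace ℝ (Fin N) → H}

theorem hasDerivAt_shift {V W : Type*} [AddCommGroup V] [Module ℝ V] [NormedAddCommGroup W]
    [NormedSpace ℝ W] {f : V → W} {f' : V → W} {e : V}
    (h : ∀ t, HasDerivAt (fun r : ℝ => f (t + r • e)) (f' t) 0) (t : V) (r : ℝ) :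
    HasDerivAt (fun r : ℝ => f (t + r • e)) (f' (t + r • e)) r := by
  have h1 := HasDerivAt.comp_sub_const (f := fun s : ℝ => f (t + r • e + s • e)) r r
    (by rw [sub_self]; exact h (t + r • e))
  refine h1.congr_of_eventuallyEq (Eventually.of_forall fun s => ?_)
  change f (t + s • e) = f (t + r • e + (s - r) • e)
  rw [sub_smul, add_assoc, add_sub_cancel]

/-- The covariance function of a twice mean square differentiable isotropic field is four times
differentiable along lines. -/
theorem IsHilbertField.contDiff_line (hx : IsHilbertField ρ x x1 x2) (i : Fin N) :
    ContDiff ℝ 3 (fun r : ℝ => ρ (r ^ 2)) := by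
  set e : EuclideanSpace ℝ (Fin N) := basisVec i with he
  have hnorm : ∀ r : ℝ, ‖r • e‖ ^ 2 = r ^ 2 := by
    intro r
    rw [norm_smul, he, basisVec]
    simp
  have hy : ∀ r : ℝ, HasDerivAt (fun r : ℝ => x (r • e)) (x1 i (r • e)) r := by
    intro r
    simpa using hasDerivAt_shift (hx.deriv1 i) 0 r
  have hy1 : ∀ r : ℝ, HasDerivAt (fun r : ℝ => x1 i (r • e)) (x2 i i (r • e)) r := by
    intro r
    simpa using hasDerivAt_shift (hx.deriv2 i i) 0 r
  set c : ℝ → ℝ := fun r => ρ (r ^ 2) with hc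
  have hcov : ∀ r s : ℝ, ⟪x (r • e), x (s • e)⟫ = c (r - s) := by
    intro r s
    rw [hx.cov, ← sub_smul, hnorm]
  have hd1 : ∀ r s : ℝ, HasDerivAt c ⟪x1 i (r • e), x (s • e)⟫ (r - s) := by
    intro r s
    have h := (hy r).inner ℝ (hasDerivAt_const r (x (s • e)))
    simp only [inner_zero_right, zero_add] at h
    have h' := HasDerivAt.comp_add_const (f := fun r : ℝ => ⟪x (r • e), x (s • e)⟫) (r - s) s
      (by rw [sub_add_cancel]; exact h)
    refine h'.congr_of_eventuallyEq (Eventually.of_forall fun u => ?_)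
    change c u = ⟪x ((u + s) • e), x (s • e)⟫
    rw [hcov, add_sub_cancel_right]
  have hc1 : ∀ r s : ℝ, ⟪x1 i (r • e), x (s • e)⟫ = deriv c (r - s) := fun r s => (hd1 r s).deriv.symm
  -- A function of r - s written as an inner product gains a derivative from either argument;
  -- differentiating in s changes the sign. Two derivatives of the field on each side give four of
  -- the covariance.
  have sec : ∀ {f : ℝ → ℝ} {y z : ℝ → H} {w : ℝ → H}, (∀ s, HasDerivAt z (w s) s) →
      (∀ r s, ⟪y r, z s⟫ = f (r - s)) → ∀ r s, HasDerivAt f (-⟪y r, w s⟫) (r - s) := by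
    intro f y z w hz hf r s
    have h := (hasDerivAt_const s (y r)).inner ℝ (hz s)
    simp only [inner_zero_left, add_zero] at h
    have h' := HasDerivAt.comp_const_sub (f := fun s : ℝ => ⟪y r, z s⟫) r (r - s)
      (by rw [sub_sub_cancel]; exact h)
    refine h'.congr_of_eventuallyEq (Eventually.of_forall fun u => ?_)
    change f u = ⟪y r, z (r - u)⟫
    rw [hf, sub_sub_cancel]
  have hd2 := sec hy hc1
  have hc2 : ∀ r s : ℝ, ⟪x1 i (r • e), x1 i (s • e)⟫ = -deriv (deriv c) (r - s) := fun r s => by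
    rw [(hd2 r s).deriv, neg_neg]
  have hd4 := sec (f := fun u => -deriv (deriv c) u) (y := fun r => x1 i (r • e)) hy1 hc2
  have e1 : Differentiable ℝ c := fun r => by
    have := hd1 r 0
    rw [sub_zero] at this
    exact this.differentiableAt
  have e2 : Differentiable ℝ (deriv c) := fun r => by
    have := hd2 r 0
    rw [sub_zero] at this
    exact this.differentiableAt
  have e3 : ∀ r s : ℝ, HasDerivAt (deriv (deriv c)) ⟪x1 i (r • e), x2 i i (s • e)⟫ (r - s) := by
    intro r s
    have := (hd4 r s).fun_neg
    simpa using this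
  have hc3 : ∀ s r : ℝ, ⟪x2 i i (s • e), x1 i (r • e)⟫ = deriv (deriv (deriv c)) (-(s - r)) := by
    intro s r
    rw [real_inner_comm, ← (e3 r s).deriv, neg_sub]
  have hd5 := sec (f := fun u => deriv (deriv (deriv c)) (-u)) (y := fun s => x2 i i (s • e))
    hy1 hc3
  have e4 : Differentiable ℝ (deriv (deriv (deriv c))) := fun r => by
    have h := hd5 (-r) 0
    rw [sub_zero] at h
    have h2 := HasDerivAt.comp r h (hasDerivAt_neg r)
    have h3 : (fun u => deriv (deriv (deriv c)) (-u)) ∘ (fun u : ℝ => -u)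
        = deriv (deriv (deriv c)) := by
      funext u; simp
    have h4 := h2.differentiableAt
    change DifferentiableAt ℝ ((fun u => deriv (deriv (deriv c)) (-u)) ∘ (fun u : ℝ => -u)) r at h4
    rwa [h3] at h4
  refine contDiff_of_differentiable_iteratedDeriv fun m hm => ?_
  have hm' : m ≤ 3 := by exact_mod_cast hm
  interval_cases m
  · simpa using e1
  · simpa [iteratedDeriv_one] using e2
  · rw [iteratedDeriv_succ, iteratedDeriv_one]
    exact fun r => (by simpa using (e3 r 0) : HasDerivAt _ _ r).differentiableAt
  · rw [iteratedDeriv_succ, iteratedDeriv_succ, iteratedDeriv_one]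
    exact e4

/-- Away from 0, ρ is the composition of r ↦ ρ(r²) with the square root. At 0, where the root is not
smooth, the regularity assumed on [0, d²] takes over. -/
theorem contDiffOn_Ici_of_contDiff_sq (h : ContDiff ℝ 3 (fun r : ℝ => ρ (r ^ 2)))
    {d : ℝ} (hd : 0 < d) (hs : SmoothCond ρ d) : ContDiffOn ℝ 3 ρ (Set.Ici 0) := by
  intro y hy
  rcases eq_or_lt_of_le (Set.mem_Ici.1 hy) with rfl | hy
  · have h1 : ContDiffWithinAt ℝ 3 ρ (Set.Icc 0 (d ^ 2)) 0 :=
      (hs 0 ⟨le_rfl, by positivity⟩).of_le (by norm_num)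
    refine h1.mono_of_mem_nhdsWithin ?_
    rw [mem_nhdsWithin]
    exact ⟨Set.Iio (d ^ 2), isOpen_Iio, by simpa using by positivity, fun z hz => ⟨hz.2, hz.1.le⟩⟩
  · have h1 : ContDiffAt ℝ 3 (fun y : ℝ => ρ (Real.sqrt y ^ 2)) y :=
      h.contDiffAt.comp y (Real.contDiffAt_sqrt hy.ne')
    refine (h1.congr_of_eventuallyEq ?_).contDiffWithinAt
    filter_upwards [lt_mem_nhds hy] with z hz
    rw [Real.sq_sqrt hz.le]

theorem hasDerivs_of_contDiffOn (h : ContDiffOn ℝ 3 ρ (Set.Ici 0)) :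
    HasDerivs ρ (iteratedDerivWithin 1 ρ (Set.Ici 0)) (iteratedDerivWithin 2 ρ (Set.Ici 0))
      (iteratedDerivWithin 3 ρ (Set.Ici 0)) := by
  have key : ∀ k < 3, ∀ y ∈ Set.Ici (0 : ℝ), HasDerivWithinAt (iteratedDerivWithin k ρ (Set.Ici 0))
      (iteratedDerivWithin (k + 1) ρ (Set.Ici 0) y) (Set.Ici 0) y := by
    intro k hk y hy
    rw [iteratedDerivWithin_succ]
    exact (h.differentiableOn_iteratedDerivWithin (by exact_mod_cast hk) (uniqueDiffOn_Ici 0) y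
      hy).hasDerivWithinAt
  refine ⟨fun y hy => ?_, key 1 (by norm_num), key 2 (by norm_num),
    h.continuousOn_iteratedDerivWithin le_rfl (uniqueDiffOn_Ici 0)⟩
  simpa using key 0 (by norm_num) y hy

end Stationary

end CritPair

namespace CritPair

/-! ### Covariances of directional derivatives in terms of ρ and its derivatives. -/

section DirectionalDerivatives

open scoped RealInnerProductSpace

variable {N : ℕ} {H : Type*} [NormedAddCommGroup H] [InnerProductSpace ℝ H]
  {ρ ρ₁ ρ₂ ρ₃ : ℝ → ℝ} {x : EuclideanSpace ℝ (Fin N) → H}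
  {x1 : Fin N → EuclideanSpace ℝ (Fin N) → H}
  {x2 : Fin N → Fin N → EuclideanSpace ℝ (Fin N) → H}

/-- The first derivative in direction `v`. -/
noncomputable def dir1 (x1 : Fin N → EuclideanSpace ℝ (Fin N) → H)
    (v t : EuclideanSpace ℝ (Fin N)) : H := ∑ i, v i • x1 i t

/-- The second derivative in directions `v` and `w`. -/
noncomputable def dir2 (x2 : Fin N → Fin N → EuclideanSpace ℝ (Fin N) → H)
    (v w t : EuclideanSpace ℝ (Fin N)) : H := ∑ j, w j • ∑ i, v i • x2 i j t

theorem dir1_basisVec (i : Fin N) (t : EuclideanSpace ℝ (Fin N)) :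
    dir1 x1 (basisVec i) t = x1 i t := by
  simp [dir1, basisVec]

theorem dir2_basisVec_right (v : EuclideanSpace ℝ (Fin N)) (j : Fin N)
    (t : EuclideanSpace ℝ (Fin N)) : dir2 x2 v (basisVec j) t = ∑ i, v i • x2 i j t := by
  simp [dir2, basisVec]

theorem dir2_basisVec (i j : Fin N) (t : EuclideanSpace ℝ (Fin N)) :
    dir2 x2 (basisVec i) (basisVec j) t = x2 i j t := by
  simp [dir2, basisVec]

theorem isLinearMap_inner_dir1 (t : EuclideanSpace ℝ (Fin N)) (y : H) :
    IsLinearMap ℝ fun v => ⟪dir1 x1 v t, y⟫ := by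
  constructor
  · intro v w
    simp [dir1, add_smul, Finset.sum_add_distrib, inner_add_left]
  · intro c v
    simp [dir1, mul_smul, ← Finset.smul_sum, inner_smul_left]

theorem isLinearMap_inner_dir2 (v t : EuclideanSpace ℝ (Fin N)) (y : H) :
    IsLinearMap ℝ fun w => ⟪dir2 x2 v w t, y⟫ := by
  constructor
  · intro w w'
    simp only [dir2, PiLp.add_apply, add_smul, Finset.sum_add_distrib, inner_add_left]
  · intro c w
    simp only [dir2, PiLp.smul_apply, smul_eq_mul, mul_smul, ← Finset.smul_sum, inner_smul_left]
    simp

theorem eq_of_eq_basisVec {L M : EuclideanSpace ℝ (Fin N) → ℝ} (hL : IsLinearMap ℝ L)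
    (hM : IsLinearMap ℝ M) (h : ∀ i, L (basisVec i) = M (basisVec i))
    (v : EuclideanSpace ℝ (Fin N)) : L v = M v := by
  have : hL.mk' L = hM.mk' M := by
    refine (EuclideanSpace.basisFun (Fin N) ℝ).toBasis.ext fun i => ?_
    simpa using h i
  exact congrArg (fun f : EuclideanSpace ℝ (Fin N) →ₗ[ℝ] ℝ => f v) this

theorem hasDerivAt_comp_norm_sq {f f' : ℝ → ℝ}
    (hf : ∀ y ∈ Set.Ici (0 : ℝ), HasDerivWithinAt f (f' y) (Set.Ici 0) y)
    (h e : EuclideanSpace ℝ (Fin N)) :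
    HasDerivAt (fun r : ℝ => f (‖h + r • e‖ ^ 2)) (f' (‖h‖ ^ 2) * (2 * ⟪h, e⟫)) 0 := by
  have h1 : HasDerivAt (fun r : ℝ => h + r • e) e 0 := by
    simpa using ((hasDerivAt_id (0 : ℝ)).smul_const e).const_add h
  have h2 := h1.norm_sq
  simp only [zero_smul, add_zero] at h2
  have h3 := HasDerivWithinAt.comp_hasDerivAt (t := Set.Ici 0) (0 : ℝ) (h₂ := f)
    (h := fun r : ℝ => ‖h + r • e‖ ^ 2) (h₂' := f' (‖h‖ ^ 2))
    (by simpa using hf (‖h‖ ^ 2) (Set.mem_Ici.2 (by positivity))) h2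
    (Eventually.of_forall fun r => Set.mem_Ici.2 (by positivity))
  exact h3

theorem hasDerivAt_inner_line (v h e : EuclideanSpace ℝ (Fin N)) :
    HasDerivAt (fun r : ℝ => ⟪v, h + r • e⟫) ⟪v, e⟫ 0 := by
  have h1 : HasDerivAt (fun r : ℝ => ⟪v, h⟫ + r * ⟪v, e⟫) (1 * ⟪v, e⟫) 0 :=
    ((hasDerivAt_id (0 : ℝ)).mul_const _).const_add _
  simpa [inner_add_right, inner_smul_right] using h1

/-- Linearity reduces to a basis vector, and there the inner product along a coordinate line is
differentiated in two ways. The next covariance formulas follow the same scheme. -/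
theorem IsHilbertField.inner_dir1 (hx : IsHilbertField ρ x x1 x2) (hρ : HasDerivs ρ ρ₁ ρ₂ ρ₃)
    (v t s : EuclideanSpace ℝ (Fin N)) :
    ⟪dir1 x1 v t, x s⟫ = 2 * ρ₁ (‖t - s‖ ^ 2) * ⟪v, t - s⟫ := by
  refine eq_of_eq_basisVec (L := fun v => ⟪dir1 x1 v t, x s⟫)
    (M := fun v => 2 * ρ₁ (‖t - s‖ ^ 2) * ⟪v, t - s⟫) (isLinearMap_inner_dir1 t _)
    ⟨fun a b => by simp only [inner_add_left]; ring,
      fun c a => by simp only [inner_smul_left, conj_trivial, smul_eq_mul]; ring⟩ (fun i => ?_) v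
  have h1 := (hx.deriv1 i t).inner ℝ (hasDerivAt_const (0 : ℝ) (x s))
  have h2 := hasDerivAt_comp_norm_sq hρ.d1 (t - s) (basisVec i)
  simp only [inner_zero_right, zero_add] at h1
  have h3 : (fun r : ℝ => ⟪x (t + r • basisVec i), x s⟫)
      = fun r : ℝ => ρ (‖t - s + r • basisVec i‖ ^ 2) := by
    funext r
    rw [hx.cov]
    congr 3
    abel
  rw [h3] at h1
  simp only [dir1_basisVec]
  rw [h1.unique h2, real_inner_comm]
  ring

theorem IsHilbertField.inner_dir1_dir1 (hx : IsHilbertField ρ x x1 x2)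
    (hρ : HasDerivs ρ ρ₁ ρ₂ ρ₃) (v w t s : EuclideanSpace ℝ (Fin N)) :
    ⟪dir1 x1 v t, dir1 x1 w s⟫ = -(2 * ρ₁ (‖t - s‖ ^ 2) * ⟪v, w⟫
      + 4 * ρ₂ (‖t - s‖ ^ 2) * ⟪v, t - s⟫ * ⟪w, t - s⟫) := by
  rw [real_inner_comm]
  refine eq_of_eq_basisVec (L := fun w => ⟪dir1 x1 w s, dir1 x1 v t⟫)
    (M := fun w => -(2 * ρ₁ (‖t - s‖ ^ 2) * ⟪v, w⟫
      + 4 * ρ₂ (‖t - s‖ ^ 2) * ⟪v, t - s⟫ * ⟪w, t - s⟫)) (isLinearMap_inner_dir1 s _)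
    ⟨fun a b => by simp only [inner_add_left, inner_add_right]; ring,
      fun c a => by simp only [inner_smul_left, inner_smul_right, conj_trivial, smul_eq_mul]; ring⟩
    (fun i => ?_) w
  have h1 := (hx.deriv1 i s).inner ℝ (hasDerivAt_const (0 : ℝ) (dir1 x1 v t))
  have h2 := ((hasDerivAt_comp_norm_sq hρ.d2 (t - s) (-basisVec i)).const_mul 2).mul
    (hasDerivAt_inner_line v (t - s) (-basisVec i))
  simp only [inner_zero_right, zero_add] at h1
  have h3 : (fun r : ℝ => ⟪x (s + r • basisVec i), dir1 x1 v t⟫)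
      = (fun r : ℝ => 2 * ρ₁ (‖t - s + r • -basisVec i‖ ^ 2)) *
        fun r : ℝ => ⟪v, t - s + r • -basisVec i⟫ := by
    funext r
    rw [real_inner_comm, hx.inner_dir1 hρ, Pi.mul_apply]
    have : t - (s + r • basisVec i) = t - s + r • -basisVec i := by rw [smul_neg]; abel
    rw [this]
  rw [h3] at h1
  simp only [dir1_basisVec]
  rw [h1.unique h2, real_inner_comm _ (basisVec i)]
  simp only [zero_smul, add_zero, inner_neg_right]
  ring

theorem hasDerivAt_dir1 (hx : IsHilbertField ρ x x1 x2) (v t : EuclideanSpace ℝ (Fin N))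
    (j : Fin N) : HasDerivAt (fun r : ℝ => dir1 x1 v (t + r • basisVec j))
      (dir2 x2 v (basisVec j) t) 0 := by
  rw [dir2_basisVec_right]
  exact HasDerivAt.fun_sum fun i _ => (hx.deriv2 i j t).const_smul (v i)

theorem IsHilbertField.inner_dir2 (hx : IsHilbertField ρ x x1 x2) (hρ : HasDerivs ρ ρ₁ ρ₂ ρ₃)
    (v w t s : EuclideanSpace ℝ (Fin N)) :
    ⟪dir2 x2 v w t, x s⟫ = 2 * ρ₁ (‖t - s‖ ^ 2) * ⟪v, w⟫
      + 4 * ρ₂ (‖t - s‖ ^ 2) * ⟪v, t - s⟫ * ⟪w, t - s⟫ := by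
  refine eq_of_eq_basisVec (L := fun w => ⟪dir2 x2 v w t, x s⟫)
    (M := fun w => 2 * ρ₁ (‖t - s‖ ^ 2) * ⟪v, w⟫
      + 4 * ρ₂ (‖t - s‖ ^ 2) * ⟪v, t - s⟫ * ⟪w, t - s⟫) (isLinearMap_inner_dir2 v t _)
    ⟨fun a b => by simp only [inner_add_left, inner_add_right]; ring,
      fun c a => by simp only [inner_smul_left, inner_smul_right, conj_trivial, smul_eq_mul]; ring⟩
    (fun i => ?_) w
  have h1 := (hasDerivAt_dir1 hx v t i).inner ℝ (hasDerivAt_const (0 : ℝ) (x s))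
  have h2 := ((hasDerivAt_comp_norm_sq hρ.d2 (t - s) (basisVec i)).const_mul 2).mul
    (hasDerivAt_inner_line v (t - s) (basisVec i))
  simp only [inner_zero_right, zero_add] at h1
  have h3 : (fun r : ℝ => ⟪dir1 x1 v (t + r • basisVec i), x s⟫)
      = (fun r : ℝ => 2 * ρ₁ (‖t - s + r • basisVec i‖ ^ 2)) *
        fun r : ℝ => ⟪v, t - s + r • basisVec i⟫ := by
    funext r
    rw [hx.inner_dir1 hρ, Pi.mul_apply]
    have : t + r • basisVec i - s = t - s + r • basisVec i := by abel
    rw [this]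
  rw [h3] at h1
  rw [h1.unique h2, real_inner_comm _ (basisVec i)]
  simp only [zero_smul, add_zero]
  ring

theorem IsHilbertField.inner_dir2_dir1 (hx : IsHilbertField ρ x x1 x2)
    (hρ : HasDerivs ρ ρ₁ ρ₂ ρ₃) (v w z t s : EuclideanSpace ℝ (Fin N)) :
    ⟪dir2 x2 v w t, dir1 x1 z s⟫ = -(4 * ρ₂ (‖t - s‖ ^ 2) *
        (⟪v, w⟫ * ⟪z, t - s⟫ + ⟪v, z⟫ * ⟪w, t - s⟫ + ⟪w, z⟫ * ⟪v, t - s⟫)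
      + 8 * ρ₃ (‖t - s‖ ^ 2) * ⟪v, t - s⟫ * ⟪w, t - s⟫ * ⟪z, t - s⟫) := by
  rw [real_inner_comm]
  refine eq_of_eq_basisVec (L := fun z => ⟪dir1 x1 z s, dir2 x2 v w t⟫)
    (M := fun z => -(4 * ρ₂ (‖t - s‖ ^ 2) *
        (⟪v, w⟫ * ⟪z, t - s⟫ + ⟪v, z⟫ * ⟪w, t - s⟫ + ⟪w, z⟫ * ⟪v, t - s⟫)
      + 8 * ρ₃ (‖t - s‖ ^ 2) * ⟪v, t - s⟫ * ⟪w, t - s⟫ * ⟪z, t - s⟫))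
    (isLinearMap_inner_dir1 s _)
    ⟨fun a b => by simp only [inner_add_left, inner_add_right]; ring,
      fun c a => by simp only [inner_smul_left, inner_smul_right, conj_trivial, smul_eq_mul]; ring⟩
    (fun i => ?_) z
  have h1 := (hx.deriv1 i s).inner ℝ (hasDerivAt_const (0 : ℝ) (dir2 x2 v w t))
  have h2 := (((hasDerivAt_comp_norm_sq hρ.d2 (t - s) (-basisVec i)).const_mul 2).mul_const
    ⟪v, w⟫).add ((((hasDerivAt_comp_norm_sq hρ.d3 (t - s) (-basisVec i)).const_mul 4).mul
    (hasDerivAt_inner_line v (t - s) (-basisVec i))).mul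
    (hasDerivAt_inner_line w (t - s) (-basisVec i)))
  simp only [inner_zero_right, zero_add] at h1
  simp only [dir1_basisVec]
  refine (h1.unique (h2.congr_of_eventuallyEq (Eventually.of_forall fun r => ?_))).trans ?_
  · have : t - (s + r • basisVec i) = t - s + r • -basisVec i := by rw [smul_neg]; abel
    simp only [real_inner_comm (dir2 x2 v w t), hx.inner_dir2 hρ, Pi.mul_apply, Pi.add_apply, this]
  · simp only [zero_smul, add_zero, inner_neg_right, Pi.mul_apply]
    rw [real_inner_comm _ (basisVec i)]
    ring

/-- A product rule that asks only for continuity of f where g vanishes. At coincident points each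
term of the third order covariance has a vanishing linear factor, so the fourth order one needs no
further derivative of ρ. -/
theorem hasDerivAt_mul_of_eq_zero {f g : ℝ → ℝ} {g' : ℝ} (hf : ContinuousAt f 0)
    (hg : HasDerivAt g g' 0) (h0 : g 0 = 0) : HasDerivAt (fun r => f r * g r) (f 0 * g') 0 := by
  rw [hasDerivAt_iff_tendsto_slope_zero] at hg ⊢
  have h1 := (hf.tendsto.mono_left nhdsWithin_le_nhds).mul hg
  refine h1.congr fun r => ?_
  simp only [zero_add, h0, mul_zero, sub_zero, smul_eq_mul]
  ring

theorem continuous_comp_norm_sq {f : ℝ → ℝ} (hf : ContinuousOn f (Set.Ici 0))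
    {V : Type*} [TopologicalSpace V] {g : V → EuclideanSpace ℝ (Fin N)} (hg : Continuous g) :
    Continuous fun r => f (‖g r‖ ^ 2) :=
  hf.comp_continuous (by fun_prop) fun r => Set.mem_Ici.2 (by positivity)

theorem IsHilbertField.inner_dir2_dir2 (hx : IsHilbertField ρ x x1 x2)
    (hρ : HasDerivs ρ ρ₁ ρ₂ ρ₃) (v w y z t : EuclideanSpace ℝ (Fin N)) :
    ⟪dir2 x2 v w t, dir2 x2 y z t⟫
      = 4 * ρ₂ 0 * (⟪v, w⟫ * ⟪y, z⟫ + ⟪v, y⟫ * ⟪w, z⟫ + ⟪v, z⟫ * ⟪w, y⟫) := by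
  rw [real_inner_comm]
  refine eq_of_eq_basisVec (L := fun z => ⟪dir2 x2 y z t, dir2 x2 v w t⟫)
    (M := fun z => 4 * ρ₂ 0 * (⟪v, w⟫ * ⟪y, z⟫ + ⟪v, y⟫ * ⟪w, z⟫ + ⟪v, z⟫ * ⟪w, y⟫))
    (isLinearMap_inner_dir2 y t _)
    ⟨fun a b => by simp only [inner_add_right]; ring,
      fun c a => by simp only [inner_smul_right, smul_eq_mul]; ring⟩
    (fun i => ?_) z
  have h1 := (hasDerivAt_dir1 hx y t i).inner ℝ (hasDerivAt_const (0 : ℝ) (dir2 x2 v w t))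
  simp only [inner_zero_right, zero_add] at h1
  have c2 : ContinuousOn ρ₂ (Set.Ici 0) := fun y hy => (hρ.d3 y hy).continuousWithinAt
  have hc : Continuous fun r : ℝ => (0 : EuclideanSpace ℝ (Fin N)) + r • -basisVec i := by
    fun_prop
  have hl := fun u : EuclideanSpace ℝ (Fin N) => hasDerivAt_inner_line u 0 (-basisVec i)
  have hl0 : ∀ u : EuclideanSpace ℝ (Fin N),
      (fun r : ℝ => ⟪u, 0 + r • -basisVec i⟫) 0 = 0 := by simp
  have hlc : ∀ u : EuclideanSpace ℝ (Fin N),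
      Continuous (fun r : ℝ => ⟪u, 0 + r • -basisVec i⟫) := by
    intro u
    fun_prop
  have h2 := (hasDerivAt_mul_of_eq_zero
    (((continuous_comp_norm_sq c2 hc).const_mul (4 : ℝ)).continuousAt)
    ((((hl y).const_mul ⟪v, w⟫).add ((hl w).const_mul ⟪v, y⟫)).add ((hl v).const_mul ⟪w, y⟫))
    (by simp)).add (hasDerivAt_mul_of_eq_zero
    ((((continuous_comp_norm_sq hρ.cont hc).const_mul (8 : ℝ)).mul (hlc v)).mul
      (hlc w)).continuousAt (hl y) (hl0 y))
  have h3 := h2.neg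
  refine (h1.unique (h3.congr_of_eventuallyEq (Eventually.of_forall fun r => ?_))).trans ?_
  · have : t - (t + r • basisVec i) = 0 + r • -basisVec i := by rw [smul_neg]; abel
    simp only [real_inner_comm (dir2 x2 v w t), hx.inner_dir2_dir1 hρ, Pi.add_apply, Pi.neg_apply,
      Pi.mul_apply, this]
  · simp only [Pi.mul_apply, zero_smul, add_zero, inner_neg_right, inner_zero_right, norm_zero]
    rw [zero_pow two_ne_zero]
    ring

end DirectionalDerivatives

end CritPair

namespace CritPair

/-! ### Realization of a qualified field in L². -/

section FieldInHilbertSpace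

open scoped RealInnerProductSpace

/-- The matrix of inner products of two families of vectors. -/
noncomputable def crossGram {ι κ H : Type*} [NormedAddCommGroup H] [InnerProductSpace ℝ H]
    (y : ι → H) (z : κ → H) : Matrix ι κ ℝ := Matrix.of fun a b => ⟪y a, z b⟫

/-- The Hilbert space version of `mainVec`. -/
def mainFam {N : ℕ} {H : Type*} (x : EuclideanSpace ℝ (Fin N) → H)
    (x2 : Fin N → Fin N → EuclideanSpace ℝ (Fin N) → H) (t : EuclideanSpace ℝ (Fin N)) :
    MainIdx N → H :=
  Sum.elim (fun p => x2 p.1.1 p.1.2 t) ![x t, x 0]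

/-- The Hilbert space version of `gradVec`. -/
def gradFam {N : ℕ} {H : Type*} (x1 : Fin N → EuclideanSpace ℝ (Fin N) → H)
    (t : EuclideanSpace ℝ (Fin N)) : Fin N ⊕ Fin N → H :=
  Sum.elim (fun i => x1 i t) (fun i => x1 i 0)

variable {N : ℕ} {Ω : Type*} [MeasurableSpace Ω] {P : Measure Ω} [IsProbabilityMeasure P]
  {X : EuclideanSpace ℝ (Fin N) → Ω → ℝ} {ρ : ℝ → ℝ}

theorem covariance_eq_inner {f g : Ω → ℝ} (hf : MemLp f 2 P) (hg : MemLp g 2 P)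
    (h0 : ∫ ω, f ω ∂P = 0) : cov[f, g; P] = ⟪hf.toLp f, hg.toLp g⟫ := by
  rw [covariance_eq_sub hf hg, inner_toLp, h0]
  simp

/-- A qualified field, together with its first and second derivatives, realized in `L²`. -/
theorem IsQualified.exists_isHilbertField (hX : IsQualified P X ρ) :
    ∃ (x : EuclideanSpace ℝ (Fin N) → Lp ℝ 2 P) (x1 : Fin N → EuclideanSpace ℝ (Fin N) → Lp ℝ 2 P)
      (x2 : Fin N → Fin N → EuclideanSpace ℝ (Fin N) → Lp ℝ 2 P),
      IsHilbertField ρ x x1 x2 ∧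
      (∀ t, covMat P (mainVec X t) (mainVec X t) = crossGram (mainFam x x2 t) (mainFam x x2 t)) ∧
      (∀ t, covMat P (mainVec X t) (gradVec X t) = crossGram (mainFam x x2 t) (gradFam x1 t)) ∧
      (∀ t, covMat P (gradVec X t) (mainVec X t) = crossGram (gradFam x1 t) (mainFam x x2 t)) ∧
      (∀ t, covMat P (gradVec X t) (gradVec X t) = crossGram (gradFam x1 t) (gradFam x1 t)) ∧
      covMat P (fun i => partial1 X i 0) (fun i => partial1 X i 0)
        = crossGram (fun i => x1 i 0) (fun i => x1 i 0) ∧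
      ∀ i j : Fin N, (∃ Y : Ω → ℝ, MemLp Y 2 P ∧
          Tendsto (fun h : ℝ => eLpNorm (fun ω => h⁻¹ * (partial2 X i i (h • basisVec i) ω -
            partial2 X i i 0 ω) - Y ω) 2 P) (𝓝[≠] 0) (𝓝 0) ∧
          (covMat P (Sum.elim (fun _ : Unit => Y) (fun i => partial1 X i 0))
            (Sum.elim (fun _ : Unit => Y) (fun i => partial1 X i 0))).PosDef) →
        ∃ y : Lp ℝ 2 P, HasDerivAt (fun h : ℝ => x2 i i (h • basisVec i)) y 0 ∧
          ⟪y, x1 j 0⟫ ^ 2 < ⟪y, y⟫ * ⟪x1 j 0, x1 j 0⟫ := by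
  have h0 : ∀ t, MemLp (X t) 2 P := fun t => (hX.gaussian.hasGaussianLaw_eval t).memLp_two
  set S := (Submodule.span ℝ (Set.range fun t => (h0 t).toLp (X t))).topologicalClosure with hSdef
  have hS : IsGaussianSpace S := isGaussianSpace_span hX.gaussian hX.centered h0
  have h0S : ∀ t, (h0 t).toLp (X t) ∈ S := fun t =>
    Submodule.le_topologicalClosure _ (Submodule.subset_span ⟨t, rfl⟩)
  have H1 : ∀ i, _ := fun i => hS.hasDerivAt_toLp (v := basisVec i) h0 h0S (by
    filter_upwards [hX.partials] with ω hω t using (hω t i).1)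
  choose h1 h1S h1d using H1
  have H2 : ∀ i j, _ := fun i j => hS.hasDerivAt_toLp (v := basisVec j) (Z := partial1 X i)
    (h1 i) (h1S i) (by
      filter_upwards [hX.partials] with ω hω t using (hω t i).2 j)
  choose h2 h2S h2d using H2
  have mean : ∀ {f : Ω → ℝ} (hf : MemLp f 2 P), hf.toLp f ∈ S → ∫ ω, f ω ∂P = 0 := by
    intro f hf hfS
    rw [← hS.mean _ hfS]
    exact integral_congr_ae hf.coeFn_toLp.symm
  have h1' : ∀ i t, MemLp (partial1 X i t) 2 P := h1
  have h1S' : ∀ i t, (h1' i t).toLp (partial1 X i t) ∈ S := h1S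
  have h2' : ∀ i j t, MemLp (partial2 X i j t) 2 P := h2
  have h2S' : ∀ i j t, (h2' i j t).toLp (partial2 X i j t) ∈ S := h2S
  have hgram : ∀ {ι κ : Type} (y : ι → Ω → ℝ) (z : κ → Ω → ℝ) (hy : ∀ a, MemLp (y a) 2 P)
      (hz : ∀ b, MemLp (z b) 2 P) (hyS : ∀ a, (hy a).toLp (y a) ∈ S)
      (y' : ι → Lp ℝ 2 P) (z' : κ → Lp ℝ 2 P) (_ : ∀ a, (hy a).toLp (y a) = y' a)
      (_ : ∀ b, (hz b).toLp (z b) = z' b), covMat P y z = crossGram y' z' := by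
    intro ι κ y z hy hz hyS y' z' hy' hz'
    ext a b
    simp only [covMat, crossGram, Matrix.of_apply]
    rw [covariance_eq_inner (hy a) (hz b) (mean _ (hyS a)), hy', hz']
  set x : EuclideanSpace ℝ (Fin N) → Lp ℝ 2 P := fun t => (h0 t).toLp (X t) with hx
  set x1 : Fin N → EuclideanSpace ℝ (Fin N) → Lp ℝ 2 P :=
    fun i t => (h1' i t).toLp (partial1 X i t) with hx1
  set x2 : Fin N → Fin N → EuclideanSpace ℝ (Fin N) → Lp ℝ 2 P :=
    fun i j t => (h2' i j t).toLp (partial2 X i j t) with hx2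
  have hm : ∀ t a, MemLp (mainVec X t a) 2 P := by
    rintro t (p | c)
    · exact h2' _ _ _
    · fin_cases c
      exacts [h0 t, h0 0]
  have hmS : ∀ t a, (hm t a).toLp (mainVec X t a) ∈ S := by
    rintro t (p | c)
    · exact h2S' _ _ _
    · fin_cases c
      exacts [h0S t, h0S 0]
  have hme : ∀ t a, (hm t a).toLp (mainVec X t a) = mainFam x x2 t a := by
    rintro t (p | c)
    · rfl
    · fin_cases c <;> rfl
  have hg : ∀ t a, MemLp (gradVec X t a) 2 P := by
    rintro t (p | p)
    exacts [h1' _ _, h1' _ _]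
  have hgS : ∀ t a, (hg t a).toLp (gradVec X t a) ∈ S := by
    rintro t (p | p)
    exacts [h1S' _ _, h1S' _ _]
  have hge : ∀ t a, (hg t a).toLp (gradVec X t a) = gradFam x1 t a := by
    rintro t (p | p) <;> rfl
  refine ⟨x, x1, x2, ⟨fun t s => ?_, h1d, h2d⟩, fun t => hgram _ _ (hm t) (hm t) (hmS t) _ _
    (hme t) (hme t), fun t => hgram _ _ (hm t) (hg t) (hmS t) _ _ (hme t) (hge t),
    fun t => hgram _ _ (hg t) (hm t) (hgS t) _ _ (hge t) (hme t),
    fun t => hgram _ _ (hg t) (hg t) (hgS t) _ _ (hge t) (hge t),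
    hgram _ _ (fun i => h1' i 0) (fun i => h1' i 0) (fun i => h1S' i 0) _ _ (fun _ => rfl)
      (fun _ => rfl), ?_⟩
  · rw [hx, ← covariance_eq_inner (h0 t) (h0 s) (mean _ (h0S t)), hX.cov_eq, norm_sub_rev]
  · rintro i j ⟨Y, hY, hlim, hpos⟩
    have hf : ∀ h : ℝ, MemLp (fun ω => h⁻¹ * (partial2 X i i (h • basisVec i) ω -
        partial2 X i i 0 ω)) 2 P := fun h => ((h2' _ _ _).sub (h2' _ _ _)).const_mul _
    have hYt : Tendsto (fun h : ℝ => (hf h).toLp _) (𝓝[≠] 0) (𝓝 (hY.toLp Y)) := by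
      rw [Lp.tendsto_Lp_iff_tendsto_eLpNorm'']
      exact hlim
    have heq : ∀ h : ℝ, (hf h).toLp _ = h⁻¹ • (x2 i i (h • basisVec i) - x2 i i 0) := fun h => rfl
    have hYS : hY.toLp Y ∈ S := hS.closed.mem_of_tendsto hYt (Eventually.of_forall fun h => by
      rw [heq]; exact S.smul_mem _ (S.sub_mem (h2S' _ _ _) (h2S' _ _ _)))
    refine ⟨hY.toLp Y, ?_, ?_⟩
    · rw [hasDerivAt_iff_tendsto_slope_zero]
      refine hYt.congr fun h => ?_
      rw [heq, zero_add, zero_smul]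
    · have hz : ∀ a, MemLp ((Sum.elim (fun _ : Unit => Y) (fun i => partial1 X i 0) :
          Unit ⊕ Fin N → Ω → ℝ) a) 2 P := by
        rintro (a | a)
        exacts [hY, h1' _ _]
      have hc := hgram _ _ hz hz (by
        rintro (a | a)
        exacts [hYS, h1S' _ _]) (Sum.elim (fun _ : Unit => hY.toLp Y) (fun i => x1 i 0))
        (Sum.elim (fun _ : Unit => hY.toLp Y) (fun i => x1 i 0)) (by rintro (a | a) <;> rfl)
        (by rintro (a | a) <;> rfl)
      rw [hc] at hpos
      -- The 2 × 2 principal minor of Y and one gradient coordinate is the strict Cauchy–Schwarz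
      -- inequality.
      have hdet := (hpos.submatrix (e := ![Sum.inl (), Sum.inr j]) (by
        intro a b hab
        fin_cases a <;> fin_cases b <;> simp_all)).det_pos
      rw [Matrix.det_fin_two] at hdet
      simp only [crossGram, Matrix.submatrix_apply, Matrix.of_apply, Matrix.cons_val_zero,
        Matrix.cons_val_one, Sum.elim_inl, Sum.elim_inr] at hdet
      rw [real_inner_comm (hY.toLp Y) (x1 j 0)] at hdet
      nlinarith [hdet]

theorem IsQualified.prob_pos (hX : IsQualified P X ρ) (u : ℝ) : 0 < P.real {ω | u < X 0 ω} := by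
  have hg := hX.gaussian.hasGaussianLaw_eval 0
  have hvar : Var[X 0; P] = 1 := by
    rw [← covariance_self hg.aemeasurable, hX.cov_eq]
    simp [hX.rho_zero]
  have hmap := hg.map_eq_gaussianReal
  rw [hvar, hX.centered] at hmap
  have h1 : P.map (X 0) (Set.Ioi u) = P {ω | u < X 0 ω} :=
    Measure.map_apply_of_aemeasurable hg.aemeasurable measurableSet_Ioi
  rw [measureReal_def, ENNReal.toReal_pos_iff]
  refine ⟨?_, measure_lt_top _ _⟩
  rw [← h1, hmap, pos_iff_ne_zero]
  intro h
  have := gaussianReal_absolutelyContinuous' 0 (v := Real.toNNReal 1) (by simp) h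
  simp at this

end FieldInHilbertSpace

end CritPair

namespace CritPair

/-- The Kronecker symbol. -/
def kron {ι : Type*} [DecidableEq ι] (i j : ι) : ℝ := if i = j then 1 else 0

/-! ### Covariance matrices with rotational symmetry around the first axis. -/

section PeakMatrix

variable {n : ℕ}

/-- The indicator of the radial direction. -/
def radial (i : Fin (n + 1)) : ℝ := if i = 0 then 1 else 0

/-- The Kronecker symbol of the tangential directions. -/
def tang (i j : Fin (n + 1)) : ℝ := if i = j ∧ i ≠ 0 then 1 else 0

/-- The covariance between two second derivatives of a field with rotational symmetry around
an axis. -/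
def hessCov (q₀ : ℝ) (α : Fin 10 → ℝ) (i j k l : Fin (n + 1)) : ℝ :=
  α 0 * (radial i * radial j * (radial k * radial l)) +
    α 1 * (radial i * radial j * tang k l + tang i j * (radial k * radial l)) +
    α 2 * (radial i * radial k * tang j l + radial i * radial l * tang j k +
      radial j * radial k * tang i l + radial j * radial l * tang i k) +
    4 * q₀ * (tang i k * tang j l + tang i l * tang j k) + α 3 * (tang i j * tang k l)

/-- The general form of the covariance matrix of `(∇²X(t), X(t), X(0))` when `X` has rotational
symmetry around the first axis. -/
def axialMatrix (n : ℕ) (q₀ : ℝ) (α : Fin 10 → ℝ) : Matrix (MainIdx (n + 1)) (MainIdx (n + 1)) ℝ :=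
  Matrix.of (Sum.elim
    (fun p => Sum.elim (fun p' => hessCov q₀ α p.1.1 p.1.2 p'.1.1 p'.1.2)
      ![α 4 * (radial p.1.1 * radial p.1.2) + α 6 * tang p.1.1 p.1.2,
        α 5 * (radial p.1.1 * radial p.1.2) + α 7 * tang p.1.1 p.1.2])
    ![Sum.elim (fun p => α 4 * (radial p.1.1 * radial p.1.2) + α 6 * tang p.1.1 p.1.2)
        ![α 8, α 9],
      Sum.elim (fun p => α 5 * (radial p.1.1 * radial p.1.2) + α 7 * tang p.1.1 p.1.2)
        ![α 9, α 8]])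

/-- The coefficients of the rescaled conditional covariance matrix at distance `r`. -/
noncomputable def radialCoeff (p₀ q₀ c p q s r : ℝ) : Fin 10 → ℝ :=
  -- The letters p, q, s stand for ρ', ρ'', ρ''' at r², and c for ρ(r²). A gradient coordinate has
  -- variance a; b is the covariance of the radial derivatives at t and 0; D and D' are the
  -- determinants of the radial and tangential 2 × 2 gradient blocks.
  let a := -(2 * p₀)
  let b := -(2 * p + 4 * r ^ 2 * q)
  let m := 12 * q + 8 * s * r ^ 2
  let D := a ^ 2 - b ^ 2
  let D' := a ^ 2 - (2 * p) ^ 2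
  ![12 * q₀ / r ^ 2 - m ^ 2 * a / D, 4 * q₀ / r - a * m * (4 * q * r) / D,
    4 * q₀ / r - a * r * (16 * q ^ 2) / D', 4 * q₀ - 16 * a * q ^ 2 * r ^ 2 / D,
    2 * p₀ / r - 2 * r * p * m * a / D, (2 * p + 4 * r ^ 2 * q) / r - 2 * r * p * m * b / D,
    2 * p₀ - 8 * a * r ^ 2 * p * q / D, 2 * p - 8 * b * r ^ 2 * p * q / D,
    1 - 4 * a * r ^ 2 * p ^ 2 / D, c - 4 * r ^ 2 * p ^ 2 * b / D]

/-- The scaling of the radial direction by `κ`. -/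
def radialScale (κ : ℝ) (i : Fin (n + 1)) : ℝ := if i = 0 then κ else 1

/-- The covariance of `∇²X(t)` and `-∇X(0)`. -/
def gradCoeff (q s r : ℝ) (i j c : Fin (n + 1)) : ℝ :=
  4 * q * r * (kron i j * radial c + kron i c * radial j + kron j c * radial i) +
    8 * s * r ^ 3 * (radial i * radial j * radial c)

/-- Pure algebra, case by case according to which indices are radial. Writing r = κ⁻² keeps
everything rational in κ, though the radial axis is scaled by r^(-1/2). The sum over c is the
regression term. -/
theorem hessCov_radialCoeff (p₀ q₀ v p q s r κ : ℝ) (hκ : κ ≠ 0) (hr : r = (κ ^ 2)⁻¹)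
    (D : Fin (n + 1) → ℝ) (D₁ D₂ : ℝ)
    (h₁ : (-(2 * p₀)) ^ 2 - (-(2 * p + 4 * r ^ 2 * q)) ^ 2 = D₁)
    (h₂ : (-(2 * p₀)) ^ 2 - (2 * p) ^ 2 = D₂) (hD₁ : D₁ ≠ 0) (hD₂ : D₂ ≠ 0) (hD0 : D 0 = D₁)
    (hD : ∀ c : Fin n, D c.succ = D₂) (i j k l : Fin (n + 1)) :
    (radialScale κ i * radialScale κ j) * (radialScale κ k * radialScale κ l) *
        (4 * q₀ * (kron i j * kron k l + kron i k * kron j l + kron i l * kron j k)) -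
      ∑ c, -(2 * p₀) / D c * ((radialScale κ i * radialScale κ j * gradCoeff q s r i j c) *
        (radialScale κ k * radialScale κ l * gradCoeff q s r k l c))
      = hessCov q₀ (radialCoeff p₀ q₀ v p q s r) i j k l := by
  simp only [hessCov, radialCoeff, h₁, h₂]
  rw [Fin.sum_univ_succ, hD0]
  simp_rw [hD]
  cases i using Fin.cases <;> cases j using Fin.cases <;> cases k using Fin.cases <;>
    cases l using Fin.cases <;>
    simp [gradCoeff, kron, radial, tang, radialScale, Fin.succ_ne_zero, (Fin.succ_ne_zero _).symm,
      Finset.sum_ite_eq]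
  all_goals
    clear h₁ h₂ hD hD0
    subst hr
    (try split_ifs) <;> first | (exfalso; simp_all; done) | (field_simp; ring)

theorem valueCov_radialCoeff (p₀ q₀ v p q s r κ : ℝ) (hκ : κ ≠ 0) (hr : r = (κ ^ 2)⁻¹)
    (D : Fin (n + 1) → ℝ) (D₁ : ℝ)
    (h₁ : (-(2 * p₀)) ^ 2 - (-(2 * p + 4 * r ^ 2 * q)) ^ 2 = D₁) (hD₁ : D₁ ≠ 0) (hD0 : D 0 = D₁)
    (i j : Fin (n + 1)) :
    radialScale κ i * radialScale κ j * (2 * p₀ * kron i j) -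
      ∑ c, -(2 * p₀) / D c * ((radialScale κ i * radialScale κ j * gradCoeff q s r i j c) *
        (2 * p * (r * radial c)))
      = radialCoeff p₀ q₀ v p q s r 4 * (radial i * radial j) +
        radialCoeff p₀ q₀ v p q s r 6 * tang i j := by
  have e4 : radialCoeff p₀ q₀ v p q s r 4 = 2 * p₀ / r -
      2 * r * p * (12 * q + 8 * s * r ^ 2) * -(2 * p₀) / D₁ := by rw [← h₁]; rfl
  have e6 : radialCoeff p₀ q₀ v p q s r 6 = 2 * p₀ - 8 * -(2 * p₀) * r ^ 2 * p * q / D₁ := by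
    rw [← h₁]; rfl
  rw [e4, e6, Fin.sum_univ_succ, hD0]
  cases i using Fin.cases <;> cases j using Fin.cases <;>
    simp [gradCoeff, kron, radial, tang, radialScale, Fin.succ_ne_zero, (Fin.succ_ne_zero _).symm]
  all_goals
    clear h₁ hD0
    subst hr
    (try split_ifs) <;> first | rfl | (field_simp; ring)

theorem valueCov_radialCoeff' (p₀ q₀ v p q s r κ : ℝ) (hκ : κ ≠ 0) (hr : r = (κ ^ 2)⁻¹)
    (D : Fin (n + 1) → ℝ) (D₁ : ℝ)
    (h₁ : (-(2 * p₀)) ^ 2 - (-(2 * p + 4 * r ^ 2 * q)) ^ 2 = D₁) (hD₁ : D₁ ≠ 0) (hD0 : D 0 = D₁)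
    (i j : Fin (n + 1)) :
    radialScale κ i * radialScale κ j *
        (2 * p * kron i j + 4 * q * r ^ 2 * (radial i * radial j)) -
      ∑ c, -(2 * p + 4 * r ^ 2 * q * radial c) / D c *
        ((radialScale κ i * radialScale κ j * gradCoeff q s r i j c) * (2 * p * (r * radial c)))
      = radialCoeff p₀ q₀ v p q s r 5 * (radial i * radial j) +
        radialCoeff p₀ q₀ v p q s r 7 * tang i j := by
  have e5 : radialCoeff p₀ q₀ v p q s r 5 = (2 * p + 4 * r ^ 2 * q) / r -
      2 * r * p * (12 * q + 8 * s * r ^ 2) * -(2 * p + 4 * r ^ 2 * q) / D₁ := by rw [← h₁]; rfl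
  have e7 : radialCoeff p₀ q₀ v p q s r 7 =
      2 * p - 8 * -(2 * p + 4 * r ^ 2 * q) * r ^ 2 * p * q / D₁ := by
    rw [← h₁]; rfl
  rw [e5, e7, Fin.sum_univ_succ, hD0]
  cases i using Fin.cases <;> cases j using Fin.cases <;>
    simp [gradCoeff, kron, radial, tang, radialScale, Fin.succ_ne_zero, (Fin.succ_ne_zero _).symm]
  all_goals
    clear h₁ hD0
    subst hr
    (try split_ifs) <;> first | rfl | (field_simp; ring)

end PeakMatrix

end CritPair

namespace CritPair

/-! ### Conditional covariances as Schur complements of Gram matrices. -/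

section Gram

open scoped RealInnerProductSpace

variable {ι ι' κ κ' H : Type*} [Fintype ι] [Fintype ι'] [Fintype κ] [Fintype κ']
  [DecidableEq κ] [DecidableEq κ'] [NormedAddCommGroup H] [InnerProductSpace ℝ H]

/-- The covariance of `y` conditional on `z`. -/
noncomputable def condGram {ι : Type*} (y : ι → H) (z : κ → H) : Matrix ι ι ℝ :=
  crossGram y y - crossGram y z * (crossGram z z)⁻¹ * crossGram z y

/-- The action of a matrix on a family of vectors. -/
noncomputable def linComb {ι ι' : Type*} [Fintype ι] (T : Matrix ι' ι ℝ) (y : ι → H) : ι' → H :=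
  fun a => ∑ b, T a b • y b

theorem mul_crossGram {κ ι' : Type*} (T : Matrix ι' ι ℝ) (y : ι → H) (z : κ → H) :
    T * crossGram y z = crossGram (linComb T y) z := by
  ext a b
  simp [Matrix.mul_apply, crossGram, linComb, sum_inner, inner_smul_left]

theorem crossGram_mul_transpose {κ ι' : Type*} (T : Matrix ι' ι ℝ) (y : ι → H) (z : κ → H) :
    crossGram z y * T.transpose = crossGram z (linComb T y) := by
  ext a b
  simp [Matrix.mul_apply, crossGram, linComb, inner_sum, inner_smul_right, mul_comm]

/-- Conditioning on z and on its invertible image U z are the same: U cancels in the regression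
term. -/
theorem transform_condGram {ι' : Type*} (T : Matrix ι' ι ℝ) (U : Matrix κ κ ℝ) (hU : IsUnit U)
    (y : ι → H) (z : κ → H) :
    T * condGram y z * T.transpose = condGram (linComb T y) (linComb U z) := by
  have hdet : IsUnit U.det := (Matrix.isUnit_iff_isUnit_det U).1 hU
  have hdet' : IsUnit U.transpose.det := by rwa [Matrix.det_transpose]
  have h1 : (crossGram (linComb U z) (linComb U z))⁻¹
      = U.transpose⁻¹ * (crossGram z z)⁻¹ * U⁻¹ := by
    rw [← mul_crossGram, ← crossGram_mul_transpose, Matrix.mul_inv_rev, Matrix.mul_inv_rev]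
  rw [condGram, condGram, h1, ← mul_crossGram, ← mul_crossGram, ← crossGram_mul_transpose,
    ← crossGram_mul_transpose, ← mul_crossGram]
  rw [Matrix.mul_sub, Matrix.sub_mul]
  congr 1
  · rw [Matrix.mul_assoc]
  · rw [← crossGram_mul_transpose]
    simp only [Matrix.mul_assoc]
    rw [Matrix.nonsing_inv_mul_cancel_left U _ hdet,
      Matrix.mul_nonsing_inv_cancel_left U.transpose _ hdet']

/-- Coordinate by coordinate this inverts a symmetric 2 × 2 matrix with diagonal a, off-diagonal b c
and determinant a² - (b c)². -/
theorem inv_fromBlocks_diagonal (a : ℝ) (b : κ → ℝ) (h : ∀ c, a ^ 2 - b c ^ 2 ≠ 0) :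
    (Matrix.fromBlocks (Matrix.diagonal fun _ : κ => a) (Matrix.diagonal b) (Matrix.diagonal b)
      (Matrix.diagonal fun _ : κ => a))⁻¹ =
    Matrix.fromBlocks (Matrix.diagonal fun c => a / (a ^ 2 - b c ^ 2))
      (Matrix.diagonal fun c => -b c / (a ^ 2 - b c ^ 2))
      (Matrix.diagonal fun c => -b c / (a ^ 2 - b c ^ 2))
      (Matrix.diagonal fun c => a / (a ^ 2 - b c ^ 2)) := by
  refine Matrix.inv_eq_right_inv ?_
  rw [Matrix.fromBlocks_multiply]
  simp only [Matrix.diagonal_mul_diagonal, Matrix.diagonal_add]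
  rw [← Matrix.fromBlocks_one]
  have e1 : ∀ c, a * (a / (a ^ 2 - b c ^ 2)) + b c * (-b c / (a ^ 2 - b c ^ 2)) = 1 := by
    intro c
    have := h c
    field_simp
    ring
  have e2 : ∀ c, a * (-b c / (a ^ 2 - b c ^ 2)) + b c * (a / (a ^ 2 - b c ^ 2)) = 0 := by
    intro c
    ring
  have e3 : ∀ c, b c * (a / (a ^ 2 - b c ^ 2)) + a * (-b c / (a ^ 2 - b c ^ 2)) = 0 := by
    intro c
    ring
  have e4 : ∀ c, b c * (-b c / (a ^ 2 - b c ^ 2)) + a * (a / (a ^ 2 - b c ^ 2)) = 1 := by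
    intro c
    rw [add_comm, e1]
  simp_rw [e1, e2, e3, e4]
  simp

omit [Fintype ι] in
theorem condGram_apply_of_diagonal (y : ι → H) (z : κ ⊕ κ → H) (a : ℝ) (b : κ → ℝ)
    (h : ∀ c, a ^ 2 - b c ^ 2 ≠ 0)
    (hz : crossGram z z = Matrix.fromBlocks (Matrix.diagonal fun _ : κ => a) (Matrix.diagonal b)
      (Matrix.diagonal b) (Matrix.diagonal fun _ : κ => a)) (i j : ι) :
    condGram y z i j = ⟪y i, y j⟫ - ∑ c, (a / (a ^ 2 - b c ^ 2) *
        (⟪y i, z (Sum.inl c)⟫ * ⟪y j, z (Sum.inl c)⟫ + ⟪y i, z (Sum.inr c)⟫ * ⟪y j, z (Sum.inr c)⟫)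
      - b c / (a ^ 2 - b c ^ 2) * (⟪y i, z (Sum.inl c)⟫ * ⟪y j, z (Sum.inr c)⟫ +
        ⟪y i, z (Sum.inr c)⟫ * ⟪y j, z (Sum.inl c)⟫)) := by
  rw [condGram, hz, inv_fromBlocks_diagonal a b h, Matrix.sub_apply, Matrix.mul_apply]
  congr 1
  rw [Fintype.sum_sum_type, ← Finset.sum_add_distrib]
  refine Finset.sum_congr rfl fun c _ => ?_
  rw [Matrix.mul_apply, Matrix.mul_apply, Fintype.sum_sum_type, Fintype.sum_sum_type]
  simp only [Matrix.fromBlocks_apply₁₁, Matrix.fromBlocks_apply₁₂, Matrix.fromBlocks_apply₂₁,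
    Matrix.fromBlocks_apply₂₂, Matrix.diagonal_apply, mul_ite, mul_zero, Finset.sum_ite_eq',
    Finset.mem_univ, if_true]
  simp only [crossGram, Matrix.of_apply, real_inner_comm (y j)]
  ring

/-- The full form at (v, -D⁻¹ Bᴴ v), its minimum over the second component, is the Schur complement
form at v. -/
theorem posDef_schur [DecidableEq ι] {A : Matrix ι ι ℝ} {B : Matrix ι κ ℝ} {C : Matrix κ ι ℝ}
    {D : Matrix κ κ ℝ}
    (h : (Matrix.fromBlocks A B C D).PosDef) : D.PosDef ∧ (A - B * D⁻¹ * C).PosDef := by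
  have hD : D.PosDef := by
    have := h.submatrix (e := Sum.inr) Sum.inr_injective
    rwa [show (Matrix.fromBlocks A B C D).submatrix Sum.inr Sum.inr = D from rfl] at this
  have hC : C = B.conjTranspose := by
    have := h.isHermitian
    rw [Matrix.isHermitian_fromBlocks_iff] at this
    rw [this.2.1]
  refine ⟨hD, ?_⟩
  subst hC
  have := hD.isUnit.invertible
  have hherm : (A - B * D⁻¹ * B.conjTranspose).IsHermitian :=
    (Matrix.IsHermitian.fromBlocks₂₂ A B hD.isHermitian).1 h.isHermitian
  refine Matrix.PosDef.of_dotProduct_mulVec_pos hherm fun v hv => ?_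
  have h1 := h.dotProduct_mulVec_pos (x := Sum.elim v (-((D⁻¹ * B.conjTranspose).mulVec v))) (by
    intro h0
    refine hv (funext fun i => ?_)
    exact congrFun h0 (Sum.inl i))
  rw [Matrix.dotProduct_mulVec, Matrix.schur_complement_eq₂₂ A B v _ hD.isHermitian] at h1
  rw [Matrix.dotProduct_mulVec]
  simpa using h1

end Gram

/-! ### Congruence of the Hessian as a linear map of the vectorized entries. -/

section Congruence

variable {N : ℕ}

/-- The matrix of the map that sends `(W, x, z)` to `(B W Bᵀ, x, z)`. -/
noncomputable def congMat (B : Matrix (Fin N) (Fin N) ℝ) : Matrix (MainIdx N) (MainIdx N) ℝ :=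
  -- Every ordered pair (i, j) is sent to its ordered representative in `HessIdx`, so an
  -- off-diagonal entry collects two terms.
  Matrix.fromBlocks (Matrix.of fun p q => ∑ i, ∑ j,
    if (⟨(min i j, max i j), min_le_max⟩ : HessIdx N) = q then B p.1.1 i * B p.1.2 j else 0) 0 0 1

theorem sum_congMat {H : Type*} [AddCommGroup H] [Module ℝ H] (B : Matrix (Fin N) (Fin N) ℝ)
    (y : MainIdx N → H) (p : HessIdx N) :
    ∑ q, congMat B (Sum.inl p) q • y q = ∑ i, ∑ j,
      (B p.1.1 i * B p.1.2 j) • y (Sum.inl ⟨(min i j, max i j), min_le_max⟩) := by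
  rw [Fintype.sum_sum_type]
  simp only [congMat, Matrix.fromBlocks_apply₁₁, Matrix.fromBlocks_apply₁₂, Matrix.zero_apply,
    zero_smul, Finset.sum_const_zero, add_zero, Matrix.of_apply, Finset.sum_smul]
  rw [Finset.sum_comm]
  refine Finset.sum_congr rfl fun i _ => ?_
  rw [Finset.sum_comm]
  refine Finset.sum_congr rfl fun j _ => ?_
  simp

theorem sum_congMat_inr {H : Type*} [AddCommGroup H] [Module ℝ H] (B : Matrix (Fin N) (Fin N) ℝ)
    (y : MainIdx N → H) (c : Fin 2) :
    ∑ q, congMat B (Sum.inr c) q • y q = y (Sum.inr c) := by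
  rw [Fintype.sum_sum_type]
  simp [congMat, Matrix.one_apply]

theorem matri_congMat_mulVec (B : Matrix (Fin N) (Fin N) ℝ) (w : MainIdx N → ℝ) :
    matri (hessPart ((congMat B).mulVec w)) = B * matri (hessPart w) * B.transpose := by
  have key : ∀ p : HessIdx N, (congMat B).mulVec w (Sum.inl p)
      = (B * matri (hessPart w) * B.transpose) p.1.1 p.1.2 := by
    intro p
    have := sum_congMat B w p
    simp only [smul_eq_mul] at this
    rw [Matrix.mulVec, dotProduct, this, Matrix.mul_apply, Finset.sum_comm]
    refine Finset.sum_congr rfl fun j _ => ?_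
    rw [Matrix.mul_apply, Finset.sum_mul]
    refine Finset.sum_congr rfl fun i _ => ?_
    simp [matri, hessPart]
    ring
  have hsymm : ∀ a b, (B * matri (hessPart w) * B.transpose) a b
      = (B * matri (hessPart w) * B.transpose) b a := by
    intro a b
    have h := matri_isHermitian (hessPart w)
    have h2 : (B * matri (hessPart w) * B.transpose).transpose
        = B * matri (hessPart w) * B.transpose := by
      rw [Matrix.transpose_mul, Matrix.transpose_mul, Matrix.transpose_transpose]
      rw [← Matrix.conjTranspose_eq_transpose_of_trivial (matri (hessPart w)), h.eq,
        Matrix.mul_assoc]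
    rw [← congrFun (congrFun h2 b) a, Matrix.transpose_apply]
  ext a b
  rw [matri, Matrix.of_apply, hessPart, key]
  rcases le_total a b with h | h
  · simp [h]
  · simp only [min_eq_right h, max_eq_left h]
    exact hsymm _ _

theorem congMat_mulVec_inr (B : Matrix (Fin N) (Fin N) ℝ) (w : MainIdx N → ℝ) (c : Fin 2) :
    (congMat B).mulVec w (Sum.inr c) = w (Sum.inr c) := by
  have := sum_congMat_inr B w c
  simpa [Matrix.mulVec, dotProduct] using this

theorem isUnit_congMat {B : Matrix (Fin N) (Fin N) ℝ} (hB : B.det ≠ 0) : IsUnit (congMat B) := by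
  have hu : IsUnit B := (Matrix.isUnit_iff_isUnit_det B).2 (isUnit_iff_ne_zero.2 hB)
  have hut : IsUnit B.transpose := by rwa [Matrix.isUnit_transpose]
  rw [← Matrix.mulVec_injective_iff_isUnit]
  have hz : ∀ w, (congMat B).mulVec w = 0 → w = 0 := by
    intro w hw
    have h1 := matri_congMat_mulVec B w
    rw [hw] at h1
    have h2 : matri (hessPart (0 : MainIdx N → ℝ)) = 0 := by
      ext a b; simp [matri, hessPart]
    rw [h2] at h1
    have h3 : matri (hessPart w) = 0 := by
      have h4 : B * matri (hessPart w) = 0 := hut.mul_right_cancel (by rw [← h1, zero_mul])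
      exact hu.mul_left_cancel (by rw [h4, mul_zero])
    funext a
    rcases a with p | c
    · have := congrFun (congrFun h3 p.1.1) p.1.2
      simpa [matri, hessPart, min_eq_left p.2, max_eq_right p.2] using this
    · rw [← congMat_mulVec_inr B w c, hw]
  intro w w' h
  have := hz (w - w') (by rw [Matrix.mulVec_sub]; exact sub_eq_zero.2 h)
  exact sub_eq_zero.1 this

theorem posDef_congMat {B : Matrix (Fin N) (Fin N) ℝ} (hB : B.det ≠ 0)
    {C : Matrix (MainIdx N) (MainIdx N) ℝ} (hC : C.PosDef) :
    (congMat B * C * (congMat B).transpose).PosDef := by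
  have h := hC.mul_mul_conjTranspose_same (B := congMat B)
    (Matrix.vecMul_injective_of_isUnit (isUnit_congMat hB))
  rwa [Matrix.conjTranspose_eq_transpose_of_trivial] at h

end Congruence

end CritPair

namespace CritPair

/-! ### Rotation to the radial direction and rescaling. -/

section Axial

open scoped RealInnerProductSpace

variable {n : ℕ} {H : Type*} [NormedAddCommGroup H] [InnerProductSpace ℝ H]
  {ρ ρ₁ ρ₂ ρ₃ : ℝ → ℝ} {x : EuclideanSpace ℝ (Fin (n + 1)) → H}
  {x1 : Fin (n + 1) → EuclideanSpace ℝ (Fin (n + 1)) → H}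
  {x2 : Fin (n + 1) → Fin (n + 1) → EuclideanSpace ℝ (Fin (n + 1)) → H}

/-- The covariance of second derivatives at one point is symmetric in all four indices, so the
difference of the two mixed derivatives has norm zero. -/
theorem IsHilbertField.deriv2_comm {N : ℕ} {x : EuclideanSpace ℝ (Fin N) → H}
    {x1 : Fin N → EuclideanSpace ℝ (Fin N) → H}
    {x2 : Fin N → Fin N → EuclideanSpace ℝ (Fin N) → H} (hx : IsHilbertField ρ x x1 x2)
    (hρ : HasDerivs ρ ρ₁ ρ₂ ρ₃) (i j : Fin N) (t : EuclideanSpace ℝ (Fin N)) :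
    x2 i j t = x2 j i t := by
  rw [← sub_eq_zero, ← inner_self_eq_zero (𝕜 := ℝ), inner_sub_left, inner_sub_right, inner_sub_right]
  simp only [← dir2_basisVec (x2 := x2), hx.inner_dir2_dir2 hρ]
  rw [real_inner_comm (basisVec j) (basisVec i)]
  ring

/-- The matrix whose rows are the vectors of an orthonormal basis. -/
noncomputable def rowMat {N : ℕ} (f : OrthonormalBasis (Fin N) ℝ (EuclideanSpace ℝ (Fin N))) :
    Matrix (Fin N) (Fin N) ℝ := Matrix.of fun a i => f a i

theorem rowMat_mul_transpose {N : ℕ}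
    (f : OrthonormalBasis (Fin N) ℝ (EuclideanSpace ℝ (Fin N))) :
    rowMat f * (rowMat f).transpose = 1 := by
  ext a b
  have h := f.inner_eq_ite b a
  rw [PiLp.inner_apply] at h
  simp only [RCLike.inner_apply, conj_trivial] at h
  simp only [Matrix.mul_apply, rowMat, Matrix.transpose_apply, Matrix.of_apply, Matrix.one_apply]
  rw [h]
  simp [eq_comm]

theorem isUnit_rowMat {N : ℕ} (f : OrthonormalBasis (Fin N) ℝ (EuclideanSpace ℝ (Fin N))) :
    IsUnit (rowMat f) := by
  rw [Matrix.isUnit_iff_isUnit_det]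
  exact Matrix.isUnit_det_of_right_inverse (rowMat_mul_transpose f)

/-- The rows of an orthonormal basis, with the first one scaled by `κ`. -/
noncomputable def scaledMat (κ : ℝ)
    (f : OrthonormalBasis (Fin (n + 1)) ℝ (EuclideanSpace ℝ (Fin (n + 1)))) :
    Matrix (Fin (n + 1)) (Fin (n + 1)) ℝ := Matrix.diagonal (radialScale κ) * rowMat f

theorem det_scaledMat_ne_zero {κ : ℝ} (hκ : κ ≠ 0)
    (f : OrthonormalBasis (Fin (n + 1)) ℝ (EuclideanSpace ℝ (Fin (n + 1)))) :
    (scaledMat κ f).det ≠ 0 := by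
  rw [scaledMat, Matrix.det_mul, Matrix.det_diagonal]
  refine mul_ne_zero (Finset.prod_ne_zero_iff.2 fun i _ => ?_)
    ((Matrix.isUnit_iff_isUnit_det _).1 (isUnit_rowMat f)).ne_zero
  unfold radialScale
  split_ifs
  exacts [hκ, one_ne_zero]

theorem linComb_gradFam (f : OrthonormalBasis (Fin (n + 1)) ℝ (EuclideanSpace ℝ (Fin (n + 1))))
    (t : EuclideanSpace ℝ (Fin (n + 1))) :
    linComb (Matrix.fromBlocks (rowMat f) 0 0 (rowMat f)) (gradFam x1 t)
      = Sum.elim (fun c => dir1 x1 (f c) t) (fun c => dir1 x1 (f c) 0) := by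
  funext a
  rcases a with a | a <;>
    simp [linComb, Fintype.sum_sum_type, gradFam, dir1, rowMat]

theorem isUnit_fromBlocks_rowMat
    (f : OrthonormalBasis (Fin (n + 1)) ℝ (EuclideanSpace ℝ (Fin (n + 1)))) :
    IsUnit (Matrix.fromBlocks (rowMat f) 0 0 (rowMat f)) := by
  rw [Matrix.isUnit_iff_isUnit_det]
  refine Matrix.isUnit_det_of_right_inverse
    (B := Matrix.fromBlocks (rowMat f).transpose 0 0 (rowMat f).transpose) ?_
  rw [Matrix.fromBlocks_multiply]
  simp [rowMat_mul_transpose]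

theorem linComb_mainFam (hx : IsHilbertField ρ x x1 x2) (hρ : HasDerivs ρ ρ₁ ρ₂ ρ₃) (κ : ℝ)
    (f : OrthonormalBasis (Fin (n + 1)) ℝ (EuclideanSpace ℝ (Fin (n + 1))))
    (t : EuclideanSpace ℝ (Fin (n + 1))) :
    linComb (congMat (scaledMat κ f)) (mainFam x x2 t) =
      Sum.elim (fun p => (radialScale κ p.1.1 * radialScale κ p.1.2) •
        dir2 x2 (f p.1.1) (f p.1.2) t) ![x t, x 0] := by
  funext a
  rcases a with p | c
  · rw [linComb, sum_congMat, Sum.elim_inl, dir2, Finset.smul_sum, Finset.sum_comm]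
    refine Finset.sum_congr rfl fun j _ => ?_
    rw [Finset.smul_sum, Finset.smul_sum]
    refine Finset.sum_congr rfl fun i _ => ?_
    have : mainFam x x2 t (Sum.inl ⟨(min i j, max i j), min_le_max⟩) = x2 i j t := by
      rcases le_total i j with h | h
      · simp [mainFam, h]
      · simp only [mainFam, Sum.elim_inl, min_eq_right h, max_eq_left h]
        exact hx.deriv2_comm hρ _ _ _
    rw [this, smul_smul, smul_smul]
    congr 1
    simp only [scaledMat, Matrix.diagonal_mul, rowMat, Matrix.of_apply]
    ring
  · rw [linComb, sum_congMat_inr]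
    rfl

/-- The rescaled and rotated conditional covariance matrix depends only on the distance. -/
theorem congMat_condGram (hx : IsHilbertField ρ x x1 x2) (hρ : HasDerivs ρ ρ₁ ρ₂ ρ₃)
    (h0 : ρ 0 = 1) (f : OrthonormalBasis (Fin (n + 1)) ℝ (EuclideanSpace ℝ (Fin (n + 1))))
    {r κ : ℝ} (hκ : κ ≠ 0) (hr : r = (κ ^ 2)⁻¹) {t : EuclideanSpace ℝ (Fin (n + 1))}
    (ht : t = r • f 0)
    (h₁ : (-(2 * ρ₁ 0)) ^ 2 - (-(2 * ρ₁ (r ^ 2) + 4 * r ^ 2 * ρ₂ (r ^ 2))) ^ 2 ≠ 0)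
    (h₂ : (-(2 * ρ₁ 0)) ^ 2 - (2 * ρ₁ (r ^ 2)) ^ 2 ≠ 0) :
    congMat (scaledMat κ f) * condGram (mainFam x x2 t) (gradFam x1 t) *
        (congMat (scaledMat κ f)).transpose =
      axialMatrix n (ρ₂ 0) (radialCoeff (ρ₁ 0) (ρ₂ 0) (ρ (r ^ 2)) (ρ₁ (r ^ 2)) (ρ₂ (r ^ 2))
        (ρ₃ (r ^ 2)) r) := by
  have hff : ∀ a b, ⟪f a, f b⟫ = kron a b := fun a b => by rw [f.inner_eq_ite]; rfl
  have hft : ∀ a, ⟪f a, t⟫ = r * radial a := fun a => by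
    rw [ht, inner_smul_right, hff]; rfl
  have hft' : ∀ a, ⟪f a, -t⟫ = -(r * radial a) := fun a => by rw [inner_neg_right, hft]
  have hnt : ‖t‖ ^ 2 = r ^ 2 := by
    rw [ht, norm_smul, f.norm_eq_one, mul_one, Real.norm_eq_abs, sq_abs]
  have hnt' : ‖-t‖ ^ 2 = r ^ 2 := by rw [norm_neg, hnt]
  -- The gradients are only rotated, the Hessian is rotated and rescaled. In the adapted basis the
  -- gradient Gram matrix consists of diagonal blocks and can be inverted explicitly.
  rw [transform_condGram _ _ (isUnit_fromBlocks_rowMat f), linComb_gradFam,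
    linComb_mainFam hx hρ]
  set p := ρ₁ (r ^ 2)
  set q := ρ₂ (r ^ 2)
  set s := ρ₃ (r ^ 2)
  have hgram : crossGram
      (Sum.elim (fun c => dir1 x1 (f c) t) (fun c => dir1 x1 (f c) 0))
      (Sum.elim (fun c => dir1 x1 (f c) t) (fun c => dir1 x1 (f c) 0)) =
      Matrix.fromBlocks (Matrix.diagonal fun _ : Fin (n + 1) => -(2 * ρ₁ 0))
        (Matrix.diagonal fun c => -(2 * p + 4 * r ^ 2 * q * radial c))
        (Matrix.diagonal fun c => -(2 * p + 4 * r ^ 2 * q * radial c))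
        (Matrix.diagonal fun _ : Fin (n + 1) => -(2 * ρ₁ 0)) := by
    ext a b
    rcases a with a | a <;> rcases b with b | b <;>
      simp only [crossGram, Matrix.of_apply, Sum.elim_inl, Sum.elim_inr, hx.inner_dir1_dir1 hρ,
        Matrix.fromBlocks_apply₁₁, Matrix.fromBlocks_apply₁₂, Matrix.fromBlocks_apply₂₁,
        Matrix.fromBlocks_apply₂₂, Matrix.diagonal_apply, sub_self, sub_zero, zero_sub,
        norm_zero, inner_zero_right, hff, hft, hft', hnt, hnt'] <;>
      by_cases hab : a = b <;> simp [kron, radial, hab, p, q]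
    · split_ifs <;> ring
    · exact fun hb ha => absurd (ha.trans hb.symm) hab
    · split_ifs <;> ring
    · exact fun hb ha => absurd (ha.trans hb.symm) hab
  set D : Fin (n + 1) → ℝ := fun c =>
    (-(2 * ρ₁ 0)) ^ 2 - (-(2 * p + 4 * r ^ 2 * q * radial c)) ^ 2 with hD
  have hD0 : D 0 = (-(2 * ρ₁ 0)) ^ 2 - (-(2 * p + 4 * r ^ 2 * q)) ^ 2 := by simp [hD, radial]
  have hDs : ∀ c : Fin n, D c.succ = (-(2 * ρ₁ 0)) ^ 2 - (2 * p) ^ 2 := by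
    intro c; simp [hD, radial]
  have hDne : ∀ c, D c ≠ 0 := by
    intro c
    cases c using Fin.cases with
    | zero => rw [hD0]; exact h₁
    | succ c => rw [hDs]; exact h₂
  -- A Hessian is uncorrelated with the gradient at the same point, so most terms of the regression
  -- drop out.
  have A1 : ∀ i j c, ⟪dir2 x2 (f i) (f j) t, dir1 x1 (f c) t⟫ = 0 := by
    intro i j c
    rw [hx.inner_dir2_dir1 hρ]
    simp
  have A2 : ∀ i j c, ⟪dir2 x2 (f i) (f j) t, dir1 x1 (f c) 0⟫ = -gradCoeff q s r i j c := by
    intro i j c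
    rw [hx.inner_dir2_dir1 hρ, sub_zero, hff, hff, hff, hft, hft, hft, hnt, gradCoeff]
    ring
  have A3 : ∀ c, ⟪x t, dir1 x1 (f c) t⟫ = 0 := by
    intro c
    rw [real_inner_comm, hx.inner_dir1 hρ]
    simp
  have A3' : ∀ c, ⟪x t, dir1 x1 (f c) 0⟫ = -(2 * p * (r * radial c)) := by
    intro c
    rw [real_inner_comm, hx.inner_dir1 hρ, zero_sub, hnt', hft']
    ring
  have A4 : ∀ c, ⟪x 0, dir1 x1 (f c) t⟫ = 2 * p * (r * radial c) := by
    intro c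
    rw [real_inner_comm, hx.inner_dir1 hρ, sub_zero, hnt, hft]
  have A4' : ∀ c, ⟪x 0, dir1 x1 (f c) 0⟫ = 0 := by
    intro c
    rw [real_inner_comm, hx.inner_dir1 hρ]
    simp
  have A5 : ∀ i j k l, ⟪dir2 x2 (f i) (f j) t, dir2 x2 (f k) (f l) t⟫
      = 4 * ρ₂ 0 * (kron i j * kron k l + kron i k * kron j l + kron i l * kron j k) := by
    intro i j k l
    simp only [hx.inner_dir2_dir2 hρ, hff]
  have A6 : ∀ i j, ⟪dir2 x2 (f i) (f j) t, x t⟫ = 2 * ρ₁ 0 * kron i j := by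
    intro i j
    rw [hx.inner_dir2 hρ, hff]
    simp
  have A6' : ∀ i j, ⟪dir2 x2 (f i) (f j) t, x 0⟫
      = 2 * p * kron i j + 4 * q * r ^ 2 * (radial i * radial j) := by
    intro i j
    rw [hx.inner_dir2 hρ, hff, sub_zero, hft, hft, hnt]
    ring
  have A7 : ∀ t, ⟪x t, x t⟫ = 1 := by
    intro t
    rw [hx.cov]
    simp [h0]
  have A7' : ⟪x t, x 0⟫ = ρ (r ^ 2) := by
    rw [hx.cov, sub_zero, hnt]
  have entry := condGram_apply_of_diagonal
    (Sum.elim (fun p : HessIdx (n + 1) => (radialScale κ p.1.1 * radialScale κ p.1.2) •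
        dir2 x2 (f p.1.1) (f p.1.2) t) ![x t, x 0]) _ _ _ hDne hgram
  have hess : ∀ i j : Fin (n + 1), radialScale κ i * radialScale κ j * (2 * ρ₁ 0 * kron i j) -
      ∑ c, -(2 * ρ₁ 0) / D c * ((radialScale κ i * radialScale κ j * gradCoeff q s r i j c) *
        (2 * p * (r * radial c))) = _ := fun i j =>
    valueCov_radialCoeff (ρ₁ 0) (ρ₂ 0) (ρ (r ^ 2)) p q s r κ hκ hr D _ rfl h₁ hD0 i j
  have hess' : ∀ i j : Fin (n + 1), radialScale κ i * radialScale κ j *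
        (2 * p * kron i j + 4 * q * r ^ 2 * (radial i * radial j)) -
      ∑ c, -(2 * p + 4 * r ^ 2 * q * radial c) / D c *
        ((radialScale κ i * radialScale κ j * gradCoeff q s r i j c) *
        (2 * p * (r * radial c))) = _ := fun i j =>
    valueCov_radialCoeff' (ρ₁ 0) (ρ₂ 0) (ρ (r ^ 2)) p q s r κ hκ hr D _ rfl h₁ hD0 i j
  have sx : ∑ c : Fin (n + 1), -(2 * ρ₁ 0) / D c * (2 * p * (r * radial c)) ^ 2 =
      4 * -(2 * ρ₁ 0) * r ^ 2 * p ^ 2 / D 0 := by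
    rw [Fin.sum_univ_succ]
    simp [radial]
    ring
  have sz : ∑ c : Fin (n + 1), -(2 * p + 4 * r ^ 2 * q * radial c) / D c *
      (2 * p * (r * radial c)) ^ 2 =
      4 * r ^ 2 * p ^ 2 * -(2 * p + 4 * r ^ 2 * q) / D 0 := by
    rw [Fin.sum_univ_succ]
    simp [radial]
    ring
  rw [hD0] at sx sz
  ext α β
  rw [entry]
  rcases α with ⟨⟨i, j⟩, hij⟩ | α <;> rcases β with ⟨⟨k, l⟩, hkl⟩ | β
  · simp only [Sum.elim_inl, Sum.elim_inr, inner_smul_left, inner_smul_right, conj_trivial, A1, A2, A5,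
      axialMatrix, Matrix.of_apply]
    rw [← hessCov_radialCoeff (ρ₁ 0) (ρ₂ 0) (ρ (r ^ 2)) p q s r κ hκ hr D _ _ rfl rfl h₁ h₂ hD0 hDs]
    congr 1
    · ring
    · exact Finset.sum_congr rfl fun c _ => by simp only [hD]; ring
  · fin_cases β
    · simp only [Sum.elim_inl, Sum.elim_inr, inner_smul_left, conj_trivial, A1,
        A2, A3, A3', A6, axialMatrix, Matrix.of_apply, Fin.zero_eta, Matrix.cons_val_zero]
      rw [← hess]
      congr 1
      exact Finset.sum_congr rfl fun c _ => by simp only [hD]; ring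
    · simp only [Sum.elim_inl, Sum.elim_inr, inner_smul_left, conj_trivial, A1,
        A2, A4, A4', A6', axialMatrix, Matrix.of_apply, Fin.mk_one, Matrix.cons_val_one,
        Matrix.cons_val_fin_one]
      rw [← hess']
      congr 1
      exact Finset.sum_congr rfl fun c _ => by simp only [hD]; ring
  · fin_cases α
    · simp only [Sum.elim_inl, Sum.elim_inr, inner_smul_left, inner_smul_right, conj_trivial, A1,
        A2, A3, A3', axialMatrix, Matrix.of_apply, Fin.zero_eta, Matrix.cons_val_zero]
      rw [← hess, real_inner_comm, A6]
      congr 1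
      exact Finset.sum_congr rfl fun c _ => by simp only [hD]; ring
    · simp only [Sum.elim_inl, Sum.elim_inr, inner_smul_left, inner_smul_right, conj_trivial, A1,
        A2, A4, A4', axialMatrix, Matrix.of_apply, Fin.mk_one, Matrix.cons_val_one,
        Matrix.cons_val_fin_one]
      rw [← hess', real_inner_comm, A6']
      congr 1
      exact Finset.sum_congr rfl fun c _ => by simp only [hD]; ring
  · have e8 : radialCoeff (ρ₁ 0) (ρ₂ 0) (ρ (r ^ 2)) p q s r 8 =
        1 - ∑ c : Fin (n + 1), -(2 * ρ₁ 0) / D c * (2 * p * (r * radial c)) ^ 2 := by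
      rw [sx]; rfl
    have e9 : radialCoeff (ρ₁ 0) (ρ₂ 0) (ρ (r ^ 2)) p q s r 9 =
        ρ (r ^ 2) - ∑ c : Fin (n + 1), -(2 * p + 4 * r ^ 2 * q * radial c) / D c *
      (2 * p * (r * radial c)) ^ 2 := by
      rw [sz]; rfl
    fin_cases α <;> fin_cases β <;>
      simp only [Sum.elim_inl, Sum.elim_inr, A3, A3', A4, A4', A7, A7', axialMatrix, Matrix.of_apply,
        Fin.zero_eta, Matrix.cons_val_zero, Fin.mk_one, Matrix.cons_val_one,
        Matrix.cons_val_fin_one, e8, e9]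
    · congr 1
      exact Finset.sum_congr rfl fun c _ => by simp only [hD]; ring
    · congr 1
      exact Finset.sum_congr rfl fun c _ => by simp only [hD]; ring
    · rw [real_inner_comm, A7']
      congr 1
      exact Finset.sum_congr rfl fun c _ => by simp only [hD]; ring
    · congr 1
      exact Finset.sum_congr rfl fun c _ => by simp only [hD]; ring

end Axial

end CritPair

namespace CritPair

/-! ### Continuous extension of the coefficients to r = 0. -/

section RadialCoefficients

/-- The formula for `radialCoeff` in terms of the Taylor remainders `T` of `ρ'` and `Q` of `ρ''`,
which makes sense for `r = 0`. -/
noncomputable def taylorCoeff (p₀ q₀ v T Q s r : ℝ) : Fin 10 → ℝ :=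
  let p := p₀ + q₀ * r ^ 2 + T * (r ^ 2) ^ 2
  let q := q₀ + Q * r ^ 2
  let V := T + 2 * Q
  -- Here `m` and `p'` are difference quotients in r²: 12 q + 8 s r² = 12 q₀ + r² m and p = p₀ + r²
  -- p'. Likewise `E` and `E'` are the two gradient determinants divided by r², and E = -24 p₀ q₀ -
  -- 4 r² K, which cancels the poles at r = 0.
  let m := 12 * Q + 8 * s
  let p' := q₀ + T * r ^ 2
  let K := 9 * q₀ ^ 2 + 2 * p₀ * V + 6 * q₀ * V * r ^ 2 + V ^ 2 * (r ^ 2) ^ 2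
  let E := -4 * (3 * q₀ + r ^ 2 * V) * (2 * p₀ + 3 * q₀ * r ^ 2 + (r ^ 2) ^ 2 * V)
  let E' := -4 * (q₀ + T * r ^ 2) * (2 * p₀ + q₀ * r ^ 2 + T * (r ^ 2) ^ 2)
  ![(-48 * q₀ * K + 2 * p₀ * (24 * q₀ * m + m ^ 2 * r ^ 2)) / E,
    r * (-16 * q₀ * K + 8 * p₀ * (12 * q₀ * Q + q₀ * m + m * Q * r ^ 2)) / E,
    r * (-16 * q₀ * (q₀ ^ 2 + 2 * p₀ * T + 2 * q₀ * T * r ^ 2 + T ^ 2 * (r ^ 2) ^ 2) +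
      32 * p₀ * (2 * q₀ * Q + Q ^ 2 * r ^ 2)) / E',
    4 * q₀ + 32 * p₀ * q ^ 2 / E,
    r * (-8 * p₀ * K + 4 * p₀ * (12 * q₀ * p' + p₀ * m + p' * m * r ^ 2)) / E,
    r * ((2 * p + 4 * r ^ 2 * q) * (-4 * K + 2 * (12 * q₀ * p' + p₀ * m + p' * m * r ^ 2))) / E,
    2 * p₀ + 16 * p₀ * p * q / E, 2 * p + 8 * (2 * p + 4 * r ^ 2 * q) * p * q / E,
    1 + 8 * p₀ * p ^ 2 / E, v + 4 * p ^ 2 * (2 * p + 4 * r ^ 2 * q) / E]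

theorem det_radial (p₀ q₀ T Q r p q : ℝ) (hp : p = p₀ + q₀ * r ^ 2 + T * (r ^ 2) ^ 2)
    (hq : q = q₀ + Q * r ^ 2) :
    (-(2 * p₀)) ^ 2 - (-(2 * p + 4 * r ^ 2 * q)) ^ 2 = r ^ 2 *
      (-4 * (3 * q₀ + r ^ 2 * (T + 2 * Q)) *
        (2 * p₀ + 3 * q₀ * r ^ 2 + (r ^ 2) ^ 2 * (T + 2 * Q))) := by
  subst hp hq
  ring

theorem det_tangential (p₀ q₀ T r p : ℝ) (hp : p = p₀ + q₀ * r ^ 2 + T * (r ^ 2) ^ 2) :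
    (-(2 * p₀)) ^ 2 - (2 * p) ^ 2 = r ^ 2 *
      (-4 * (q₀ + T * r ^ 2) * (2 * p₀ + q₀ * r ^ 2 + T * (r ^ 2) ^ 2)) := by
  subst hp
  ring

theorem radialCoeff_eq_taylorCoeff (p₀ q₀ v T Q s r p q : ℝ)
    (hp : p = p₀ + q₀ * r ^ 2 + T * (r ^ 2) ^ 2) (hq : q = q₀ + Q * r ^ 2) (hr : r ≠ 0)
    (hE : -4 * (3 * q₀ + r ^ 2 * (T + 2 * Q)) *
        (2 * p₀ + 3 * q₀ * r ^ 2 + (r ^ 2) ^ 2 * (T + 2 * Q)) ≠ 0)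
    (hE' : -4 * (q₀ + T * r ^ 2) * (2 * p₀ + q₀ * r ^ 2 + T * (r ^ 2) ^ 2) ≠ 0) :
    radialCoeff p₀ q₀ v p q s r = taylorCoeff p₀ q₀ v T Q s r := by
  simp only [radialCoeff, taylorCoeff, ← hp, ← hq]
  rw [det_radial p₀ q₀ T Q r p q hp hq, det_tangential p₀ q₀ T r p hp]
  generalize hEd : -4 * (3 * q₀ + r ^ 2 * (T + 2 * Q)) *
        (2 * p₀ + 3 * q₀ * r ^ 2 + (r ^ 2) ^ 2 * (T + 2 * Q)) = E at *
  generalize hEd' : -4 * (q₀ + T * r ^ 2) * (2 * p₀ + q₀ * r ^ 2 + T * (r ^ 2) ^ 2) = E' at *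
  have h0 : ∀ a b c d e f g h i j a' b' c' d' e' f' g' h' i' j' : ℝ, a = a' → b = b' → c = c' →
      d = d' → e = e' → f = f' → g = g' → h = h' → i = i' → j = j' →
      ![a, b, c, d, e, f, g, h, i, j] = ![a', b', c', d', e', f', g', h', i', j'] := by
    intros; subst_vars; rfl
  refine h0 _ _ _ _ _ _ _ _ _ _ _ _ _ _ _ _ _ _ _ _ ?_ ?_ ?_ ?_ ?_ ?_ ?_ ?_ ?_ ?_
  · field_simp
    rw [← hEd, hq]
    ring
  · field_simp
    rw [← hEd, hq]
    ring
  · field_simp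
    rw [← hEd', hq]
    ring
  · field_simp
    ring
  · field_simp
    rw [← hEd, hq, hp]
    ring
  · field_simp
    rw [← hEd, hq, hp]
    ring
  · field_simp
    ring
  · field_simp
    ring
  · field_simp
    ring
  · field_simp
    ring

/-- In the limit the rescaled radial entry becomes independent of all others and the mixed entries
degenerate to 0. For v = 1 the last two coefficients agree, so the two values coincide. -/
theorem taylorCoeff_zero (p₀ q₀ v s : ℝ) (hp : p₀ ≠ 0) (hq : q₀ ≠ 0) :
    taylorCoeff p₀ q₀ v (s / 2) s s 0 = ![(18 * q₀ ^ 2 - 30 * p₀ * s) / p₀, 0, 0, 8 * q₀ / 3, 0, 0,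
      4 * p₀ / 3, 4 * p₀ / 3, 1 - p₀ ^ 2 / (3 * q₀), v - p₀ ^ 2 / (3 * q₀)] := by
  have h0 : ∀ a b c d e f g h i j a' b' c' d' e' f' g' h' i' j' : ℝ, a = a' → b = b' → c = c' →
      d = d' → e = e' → f = f' → g = g' → h = h' → i = i' → j = j' →
      ![a, b, c, d, e, f, g, h, i, j] = ![a', b', c', d', e', f', g', h', i', j'] := by
    intros; subst_vars; rfl
  simp only [taylorCoeff]
  refine h0 _ _ _ _ _ _ _ _ _ _ _ _ _ _ _ _ _ _ _ _ ?_ ?_ ?_ ?_ ?_ ?_ ?_ ?_ ?_ ?_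
  all_goals norm_num
  all_goals
    field_simp
    ring

theorem continuousOn_taylorCoeff {S : Set ℝ} (p₀ q₀ : ℝ) {v T Q s : ℝ → ℝ} (hv : ContinuousOn v S)
    (hT : ContinuousOn T S) (hQ : ContinuousOn Q S) (hs : ContinuousOn s S)
    (hE : ∀ r ∈ S, -4 * (3 * q₀ + r ^ 2 * (T r + 2 * Q r)) *
        (2 * p₀ + 3 * q₀ * r ^ 2 + (r ^ 2) ^ 2 * (T r + 2 * Q r)) ≠ 0)
    (hE' : ∀ r ∈ S,
      -4 * (q₀ + T r * r ^ 2) * (2 * p₀ + q₀ * r ^ 2 + T r * (r ^ 2) ^ 2) ≠ 0) :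
    ContinuousOn (fun r => taylorCoeff p₀ q₀ (v r) (T r) (Q r) (s r) r) S := by
  have cE : ContinuousOn (fun r => -4 * (3 * q₀ + r ^ 2 * (T r + 2 * Q r)) *
        (2 * p₀ + 3 * q₀ * r ^ 2 + (r ^ 2) ^ 2 * (T r + 2 * Q r))) S := by fun_prop
  have cE' : ContinuousOn (fun r =>
      -4 * (q₀ + T r * r ^ 2) * (2 * p₀ + q₀ * r ^ 2 + T r * (r ^ 2) ^ 2)) S := by fun_prop
  rw [continuousOn_pi]
  intro i
  fin_cases i
  · exact ContinuousOn.div (by fun_prop) cE hE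
  · exact ContinuousOn.div (by fun_prop) cE hE
  · exact ContinuousOn.div (by fun_prop) cE' hE'
  · exact ContinuousOn.add (by fun_prop) (ContinuousOn.div (by fun_prop) cE hE)
  · exact ContinuousOn.div (by fun_prop) cE hE
  · exact ContinuousOn.div (by fun_prop) cE hE
  · exact ContinuousOn.add (by fun_prop) (ContinuousOn.div (by fun_prop) cE hE)
  · exact ContinuousOn.add (by fun_prop) (ContinuousOn.div (by fun_prop) cE hE)
  · exact ContinuousOn.add (by fun_prop) (ContinuousOn.div (by fun_prop) cE hE)
  · exact ContinuousOn.add (by fun_prop) (ContinuousOn.div (by fun_prop) cE hE)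

/-- The relations between the derivatives of `ρ` that hold for a qualified field. -/
structure IsAdmissible (ρ ρ₁ ρ₂ ρ₃ : ℝ → ℝ) : Prop extends HasDerivs ρ ρ₁ ρ₂ ρ₃ where
  rho_zero : ρ 0 = 1
  neg1 : ρ₁ 0 < 0
  pos2 : 0 < ρ₂ 0
  -- `kurtosis` makes the limiting variance of the values positive, `third` that of the rescaled
  -- radial entry; compare `peakCoeff_zero`.
  kurtosis : ρ₁ 0 ^ 2 < 3 * ρ₂ 0
  third : 3 * ρ₂ 0 ^ 2 < 5 * ρ₁ 0 * ρ₃ 0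
  radial_pos : ∀ r > 0,
    0 < (-(2 * ρ₁ 0)) ^ 2 - (-(2 * ρ₁ (r ^ 2) + 4 * r ^ 2 * ρ₂ (r ^ 2))) ^ 2
  tang_pos : ∀ r > 0, 0 < (-(2 * ρ₁ 0)) ^ 2 - (2 * ρ₁ (r ^ 2)) ^ 2

/-- The first order Taylor remainder of `ρ''`. -/
noncomputable def remainder₂ (ρ₂ ρ₃ : ℝ → ℝ) : ℝ → ℝ :=
  Function.update (fun x => (ρ₂ x - ρ₂ 0) / x) 0 (ρ₃ 0)

/-- The second order Taylor remainder of `ρ'`. -/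
noncomputable def remainder₁ (ρ₁ ρ₂ ρ₃ : ℝ → ℝ) : ℝ → ℝ :=
  Function.update (fun x => (ρ₁ x - ρ₁ 0 - ρ₂ 0 * x) / x ^ 2) 0 (ρ₃ 0 / 2)

variable {ρ ρ₁ ρ₂ ρ₃ : ℝ → ℝ}

theorem eq_remainder₂ {x : ℝ} : ρ₂ x = ρ₂ 0 + remainder₂ ρ₂ ρ₃ x * x := by
  rcases eq_or_ne x 0 with rfl | hx
  · simp
  · rw [remainder₂, Function.update_of_ne hx]
    field_simp
    ring

theorem eq_remainder₁ {x : ℝ} : ρ₁ x = ρ₁ 0 + ρ₂ 0 * x + remainder₁ ρ₁ ρ₂ ρ₃ x * x ^ 2 := by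
  rcases eq_or_ne x 0 with rfl | hx
  · simp
  · rw [remainder₁, Function.update_of_ne hx]
    field_simp
    ring

theorem continuousOn_update_zero {f : ℝ → ℝ} {y : ℝ} (hf : ∀ x > 0, ContinuousAt f x)
    (h0 : Tendsto f (𝓝[>] 0) (𝓝 y)) : ContinuousOn (Function.update f 0 y) (Set.Ici 0) := by
  intro x hx
  rcases eq_or_lt_of_le (Set.mem_Ici.1 hx) with rfl | hx
  · rw [continuousWithinAt_update_same]
    convert h0 using 2
    ext z
    simp
  · refine ContinuousAt.continuousWithinAt ?_
    exact (continuousAt_update_of_ne hx.ne').2 (hf x hx)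

theorem HasDerivs.tendsto_remainder₂ (h : HasDerivs ρ ρ₁ ρ₂ ρ₃) :
    Tendsto (fun x => (ρ₂ x - ρ₂ 0) / x) (𝓝[>] 0) (𝓝 (ρ₃ 0)) := by
  have h1 := (h.d3 0 Set.self_mem_Ici).mono Set.Ioi_subset_Ici_self
  rw [hasDerivWithinAt_iff_tendsto_slope' (by simp)] at h1
  refine h1.congr fun x => ?_
  simp [slope_def_field]

theorem HasDerivs.hasDerivAt₂ (h : HasDerivs ρ ρ₁ ρ₂ ρ₃) {x : ℝ} (hx : 0 < x) :
    HasDerivAt ρ₂ (ρ₃ x) x := (h.d3 x hx.le).hasDerivAt (Ici_mem_nhds hx)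

theorem HasDerivs.hasDerivAt₁ (h : HasDerivs ρ ρ₁ ρ₂ ρ₃) {x : ℝ} (hx : 0 < x) :
    HasDerivAt ρ₁ (ρ₂ x) x := (h.d2 x hx.le).hasDerivAt (Ici_mem_nhds hx)

theorem HasDerivs.tendsto_remainder₁ (h : HasDerivs ρ ρ₁ ρ₂ ρ₃) :
    Tendsto (fun x => (ρ₁ x - ρ₁ 0 - ρ₂ 0 * x) / x ^ 2) (𝓝[>] 0) (𝓝 (ρ₃ 0 / 2)) := by
  have c1 : Tendsto ρ₁ (𝓝[>] 0) (𝓝 (ρ₁ 0)) :=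
    ((h.d2 0 Set.self_mem_Ici).continuousWithinAt.mono Set.Ioi_subset_Ici_self)
  have cx : Tendsto (fun x : ℝ => x) (𝓝[>] 0) (𝓝 0) := tendsto_id.mono_left nhdsWithin_le_nhds
  refine HasDerivAt.lhopital_zero_nhdsGT (f' := fun x => ρ₂ x - ρ₂ 0) (g' := fun x => 2 * x)
    ?_ ?_ ?_ ?_ ?_ ?_
  · filter_upwards [self_mem_nhdsWithin] with x hx
    simpa using ((h.hasDerivAt₁ hx).sub_const (ρ₁ 0)).fun_sub ((hasDerivAt_id x).const_mul (ρ₂ 0))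
  · filter_upwards with x
    simpa using hasDerivAt_pow 2 x
  · filter_upwards [self_mem_nhdsWithin] with x hx
    have : (0 : ℝ) < x := hx
    positivity
  · simpa using (c1.sub_const (ρ₁ 0)).sub (cx.const_mul (ρ₂ 0))
  · simpa using cx.pow 2
  · refine (h.tendsto_remainder₂.div_const 2).congr fun x => ?_
    rw [div_div, mul_comm]

theorem HasDerivs.continuousOn_remainder₂ (h : HasDerivs ρ ρ₁ ρ₂ ρ₃) :
    ContinuousOn (remainder₂ ρ₂ ρ₃) (Set.Ici 0) :=
  continuousOn_update_zero (fun _ hx => ((h.hasDerivAt₂ hx).continuousAt.sub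
    continuousAt_const).div continuousAt_id (ne_of_gt hx)) h.tendsto_remainder₂

theorem HasDerivs.continuousOn_remainder₁ (h : HasDerivs ρ ρ₁ ρ₂ ρ₃) :
    ContinuousOn (remainder₁ ρ₁ ρ₂ ρ₃) (Set.Ici 0) :=
  continuousOn_update_zero (fun _ hx => (((h.hasDerivAt₁ hx).continuousAt.sub
    continuousAt_const).sub (continuousAt_const.mul continuousAt_id)).div (continuousAt_id.pow 2)
    (pow_ne_zero 2 (ne_of_gt hx))) h.tendsto_remainder₁

/-- The coefficients of the rescaled conditional covariance matrix, extended to `r = 0`. -/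
noncomputable def peakCoeff (ρ ρ₁ ρ₂ ρ₃ : ℝ → ℝ) (r : ℝ) : Fin 10 → ℝ :=
  taylorCoeff (ρ₁ 0) (ρ₂ 0) (ρ (r ^ 2)) (remainder₁ ρ₁ ρ₂ ρ₃ (r ^ 2)) (remainder₂ ρ₂ ρ₃ (r ^ 2))
    (ρ₃ (r ^ 2)) r

theorem IsAdmissible.det_radial_ne (h : IsAdmissible ρ ρ₁ ρ₂ ρ₃) {r : ℝ} (hr : 0 ≤ r) :
    -4 * (3 * ρ₂ 0 + r ^ 2 * (remainder₁ ρ₁ ρ₂ ρ₃ (r ^ 2) + 2 * remainder₂ ρ₂ ρ₃ (r ^ 2))) *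
      (2 * ρ₁ 0 + 3 * ρ₂ 0 * r ^ 2 +
        (r ^ 2) ^ 2 * (remainder₁ ρ₁ ρ₂ ρ₃ (r ^ 2) + 2 * remainder₂ ρ₂ ρ₃ (r ^ 2))) ≠ 0 := by
  rcases eq_or_lt_of_le hr with rfl | hr
  · have := h.neg1.ne
    have := h.pos2.ne'
    simp [*]
  · have h1 := h.radial_pos r hr
    rw [det_radial _ _ _ _ r _ _ (eq_remainder₁ (ρ₁ := ρ₁) (ρ₂ := ρ₂) (ρ₃ := ρ₃))
      (eq_remainder₂ (ρ₂ := ρ₂) (ρ₃ := ρ₃))] at h1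
    exact (pos_of_mul_pos_right h1 (by positivity)).ne'

theorem IsAdmissible.det_tangential_ne (h : IsAdmissible ρ ρ₁ ρ₂ ρ₃) {r : ℝ} (hr : 0 ≤ r) :
    -4 * (ρ₂ 0 + remainder₁ ρ₁ ρ₂ ρ₃ (r ^ 2) * r ^ 2) *
      (2 * ρ₁ 0 + ρ₂ 0 * r ^ 2 + remainder₁ ρ₁ ρ₂ ρ₃ (r ^ 2) * (r ^ 2) ^ 2) ≠ 0 := by
  rcases eq_or_lt_of_le hr with rfl | hr
  · have := h.neg1.ne
    have := h.pos2.ne'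
    simp [*]
  · have h1 := h.tang_pos r hr
    rw [det_tangential _ _ _ r _ (eq_remainder₁ (ρ₁ := ρ₁) (ρ₂ := ρ₂) (ρ₃ := ρ₃))] at h1
    exact (pos_of_mul_pos_right h1 (by positivity)).ne'

theorem IsAdmissible.peakCoeff_of_pos (h : IsAdmissible ρ ρ₁ ρ₂ ρ₃) {r : ℝ} (hr : 0 < r) :
    peakCoeff ρ ρ₁ ρ₂ ρ₃ r = radialCoeff (ρ₁ 0) (ρ₂ 0) (ρ (r ^ 2)) (ρ₁ (r ^ 2)) (ρ₂ (r ^ 2))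
      (ρ₃ (r ^ 2)) r :=
  (radialCoeff_eq_taylorCoeff _ _ _ _ _ _ _ _ _ eq_remainder₁ eq_remainder₂ hr.ne'
    (h.det_radial_ne hr.le) (h.det_tangential_ne hr.le)).symm

theorem IsAdmissible.peakCoeff_zero (h : IsAdmissible ρ ρ₁ ρ₂ ρ₃) :
    peakCoeff ρ ρ₁ ρ₂ ρ₃ 0 = ![(18 * ρ₂ 0 ^ 2 - 30 * ρ₁ 0 * ρ₃ 0) / ρ₁ 0, 0, 0, 8 * ρ₂ 0 / 3, 0, 0,
      4 * ρ₁ 0 / 3, 4 * ρ₁ 0 / 3, 1 - ρ₁ 0 ^ 2 / (3 * ρ₂ 0), 1 - ρ₁ 0 ^ 2 / (3 * ρ₂ 0)] := by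
  have h1 := taylorCoeff_zero (ρ₁ 0) (ρ₂ 0) 1 (ρ₃ 0) h.neg1.ne h.pos2.ne'
  rw [← h1, peakCoeff]
  simp [h.rho_zero, remainder₁, remainder₂]

theorem IsAdmissible.continuousOn_peakCoeff (h : IsAdmissible ρ ρ₁ ρ₂ ρ₃) :
    ContinuousOn (peakCoeff ρ ρ₁ ρ₂ ρ₃) (Set.Ici 0) := by
  have hsq : ∀ {f : ℝ → ℝ}, ContinuousOn f (Set.Ici 0) →
      ContinuousOn (fun r => f (r ^ 2)) (Set.Ici (0 : ℝ)) := fun hf =>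
    hf.comp (by fun_prop) fun r _ => Set.mem_Ici.2 (by positivity)
  exact continuousOn_taylorCoeff (v := fun r => ρ (r ^ 2))
    (T := fun r => remainder₁ ρ₁ ρ₂ ρ₃ (r ^ 2)) (Q := fun r => remainder₂ ρ₂ ρ₃ (r ^ 2))
    (s := fun r => ρ₃ (r ^ 2)) _ _ (hsq fun y hy => (h.d1 y hy).continuousWithinAt)
    (hsq h.continuousOn_remainder₁) (hsq h.continuousOn_remainder₂) (hsq h.cont)
    (fun r hr => h.det_radial_ne hr) (fun r hr => h.det_tangential_ne hr)

/-- The assumed inequality on ρ enters here. With x = r², the two coefficients are 2p₀(D + 8xpq)/D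
and 2p(D + 8xq(p + 2xq))/D, where D + 8xpq = 4(p₀² - p² - 2pqx - 4q²x²) is positive by assumption
and the other bracket is larger by 16x²q². -/
theorem IsAdmissible.peakCoeff_add_neg (h : IsAdmissible ρ ρ₁ ρ₂ ρ₃) {r : ℝ} (hr : 0 ≤ r)
    (hs : 0 < r → ρ₁ (r ^ 2) < 0 ∧ ρ₁ (r ^ 2) ^ 2 + 2 * ρ₁ (r ^ 2) * ρ₂ (r ^ 2) * r ^ 2 +
      4 * ρ₂ (r ^ 2) ^ 2 * (r ^ 2) ^ 2 < ρ₁ 0 ^ 2) :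
    peakCoeff ρ ρ₁ ρ₂ ρ₃ r 6 + peakCoeff ρ ρ₁ ρ₂ ρ₃ r 7 < 0 := by
  have hp0 := h.neg1
  rcases eq_or_lt_of_le hr with rfl | hr
  · rw [h.peakCoeff_zero]
    change 4 * ρ₁ 0 / 3 + 4 * ρ₁ 0 / 3 < 0
    linarith
  · obtain ⟨hp, hs⟩ := hs hr
    rw [h.peakCoeff_of_pos hr]
    have hD := h.radial_pos r hr
    have e6 : radialCoeff (ρ₁ 0) (ρ₂ 0) (ρ (r ^ 2)) (ρ₁ (r ^ 2)) (ρ₂ (r ^ 2)) (ρ₃ (r ^ 2)) r 6 =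
      2 * ρ₁ 0 - 8 * -(2 * ρ₁ 0) * r ^ 2 * ρ₁ (r ^ 2) * ρ₂ (r ^ 2) /
        ((-(2 * ρ₁ 0)) ^ 2 - (-(2 * ρ₁ (r ^ 2) + 4 * r ^ 2 * ρ₂ (r ^ 2))) ^ 2) := rfl
    have e7 : radialCoeff (ρ₁ 0) (ρ₂ 0) (ρ (r ^ 2)) (ρ₁ (r ^ 2)) (ρ₂ (r ^ 2)) (ρ₃ (r ^ 2)) r 7 =
      2 * ρ₁ (r ^ 2) - 8 * -(2 * ρ₁ (r ^ 2) + 4 * r ^ 2 * ρ₂ (r ^ 2)) * r ^ 2 * ρ₁ (r ^ 2) *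
        ρ₂ (r ^ 2) /
        ((-(2 * ρ₁ 0)) ^ 2 - (-(2 * ρ₁ (r ^ 2) + 4 * r ^ 2 * ρ₂ (r ^ 2))) ^ 2) := rfl
    rw [e6, e7]
    generalize ρ₁ (r ^ 2) = p at *
    generalize ρ₂ (r ^ 2) = q at *
    generalize ρ₁ 0 = p₀ at *
    generalize hx : r ^ 2 = x at *
    generalize hDd : (-(2 * p₀)) ^ 2 - (-(2 * p + 4 * x * q)) ^ 2 = D at *
    have h1 : 2 * p₀ - 8 * -(2 * p₀) * x * p * q / D = 2 * p₀ * ((D + 8 * x * p * q) / D) := by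
      field_simp
      ring
    have h2 : 2 * p - 8 * -(2 * p + 4 * x * q) * x * p * q / D
        = 2 * p * ((D + 8 * x * q * (p + 2 * x * q)) / D) := by
      field_simp
      ring
    have h3 : 0 < D + 8 * x * p * q := by rw [← hDd]; linarith
    have h4 : 0 < D + 8 * x * q * (p + 2 * x * q) := by
      have : 0 ≤ x ^ 2 * q ^ 2 := by positivity
      rw [← hDd]; linarith
    rw [h1, h2]
    have h5 := mul_neg_of_neg_of_pos (by linarith : 2 * p₀ < 0) (div_pos h3 hD)
    have h6 := mul_neg_of_neg_of_pos (by linarith : 2 * p < 0) (div_pos h4 hD)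
    linarith

end RadialCoefficients

end CritPair

namespace CritPair

/-! ### Non-degeneracy and uniform bounds for the rescaled covariance matrix. -/

section PeakMatrixBounds

variable {ρ ρ₁ ρ₂ ρ₃ : ℝ → ℝ} {n : ℕ}

/-- The rescaled conditional covariance matrix at distance `r`, extended to `r = 0`. -/
noncomputable def peakMatrix (ρ ρ₁ ρ₂ ρ₃ : ℝ → ℝ) (n : ℕ) (r : ℝ) :
    Matrix (MainIdx (n + 1)) (MainIdx (n + 1)) ℝ :=
  axialMatrix n (ρ₂ 0) (peakCoeff ρ ρ₁ ρ₂ ρ₃ r)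

theorem continuous_axialMatrix (n : ℕ) (q₀ : ℝ) : Continuous (axialMatrix n q₀) := by
  refine continuous_matrix fun i j => ?_
  rcases i with p | i <;> rcases j with p' | j
  · change Continuous fun α => hessCov q₀ α p.1.1 p.1.2 p'.1.1 p'.1.2
    unfold hessCov
    fun_prop
  · fin_cases j <;> simp only [axialMatrix, Matrix.of_apply, Sum.elim_inl, Sum.elim_inr,
      Fin.zero_eta, Fin.mk_one, Matrix.cons_val_zero, Matrix.cons_val_one,
      Matrix.cons_val_fin_one] <;> fun_prop
  · fin_cases i <;> simp only [axialMatrix, Matrix.of_apply, Sum.elim_inl, Sum.elim_inr,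
      Fin.zero_eta, Fin.mk_one, Matrix.cons_val_zero, Matrix.cons_val_one,
      Matrix.cons_val_fin_one] <;> fun_prop
  · fin_cases i <;> fin_cases j <;> simp only [axialMatrix, Matrix.of_apply, Sum.elim_inr,
      Fin.zero_eta, Fin.mk_one, Matrix.cons_val_zero, Matrix.cons_val_one,
      Matrix.cons_val_fin_one] <;> fun_prop

theorem IsAdmissible.continuousOn_peakMatrix (h : IsAdmissible ρ ρ₁ ρ₂ ρ₃) (n : ℕ) :
    ContinuousOn (peakMatrix ρ ρ₁ ρ₂ ρ₃ n) (Set.Ici 0) :=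
  (continuous_axialMatrix n _).comp_continuousOn h.continuousOn_peakCoeff

theorem isClosed_posSemidef {ι : Type*} [Fintype ι] :
    IsClosed {C : Matrix ι ι ℝ | C.PosSemidef} := by
  have : {C : Matrix ι ι ℝ | C.PosSemidef} = {C | C.transpose = C} ∩
      ⋂ v : ι → ℝ, {C | 0 ≤ v ⬝ᵥ C.mulVec v} := by
    ext C
    simp only [Set.mem_inter_iff, Set.mem_iInter, Set.mem_ofPred_eq]
    rw [Matrix.posSemidef_iff_dotProduct_mulVec, Matrix.IsHermitian,
      Matrix.conjTranspose_eq_transpose_of_trivial]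
    simp
  rw [this]
  refine (isClosed_eq (by fun_prop) (by fun_prop)).inter (isClosed_iInter fun v => ?_)
  refine isClosed_le continuous_const ?_
  simp only [dotProduct, Matrix.mulVec]
  fun_prop

theorem IsAdmissible.posSemidef_peakMatrix (h : IsAdmissible ρ ρ₁ ρ₂ ρ₃)
    (hpos : ∀ r > 0, (peakMatrix ρ ρ₁ ρ₂ ρ₃ n r).PosDef) {r : ℝ} (hr : 0 ≤ r) :
    (peakMatrix ρ ρ₁ ρ₂ ρ₃ n r).PosSemidef := by
  rcases eq_or_lt_of_le hr with rfl | hr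
  · have h1 := (h.continuousOn_peakMatrix n 0 Set.self_mem_Ici).mono Set.Ioi_subset_Ici_self
    refine isClosed_posSemidef.mem_of_tendsto h1.tendsto ?_
    filter_upwards [self_mem_nhdsWithin] with r hr using (hpos r hr).posSemidef
  · exact (hpos r hr).posSemidef

theorem IsAdmissible.peakCoeff_zero_pos (h : IsAdmissible ρ ρ₁ ρ₂ ρ₃) :
    0 < peakCoeff ρ ρ₁ ρ₂ ρ₃ 0 0 ∧ peakCoeff ρ ρ₁ ρ₂ ρ₃ 0 1 = 0 ∧ peakCoeff ρ ρ₁ ρ₂ ρ₃ 0 4 = 0 ∧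
      peakCoeff ρ ρ₁ ρ₂ ρ₃ 0 5 = 0 ∧ peakCoeff ρ ρ₁ ρ₂ ρ₃ 0 6 < 0 ∧
      0 < peakCoeff ρ ρ₁ ρ₂ ρ₃ 0 8 ∧ 0 < peakCoeff ρ ρ₁ ρ₂ ρ₃ 0 9 := by
  rw [h.peakCoeff_zero]
  have h1 := h.neg1
  have h2 := h.pos2
  have h3 := h.kurtosis
  have h4 := h.third
  have h5 : 0 < 1 - ρ₁ 0 ^ 2 / (3 * ρ₂ 0) := by
    rw [sub_pos, div_lt_one (by positivity)]
    exact h3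
  refine ⟨?_, rfl, rfl, rfl, ?_, h5, h5⟩
  · exact div_pos_of_neg_of_neg (by nlinarith) h1
  · change 4 * ρ₁ 0 / 3 < 0
    linarith

theorem axialMatrix_mulVec_zero (q₀ : ℝ) (α : Fin 10 → ℝ) (i : MainIdx (n + 1)) :
    (axialMatrix n q₀ α).mulVec
      (Pi.single (Sum.inr 0) 1 - Pi.single (cornerIdx n) 1) i
      = axialMatrix n q₀ α i (Sum.inr 0) - axialMatrix n q₀ α i (cornerIdx n) := by
  rw [Matrix.mulVec_sub, Matrix.mulVec_single_one, Matrix.mulVec_single_one]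
  rfl

/-- The matrix at r = 0 is singular, so an explicit direction is needed: one value coordinate minus
the corner coordinate. Its image has diagonal Hessian with negative entries, minus coefficient 0 and
coefficient 6, and positive values. -/
theorem IsAdmissible.chargesMaxima_zero (h : IsAdmissible ρ ρ₁ ρ₂ ρ₃)
    (hpos : ∀ r > 0, (peakMatrix ρ ρ₁ ρ₂ ρ₃ n r).PosDef) :
    ChargesMaxima (peakMatrix ρ ρ₁ ρ₂ ρ₃ n 0) := by
  obtain ⟨a0, a1, a4, a5, a6, a8, a9⟩ := h.peakCoeff_zero_pos
  refine ⟨h.posSemidef_peakMatrix hpos le_rfl,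
    Pi.single (Sum.inr 0) 1 - Pi.single (cornerIdx n) 1, ?_, ?_, ?_⟩
  · rw [peakMatrix, axialMatrix_mulVec_zero]
    simpa [axialMatrix, cornerIdx, radial, tang, a4] using a8
  · rw [peakMatrix, axialMatrix_mulVec_zero]
    simpa [axialMatrix, cornerIdx, radial, tang, a5] using a9
  · intro e he
    have hm : matri (hessPart ((peakMatrix ρ ρ₁ ρ₂ ρ₃ n 0).mulVec
        (Pi.single (Sum.inr 0) 1 - Pi.single (cornerIdx n) 1))) =
        Matrix.diagonal fun i : Fin (n + 1) =>
          if i = 0 then -peakCoeff ρ ρ₁ ρ₂ ρ₃ 0 0 else peakCoeff ρ ρ₁ ρ₂ ρ₃ 0 6 := by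
      ext i j
      simp only [matri, hessPart, Matrix.of_apply]
      rw [peakMatrix, axialMatrix_mulVec_zero]
      simp only [axialMatrix, cornerIdx, Matrix.of_apply, Sum.elim_inl, Sum.elim_inr,
        Matrix.cons_val_zero, a4, hessCov, a1]
      rcases lt_trichotomy i j with hij | rfl | hij
      · have h1 : radial j = 0 := if_neg (by rintro rfl; exact absurd hij (Fin.not_lt_zero _))
        simp [min_eq_left hij.le, max_eq_right hij.le, tang, hij.ne, h1]
      · by_cases hi : i = 0 <;> simp [radial, tang, hi]
      · have h1 : radial i = 0 := if_neg (by rintro rfl; exact absurd hij (Fin.not_lt_zero _))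
        simp [min_eq_right hij.le, max_eq_left hij.le, tang, hij.ne, hij.ne', h1]
    rw [hm]
    have h1 : ∀ i : Fin (n + 1), (if i = 0 then -peakCoeff ρ ρ₁ ρ₂ ρ₃ 0 0
        else peakCoeff ρ ρ₁ ρ₂ ρ₃ 0 6) < 0 := by
      intro i
      split_ifs
      · linarith
      · exact a6
    simp only [dotProduct, Matrix.mulVec_diagonal]
    obtain ⟨i, hi⟩ := Function.ne_iff.1 he
    have h2 : ∀ i, e i * ((if i = 0 then -peakCoeff ρ ρ₁ ρ₂ ρ₃ 0 0
        else peakCoeff ρ ρ₁ ρ₂ ρ₃ 0 6) * e i) =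
        (if i = 0 then -peakCoeff ρ ρ₁ ρ₂ ρ₃ 0 0 else peakCoeff ρ ρ₁ ρ₂ ρ₃ 0 6) * e i ^ 2 := by
      intro i; ring
    simp_rw [h2]
    refine Finset.sum_neg' (fun i _ => mul_nonpos_of_nonpos_of_nonneg (h1 i).le (sq_nonneg _))
      ⟨i, Finset.mem_univ _, mul_neg_of_neg_of_pos (h1 i) (pow_two_pos_of_ne_zero hi)⟩

theorem IsAdmissible.chargesMaxima_peakMatrix (h : IsAdmissible ρ ρ₁ ρ₂ ρ₃)
    (hpos : ∀ r > 0, (peakMatrix ρ ρ₁ ρ₂ ρ₃ n r).PosDef) {r : ℝ} (hr : 0 ≤ r) :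
    ChargesMaxima (peakMatrix ρ ρ₁ ρ₂ ρ₃ n r) := by
  rcases eq_or_lt_of_le hr with rfl | hr
  · exact h.chargesMaxima_zero hpos
  · exact chargesMaxima_of_posDef (hpos r hr)

theorem sumVar_pos_of_posDef {N : ℕ} {C : Matrix (MainIdx N) (MainIdx N) ℝ} (hC : C.PosDef) :
    0 < sumVar C := by
  have h1 := hC.dotProduct_mulVec_pos (x := Pi.single (Sum.inr 0) 1 + Pi.single (Sum.inr 1) 1) (by
    intro h0
    have := congrFun h0 (Sum.inr 0)
    simp at this)
  simp only [star_trivial, Matrix.mulVec_add, Matrix.mulVec_single_one, add_dotProduct,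
    dotProduct_add, single_one_dotProduct, Matrix.col_apply] at h1
  simp only [sumVar, sumCov]
  linarith

theorem corner_pos_of_posDef {N : ℕ} {C : Matrix (MainIdx N) (MainIdx N) ℝ} (hC : C.PosDef)
    (p : HessIdx N) : 0 < C (Sum.inl p) (Sum.inl p) * sumVar C - sumCov C (Sum.inl p) ^ 2 := by
  have hs := sumVar_pos_of_posDef hC
  -- The test vector is the regression residual of the entry on the sum of the values, multiplied by
  -- `sumVar C` to clear denominators.
  have h1 := hC.dotProduct_mulVec_pos (x := sumVar C • Pi.single (Sum.inl p) 1 -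
    sumCov C (Sum.inl p) • (Pi.single (Sum.inr 0) 1 + Pi.single (Sum.inr 1) 1)) (by
    intro h0
    have := congrFun h0 (Sum.inl p)
    simp at this
    exact hs.ne' this)
  have hsymm : ∀ i j, C i j = C j i := fun i j => by
    have := hC.isHermitian.apply i j
    simpa using this.symm
  simp only [star_trivial, Matrix.mulVec_add, Matrix.mulVec_sub, Matrix.mulVec_smul,
    Matrix.mulVec_single_one, add_dotProduct, sub_dotProduct, smul_dotProduct, dotProduct_smul,
    dotProduct_sub, dotProduct_add, single_one_dotProduct, Matrix.col_apply, smul_eq_mul] at h1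
  rw [hsymm (Sum.inr 0) (Sum.inl p), hsymm (Sum.inr 1) (Sum.inl p)] at h1
  have h2 : 0 < sumVar C * (C (Sum.inl p) (Sum.inl p) * sumVar C - sumCov C (Sum.inl p) ^ 2) := by
    refine h1.trans_eq ?_
    simp only [sumVar, sumCov]
    ring
  exact pos_of_mul_pos_right h2 hs.le

/-- The constant c is the minimum over [0, d] of three continuous positive functions. At r = 0,
positivity comes from the explicit limit coefficients, since the matrix is singular there. -/
theorem IsAdmissible.exists_peakBounds (h : IsAdmissible ρ ρ₁ ρ₂ ρ₃)
    (hpos : ∀ r > 0, (peakMatrix ρ ρ₁ ρ₂ ρ₃ n r).PosDef) {d : ℝ} (hd : 0 ≤ d)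
    (hs : ∀ r, 0 < r → r ≤ d → ρ₁ (r ^ 2) < 0 ∧ ρ₁ (r ^ 2) ^ 2 +
      2 * ρ₁ (r ^ 2) * ρ₂ (r ^ 2) * r ^ 2 + 4 * ρ₂ (r ^ 2) ^ 2 * (r ^ 2) ^ 2 < ρ₁ 0 ^ 2) :
    ∃ K c : ℝ, 0 < K ∧ 0 < c ∧ ∀ r ∈ Set.Icc 0 d, PeakBounds n K c (peakMatrix ρ ρ₁ ρ₂ ρ₃ n r) := by
  have hcont : ContinuousOn (peakMatrix ρ ρ₁ ρ₂ ρ₃ n) (Set.Icc 0 d) :=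
    (h.continuousOn_peakMatrix n).mono Set.Icc_subset_Ici_self
  have hentry : ∀ i j, ContinuousOn (fun r => peakMatrix ρ ρ₁ ρ₂ ρ₃ n r i j) (Set.Icc 0 d) :=
    fun i j => (continuous_id.matrix_elem i j).comp_continuousOn hcont
  have hb : ∀ i j, ∃ K, ∀ r ∈ Set.Icc 0 d, ‖peakMatrix ρ ρ₁ ρ₂ ρ₃ n r i j‖ ≤ K := fun i j =>
    isCompact_Icc.exists_bound_of_continuousOn (hentry i j)
  choose K hK using hb
  have hsumCov : ∀ i, ContinuousOn (fun r => sumCov (peakMatrix ρ ρ₁ ρ₂ ρ₃ n r) i) (Set.Icc 0 d) :=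
    fun i => (hentry _ _).add (hentry _ _)
  have hsumVar : ContinuousOn (fun r => sumVar (peakMatrix ρ ρ₁ ρ₂ ρ₃ n r)) (Set.Icc 0 d) :=
    (hsumCov _).add (hsumCov _)
  have hcoeff : ∀ i, ContinuousOn (fun r => peakCoeff ρ ρ₁ ρ₂ ρ₃ r i) (Set.Icc 0 d) := fun i =>
    (continuous_apply i).comp_continuousOn
      (h.continuousOn_peakCoeff.mono Set.Icc_subset_Ici_self)
  obtain ⟨a0, -, a4, a5, -, a8, a9⟩ := h.peakCoeff_zero_pos
  have p1 : ∀ r ∈ Set.Icc 0 d, 0 < sumVar (peakMatrix ρ ρ₁ ρ₂ ρ₃ n r) := by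
    intro r hr
    rcases eq_or_lt_of_le hr.1 with rfl | hr
    · simp only [sumVar, sumCov, peakMatrix, axialMatrix, Matrix.of_apply, Sum.elim_inr,
        Matrix.cons_val_zero, Matrix.cons_val_one, Matrix.cons_val_fin_one]
      linarith
    · exact sumVar_pos_of_posDef (hpos r hr)
  have p2 : ∀ r ∈ Set.Icc 0 d, 0 < -(peakCoeff ρ ρ₁ ρ₂ ρ₃ r 6 + peakCoeff ρ ρ₁ ρ₂ ρ₃ r 7) :=
    fun r hr => neg_pos.2 (h.peakCoeff_add_neg hr.1 fun h0 => hs r h0 hr.2)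
  have p3 : ∀ r ∈ Set.Icc 0 d, 0 < peakMatrix ρ ρ₁ ρ₂ ρ₃ n r (cornerIdx n) (cornerIdx n) *
      sumVar (peakMatrix ρ ρ₁ ρ₂ ρ₃ n r) - sumCov (peakMatrix ρ ρ₁ ρ₂ ρ₃ n r) (cornerIdx n) ^ 2 := by
    intro r hr
    rcases eq_or_lt_of_le hr.1 with rfl | hr'
    · have e1 : sumCov (peakMatrix ρ ρ₁ ρ₂ ρ₃ n 0) (cornerIdx n) = 0 := by
        simp [sumCov, peakMatrix, axialMatrix, cornerIdx, tang, a4, a5]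
      have e2 : peakMatrix ρ ρ₁ ρ₂ ρ₃ n 0 (cornerIdx n) (cornerIdx n) =
          peakCoeff ρ ρ₁ ρ₂ ρ₃ 0 0 := by
        simp [peakMatrix, axialMatrix, cornerIdx, hessCov, tang, radial]
      have := p1 0 hr
      rw [e1, e2]
      have := mul_pos a0 this
      linarith
    · exact corner_pos_of_posDef (hpos r hr') _
  set F : ℝ → ℝ := fun r => min (sumVar (peakMatrix ρ ρ₁ ρ₂ ρ₃ n r))
    (min (-(peakCoeff ρ ρ₁ ρ₂ ρ₃ r 6 + peakCoeff ρ ρ₁ ρ₂ ρ₃ r 7))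
      (peakMatrix ρ ρ₁ ρ₂ ρ₃ n r (cornerIdx n) (cornerIdx n) *
      sumVar (peakMatrix ρ ρ₁ ρ₂ ρ₃ n r) -
        sumCov (peakMatrix ρ ρ₁ ρ₂ ρ₃ n r) (cornerIdx n) ^ 2)) with hF
  have hFc : ContinuousOn F (Set.Icc 0 d) :=
    hsumVar.inf ((((hcoeff 6).add (hcoeff 7)).neg).inf
      (((hentry _ _).mul hsumVar).sub ((hsumCov _).pow 2)))
  obtain ⟨r₀, hr₀, hmin⟩ := isCompact_Icc.exists_isMinOn (Set.nonempty_Icc.2 hd) hFc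
  have hF0 : 0 < F r₀ := lt_min (p1 r₀ hr₀) (lt_min (p2 r₀ hr₀) (p3 r₀ hr₀))
  refine ⟨1 + ∑ i, ∑ j, |K i j|, F r₀, by positivity, hF0, fun r hr => ?_⟩
  have hFr : F r₀ ≤ F r := hmin hr
  have m1 : F r₀ ≤ sumVar (peakMatrix ρ ρ₁ ρ₂ ρ₃ n r) := hFr.trans (min_le_left _ _)
  have m2 := hFr.trans ((min_le_right _ _).trans (min_le_left _ _))
  have m3 := hFr.trans ((min_le_right _ _).trans (min_le_right _ _))
  refine ⟨h.posSemidef_peakMatrix hpos hr.1, fun i j => ?_, rfl, m1, fun p hp => ?_, fun j => ?_, m3⟩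
  · refine (hK i j r hr).trans ((le_abs_self _).trans ?_)
    have h1 : |K i j| ≤ ∑ j, |K i j| :=
      Finset.single_le_sum (f := fun j => |K i j|) (fun _ _ => abs_nonneg _) (Finset.mem_univ j)
    have h2 : ∑ j, |K i j| ≤ ∑ i, ∑ j, |K i j| :=
      Finset.single_le_sum (f := fun i => ∑ j, |K i j|)
        (fun _ _ => Finset.sum_nonneg fun _ _ => abs_nonneg _) (Finset.mem_univ i)
    linarith
  · have h1 : radial p.1.1 * radial p.1.2 = 0 := by
      simp only [radial]
      split_ifs with h1 h2
      · exact absurd (h1.trans h2.symm) hp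
      all_goals simp
    simp [sumCov, peakMatrix, axialMatrix, tang, hp, h1]
  · have h1 : sumCov (peakMatrix ρ ρ₁ ρ₂ ρ₃ n r) (Sum.inl ⟨(j.succ, j.succ), le_rfl⟩) =
        peakCoeff ρ ρ₁ ρ₂ ρ₃ r 6 + peakCoeff ρ ρ₁ ρ₂ ρ₃ r 7 := by
      simp [sumCov, peakMatrix, axialMatrix, tang, radial]
    rw [h1]
    linarith

end PeakMatrixBounds

end CritPair

namespace CritPair

/-! ### Inequalities between the derivatives of ρ from non-degeneracy. -/

section Admissible

open scoped RealInnerProductSpace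

variable {n : ℕ} {H : Type*} [NormedAddCommGroup H] [InnerProductSpace ℝ H]
  {ρ ρ₁ ρ₂ ρ₃ : ℝ → ℝ} {x : EuclideanSpace ℝ (Fin (n + 1)) → H}
  {x1 : Fin (n + 1) → EuclideanSpace ℝ (Fin (n + 1)) → H}
  {x2 : Fin (n + 1) → Fin (n + 1) → EuclideanSpace ℝ (Fin (n + 1)) → H}

theorem sq_lt_of_posDef {ι : Type*} [Finite ι] {M : Matrix ι ι ℝ} (hM : M.PosDef) {i j : ι}
    (hij : i ≠ j) : M i j ^ 2 < M i i * M j j := by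
  have hdet := (hM.submatrix (e := ![i, j]) (by
    intro a b hab
    fin_cases a <;> fin_cases b <;> simp_all)).det_pos
  have hsymm : M j i = M i j := by simpa using hM.isHermitian.apply i j
  rw [Matrix.det_fin_two] at hdet
  simp only [Matrix.submatrix_apply, Matrix.cons_val_zero, Matrix.cons_val_one,
    Matrix.cons_val_fin_one, hsymm] at hdet
  rw [sq]
  linarith

theorem inner_basisVec {N : ℕ} (i j : Fin N) : ⟪(basisVec i : EuclideanSpace ℝ (Fin N)), basisVec j⟫
    = kron i j := by
  rw [EuclideanSpace.inner_single_left]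
  simp [kron, basisVec]

/-- Both numbers are limits of inner products of difference quotients of X₁₁ along the axis. The
covariance of X₁₁ at two distinct points involves the fourth derivative of ρ, but with a factor u⁴
that makes it disappear in the limit. -/
theorem IsHilbertField.third_moment (hx : IsHilbertField ρ x x1 x2) (hρ : HasDerivs ρ ρ₁ ρ₂ ρ₃)
    {ρ₄ : ℝ → ℝ} {δ : ℝ} (hδ : 0 < δ)
    (h4 : ∀ y ∈ Set.Icc 0 (δ ^ 2), HasDerivWithinAt ρ₃ (ρ₄ y) (Set.Ici 0) y)
    (h5 : ContinuousWithinAt ρ₄ (Set.Ici 0) 0) {y : H}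
    (hy : HasDerivAt (fun h : ℝ => x2 0 0 (h • basisVec 0)) y 0) :
    ⟪y, y⟫ = -120 * ρ₃ 0 ∧ ⟪y, x1 0 0⟫ = -12 * ρ₂ 0 := by
  set e : EuclideanSpace ℝ (Fin (n + 1)) := basisVec 0 with he
  have hee : ⟪e, e⟫ = 1 := by rw [he, inner_basisVec]; simp [kron]
  have hne : ‖e‖ ^ 2 = 1 := by rw [← real_inner_self_eq_norm_sq, hee]
  have hns : ∀ u : ℝ, ‖u • e‖ ^ 2 = u ^ 2 := fun u => by
    rw [norm_smul, mul_pow, hne, mul_one, Real.norm_eq_abs, sq_abs]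
  have hin : ∀ u : ℝ, ⟪e, u • e⟫ = u := fun u => by rw [inner_smul_right, hee, mul_one]
  have hx2 : ∀ t, x2 0 0 t = dir2 x2 e e t := fun t => (dir2_basisVec 0 0 t).symm
  have hx1 : ∀ t, x1 0 t = dir1 x1 e t := fun t => (dir1_basisVec 0 t).symm
  have h21 : ∀ u v : ℝ, ⟪x2 0 0 (u • e), x1 0 (v • e)⟫ =
      -(12 * ρ₂ ((u - v) ^ 2) * (u - v) + 8 * ρ₃ ((u - v) ^ 2) * (u - v) ^ 3) := by
    intro u v
    rw [hx2, hx1, hx.inner_dir2_dir1 hρ, ← sub_smul, hns, hin, hee]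
    ring
  have h22 : ∀ u : ℝ, ⟪x2 0 0 (u • e), x2 0 0 (u • e)⟫ = 12 * ρ₂ 0 := by
    intro u
    rw [hx2, hx.inner_dir2_dir2 hρ, hee]
    ring
  have hsq : ∀ {f : ℝ → ℝ} {f' u : ℝ}, u ≠ 0 → HasDerivWithinAt f f' (Set.Ici 0) (u ^ 2) →
      HasDerivAt (fun v => f (v ^ 2)) (f' * (2 * u)) u := by
    intro f f' u hu hf
    have h1 : HasDerivAt f f' (u ^ 2) := hf.hasDerivAt (Ici_mem_nhds (by positivity))
    have h2 : HasDerivAt (fun v : ℝ => v ^ 2) (2 * u) u := by simpa using hasDerivAt_pow 2 u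
    exact HasDerivAt.comp u (h₂ := f) (h := fun v : ℝ => v ^ 2) h1 h2
  have h22' : ∀ u : ℝ, u ≠ 0 → |u| ≤ δ → ⟪x2 0 0 (u • e), x2 0 0 0⟫ =
      12 * ρ₂ (u ^ 2) + 48 * u ^ 2 * ρ₃ (u ^ 2) + 16 * u ^ 4 * ρ₄ (u ^ 2) := by
    intro u hu huδ
    have hd := hx.deriv2 0 0 0
    have h1 := hd.inner ℝ (hasDerivAt_const (0 : ℝ) (x2 0 0 (u • e)))
    simp only [inner_zero_right, zero_add] at h1
    have hmem : u ^ 2 ∈ Set.Icc 0 (δ ^ 2) :=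
      ⟨by positivity, sq_le_sq' (by linarith [neg_abs_le u]) ((le_abs_self u).trans huδ)⟩
    have h2 : HasDerivAt (fun w : ℝ => -(12 * ρ₂ (w ^ 2) * w + 8 * ρ₃ (w ^ 2) * w ^ 3))
        (-((12 * (ρ₃ (u ^ 2) * (2 * u)) * u + 12 * ρ₂ (u ^ 2) * 1) +
          (8 * (ρ₄ (u ^ 2) * (2 * u)) * u ^ 3 + 8 * ρ₃ (u ^ 2) * (3 * u ^ 2)))) u := by
      refine ((((hsq hu (hρ.d3 _ hmem.1)).const_mul 12).mul (hasDerivAt_id u)).add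
        (((hsq hu (h4 _ hmem)).const_mul 8).mul ?_)).neg
      simpa using hasDerivAt_pow 3 u
    have h3 := HasDerivAt.comp_const_sub (f := fun w : ℝ =>
      -(12 * ρ₂ (w ^ 2) * w + 8 * ρ₃ (w ^ 2) * w ^ 3)) u 0 (by rw [sub_zero]; exact h2)
    have h4 := h1.unique (h3.congr_of_eventuallyEq (Eventually.of_forall fun r => by
      change ⟪x1 0 (r • e), x2 0 0 (u • e)⟫ = _
      rw [real_inner_comm, h21]))
    rw [real_inner_comm, h4]
    ring
  have hslope := hasDerivAt_iff_tendsto_slope_zero.1 hy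
  simp only [zero_add, zero_smul] at hslope
  have cx : Tendsto (fun u : ℝ => u ^ 2) (𝓝[≠] 0) (𝓝[>] 0) := by
    refine tendsto_nhdsWithin_iff.2 ⟨?_, ?_⟩
    · have : Tendsto (fun u : ℝ => u ^ 2) (𝓝 0) (𝓝 (0 ^ 2)) := (continuous_pow 2).tendsto 0
      rw [zero_pow two_ne_zero] at this
      exact this.mono_left nhdsWithin_le_nhds
    · filter_upwards [self_mem_nhdsWithin] with u hu
      have hu' : u ≠ 0 := hu
      exact Set.mem_Ioi.2 (by positivity)
  have c2 := cx.mono_right (nhdsWithin_mono (0 : ℝ) Set.Ioi_subset_Ici_self)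
  have t3 : Tendsto (fun u : ℝ => ρ₃ (u ^ 2)) (𝓝[≠] 0) (𝓝 (ρ₃ 0)) :=
    (hρ.cont 0 Set.self_mem_Ici).tendsto.comp c2
  have t4 : Tendsto (fun u : ℝ => ρ₄ (u ^ 2)) (𝓝[≠] 0) (𝓝 (ρ₄ 0)) := h5.tendsto.comp c2
  have t2 : Tendsto (fun u : ℝ => ρ₂ (u ^ 2)) (𝓝[≠] 0) (𝓝 (ρ₂ 0)) :=
    (hρ.d3 0 Set.self_mem_Ici).continuousWithinAt.tendsto.comp c2
  have tq : Tendsto (fun u : ℝ => (ρ₂ (u ^ 2) - ρ₂ 0) / u ^ 2) (𝓝[≠] 0) (𝓝 (ρ₃ 0)) :=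
    hρ.tendsto_remainder₂.comp cx
  have tu : Tendsto (fun u : ℝ => u ^ 2) (𝓝[≠] 0) (𝓝 0) := c2.mono_right nhdsWithin_le_nhds
  constructor
  · refine tendsto_nhds_unique (hslope.inner hslope) ?_
    have hlim : Tendsto (fun u : ℝ => -24 * ((ρ₂ (u ^ 2) - ρ₂ 0) / u ^ 2) - 96 * ρ₃ (u ^ 2) -
        32 * u ^ 2 * ρ₄ (u ^ 2)) (𝓝[≠] 0) (𝓝 (-24 * ρ₃ 0 - 96 * ρ₃ 0 - 32 * 0 * ρ₄ 0)) :=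
      ((tq.const_mul (-24)).sub (t3.const_mul 96)).sub ((tu.const_mul 32).mul t4)
    rw [show -120 * ρ₃ 0 = -24 * ρ₃ 0 - 96 * ρ₃ 0 - 32 * 0 * ρ₄ 0 by ring]
    refine hlim.congr' ?_
    have hmem : Set.Icc (-δ) δ ∈ 𝓝 (0 : ℝ) := Icc_mem_nhds (by linarith) hδ
    filter_upwards [self_mem_nhdsWithin, nhdsWithin_le_nhds hmem] with u hu huδ
    have hu' : u ≠ 0 := hu
    have h00 := h22 0
    rw [zero_smul] at h00
    rw [inner_smul_left, inner_smul_right, inner_sub_left, inner_sub_right, inner_sub_right,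
      h22, h00, real_inner_comm (x2 0 0 (u • e)) (x2 0 0 0), h22' u hu' (abs_le.2 huδ), conj_trivial]
    field_simp
    ring
  · have h1 := Filter.Tendsto.inner (𝕜 := ℝ) hslope (tendsto_const_nhds (x := x1 0 0))
    refine tendsto_nhds_unique h1 ?_
    have hlim : Tendsto (fun u : ℝ => -(12 * ρ₂ (u ^ 2) + 8 * ρ₃ (u ^ 2) * u ^ 2)) (𝓝[≠] 0)
        (𝓝 (-(12 * ρ₂ 0 + 8 * ρ₃ 0 * 0))) :=
      ((t2.const_mul 12).add ((t3.const_mul 8).mul tu)).neg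
    rw [show -12 * ρ₂ 0 = -(12 * ρ₂ 0 + 8 * ρ₃ 0 * 0) by ring]
    refine hlim.congr' ?_
    filter_upwards [self_mem_nhdsWithin] with u hu
    have hu' : u ≠ 0 := hu
    have h0 := h21 0 0
    have h1 := h21 u 0
    simp only [zero_smul, sub_zero] at h0 h1
    rw [inner_smul_left, inner_sub_left, h1, h0, conj_trivial]
    field_simp
    ring

/-- Each inequality is a diagonal entry or a 2 × 2 minor: the variance of X₁, the pair (X₁₁, X), and
the pairs (X_i(t), X_i(0)) with i radial or tangential. -/
theorem IsHilbertField.isAdmissible (hx : IsHilbertField ρ x x1 x2) (hρ : HasDerivs ρ ρ₁ ρ₂ ρ₃)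
    (h0 : ρ 0 = 1) (hn : 1 ≤ n) (hthird : 3 * ρ₂ 0 ^ 2 < 5 * ρ₁ 0 * ρ₃ 0)
    (hmain : ∀ t ≠ 0, (crossGram (mainFam x x2 t) (mainFam x x2 t)).PosDef)
    (hgrad : ∀ t ≠ 0, (crossGram (gradFam x1 t) (gradFam x1 t)).PosDef) :
    IsAdmissible ρ ρ₁ ρ₂ ρ₃ := by
  have hne : ∀ r : ℝ, 0 < r → r • (basisVec 0 : EuclideanSpace ℝ (Fin (n + 1))) ≠ 0 := by
    intro r hr h
    have := congrArg (fun v : EuclideanSpace ℝ (Fin (n + 1)) => v 0) h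
    simp [basisVec] at this
    exact hr.ne' this
  have hns : ∀ u : ℝ, ‖u • (basisVec 0 : EuclideanSpace ℝ (Fin (n + 1)))‖ ^ 2 = u ^ 2 :=
    fun u => by
      rw [norm_smul, mul_pow, ← real_inner_self_eq_norm_sq (basisVec 0), inner_basisVec, Real.norm_eq_abs,
        sq_abs]
      simp [kron]
  have hg := hgrad _ (hne 1 one_pos)
  have hm := hmain _ (hne 1 one_pos)
  have g1 : ∀ i t s, ⟪x1 i t, x1 i s⟫ = -(2 * ρ₁ (‖t - s‖ ^ 2) +
      4 * ρ₂ (‖t - s‖ ^ 2) * ⟪basisVec i, t - s⟫ ^ 2) := by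
    intro i t s
    rw [← dir1_basisVec (x1 := x1) i t, ← dir1_basisVec (x1 := x1) i s, hx.inner_dir1_dir1 hρ,
      inner_basisVec]
    simp only [kron, if_true]
    ring
  have d1 := hg.diag_pos (i := Sum.inl 0)
  simp only [crossGram, gradFam, Matrix.of_apply, Sum.elim_inl, g1] at d1
  simp only [sub_self, norm_zero, inner_zero_right] at d1
  norm_num at d1
  have hm2 := sq_lt_of_posDef hm (i := Sum.inl ⟨(0, 0), le_rfl⟩) (j := Sum.inr 0) (by simp)
  simp only [crossGram, mainFam, Matrix.of_apply, Sum.elim_inl, Sum.elim_inr, Matrix.cons_val_zero,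
    hx.cov] at hm2
  rw [← dir2_basisVec (x2 := x2), hx.inner_dir2 hρ, hx.inner_dir2_dir2 hρ, inner_basisVec] at hm2
  simp only [kron, if_true, sub_self, norm_zero, inner_zero_right, zero_pow two_ne_zero, h0] at hm2
  have hk : ρ₁ 0 ^ 2 < 3 * ρ₂ 0 := by linarith
  refine ⟨hρ, h0, by linarith, ?_, hk, hthird, fun r hr => ?_, fun r hr => ?_⟩
  · nlinarith [sq_nonneg (ρ₁ 0)]
  · have h := sq_lt_of_posDef (hgrad _ (hne r hr)) (i := Sum.inl 0) (j := Sum.inr 0) (by simp)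
    simp only [crossGram, gradFam, Matrix.of_apply, Sum.elim_inl, Sum.elim_inr, g1, sub_zero,
      hns, inner_smul_right, inner_basisVec, sub_self, norm_zero, inner_zero_right,
      zero_pow two_ne_zero] at h
    simp only [kron, if_true] at h
    linarith
  -- A tangential axis exists because 1 ≤ n.
  · have h := sq_lt_of_posDef (hgrad _ (hne r hr)) (i := Sum.inl ⟨1, by omega⟩)
      (j := Sum.inr ⟨1, by omega⟩) (by simp)
    have hk : kron (⟨1, by omega⟩ : Fin (n + 1)) 0 = 0 := if_neg (by simp [Fin.ext_iff])
    simp only [crossGram, gradFam, Matrix.of_apply, Sum.elim_inl, Sum.elim_inr, g1, sub_zero,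
      hns, inner_smul_right, inner_basisVec, sub_self, norm_zero, inner_zero_right,
      zero_pow two_ne_zero, hk] at h
    linarith

end Admissible

end CritPair

namespace CritPair

/-! ### Reduction of `psi` to the rescaled covariance matrix. -/

section Reduction

open scoped RealInnerProductSpace

theorem gaussDensity_zero_pos {ι : Type*} [Fintype ι] [DecidableEq ι] {C : Matrix ι ι ℝ}
    (hC : C.PosDef) : 0 < gaussDensity C 0 := by
  have := hC.det_pos
  have := Real.pi_pos
  unfold gaussDensity
  positivity

theorem covMat_sumElim {Ω ι κ : Type*} [MeasurableSpace Ω] (P : Measure Ω) (Y : ι → Ω → ℝ)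
    (Z : κ → Ω → ℝ) : covMat P (Sum.elim Y Z) (Sum.elim Y Z) =
      Matrix.fromBlocks (covMat P Y Y) (covMat P Y Z) (covMat P Z Y) (covMat P Z Z) := by
  ext (a | a) (b | b) <;> rfl

theorem exists_orthonormalBasis_first {n : ℕ} {t : EuclideanSpace ℝ (Fin (n + 1))} (ht : t ≠ 0) :
    ∃ f : OrthonormalBasis (Fin (n + 1)) ℝ (EuclideanSpace ℝ (Fin (n + 1))), t = ‖t‖ • f 0 := by
  have hv : Orthonormal ℝ (({0} : Set (Fin (n + 1))).domRestrict
      (fun _ : Fin (n + 1) => ‖t‖⁻¹ • t)) := by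
    refine ⟨fun i => ?_, fun i j hij => absurd (Subsingleton.elim i j) hij⟩
    change ‖‖t‖⁻¹ • t‖ = 1
    rw [norm_smul, norm_inv, norm_norm, inv_mul_cancel₀ (norm_ne_zero_iff.2 ht)]
  obtain ⟨f, hf⟩ := hv.exists_orthonormalBasis_extension_of_card_eq (by simp)
  refine ⟨f, ?_⟩
  rw [hf 0 rfl, smul_smul, mul_inv_cancel₀ (norm_ne_zero_iff.2 ht), one_smul]

theorem iteratedDerivWithin_Icc_eq {ρ : ℝ → ℝ} (h : ContDiffOn ℝ 3 ρ (Set.Ici 0)) {d : ℝ}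
    (hd : 0 < d) {k : ℕ} (hk : k ≤ 3) {y : ℝ} (hy : y ∈ Set.Icc 0 (d ^ 2)) :
    iteratedDerivWithin k ρ (Set.Icc 0 (d ^ 2)) y = iteratedDerivWithin k ρ (Set.Ici 0) y := by
  rw [iteratedDerivWithin, iteratedDerivWithin,
    iteratedFDerivWithin_subset Set.Icc_subset_Ici_self (uniqueDiffOn_Icc (by positivity))
      (uniqueDiffOn_Ici 0) (h.of_le (by exact_mod_cast hk)) hy]

variable {n : ℕ} {Ω : Type*} [MeasurableSpace Ω] {P : Measure Ω} [IsProbabilityMeasure P]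
  {X : EuclideanSpace ℝ (Fin (n + 1)) → Ω → ℝ} {ρ : ℝ → ℝ}

/-- The analytic content of the hypotheses on the field. -/
theorem IsQualified.exists_peakMatrix (hX : IsQualified P X ρ) {d : ℝ} (hd : 0 < d)
    (hsmooth : SmoothCond ρ d) (hsign : SignCond ρ d) :
    ∃ ρ₁ ρ₂ ρ₃ : ℝ → ℝ, IsAdmissible ρ ρ₁ ρ₂ ρ₃ ∧
      (∀ r > 0, (peakMatrix ρ ρ₁ ρ₂ ρ₃ n r).PosDef) ∧
      (∀ r, 0 < r → r ≤ d → ρ₁ (r ^ 2) < 0 ∧ ρ₁ (r ^ 2) ^ 2 +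
        2 * ρ₁ (r ^ 2) * ρ₂ (r ^ 2) * r ^ 2 + 4 * ρ₂ (r ^ 2) ^ 2 * (r ^ 2) ^ 2 < ρ₁ 0 ^ 2) ∧
      ∀ t ≠ 0, (condCov P X t).PosDef ∧ (covMat P (gradVec X t) (gradVec X t)).PosDef ∧
        ∃ B : Matrix (Fin (n + 1)) (Fin (n + 1)) ℝ, B.det ≠ 0 ∧
          congMat B * condCov P X t * (congMat B).transpose = peakMatrix ρ ρ₁ ρ₂ ρ₃ n ‖t‖ := by
  obtain ⟨x, x1, x2, hx, cmm, cmg, cgm, cgg, -, hthird⟩ := hX.exists_isHilbertField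
  have hn : 1 ≤ n := by have := hX.two_le; omega
  have hcd : ContDiffOn ℝ 3 ρ (Set.Ici 0) :=
    contDiffOn_Ici_of_contDiff_sq (hx.contDiff_line 0) hd hsmooth
  have hρ := hasDerivs_of_contDiffOn hcd
  set ρ₁ := iteratedDerivWithin 1 ρ (Set.Ici 0)
  set ρ₂ := iteratedDerivWithin 2 ρ (Set.Ici 0)
  set ρ₃ := iteratedDerivWithin 3 ρ (Set.Ici 0) with hρ₃
  have hpd : ∀ t ≠ 0, (covMat P (gradVec X t) (gradVec X t)).PosDef ∧ (condCov P X t).PosDef := by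
    intro t ht
    have h := hX.nondeg t ht
    rw [covMat_sumElim] at h
    exact posDef_schur h
  have hmain : ∀ t ≠ 0, (crossGram (mainFam x x2 t) (mainFam x x2 t)).PosDef := by
    intro t ht
    have h := hX.nondeg t ht
    rw [covMat_sumElim] at h
    have h2 := h.submatrix (e := Sum.inl) Sum.inl_injective
    rw [← cmm]
    exact h2
  have hgrad : ∀ t ≠ 0, (crossGram (gradFam x1 t) (gradFam x1 t)).PosDef := by
    intro t ht
    rw [← cgg]
    exact (hpd t ht).1
  -- Strict Cauchy–Schwarz for X₁₁₁ and X₁ reads (12 ρ₂)² < (-120 ρ₃)(-2 ρ₁) at 0; divide by 48.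
  have h3 : 3 * ρ₂ 0 ^ 2 < 5 * ρ₁ 0 * ρ₃ 0 := by
    obtain ⟨y, hy, hlt⟩ := hthird 0 0 hX.nondeg_third
    obtain ⟨⟨δ, hδ, hdiff⟩, -⟩ := hX.sixth_deriv
    obtain ⟨e1, e2⟩ := hx.third_moment hρ hδ (ρ₄ := iteratedDerivWithin 4 ρ (Set.Ici 0))
      (fun z hz => by
        rw [iteratedDerivWithin_succ]
        exact (hdiff 3 (by norm_num) z hz).hasDerivWithinAt)
      (hdiff 4 (by norm_num) 0 ⟨le_rfl, by positivity⟩).continuousWithinAt hy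
    have e3 : ⟪x1 0 0, x1 0 0⟫ = -(2 * ρ₁ 0) := by
      rw [← dir1_basisVec (x1 := x1), hx.inner_dir1_dir1 hρ, inner_basisVec]
      simp [kron]
    rw [e1, e2, e3] at hlt
    linarith
  have hadm : IsAdmissible ρ ρ₁ ρ₂ ρ₃ := hx.isAdmissible hρ hX.rho_zero hn h3 hmain hgrad
  have hcond : ∀ t, condCov P X t = condGram (mainFam x x2 t) (gradFam x1 t) := by
    intro t
    rw [condCov, cmm, cmg, cgm, cgg]
    rfl
  have hpeak : ∀ t ≠ 0, ∃ B : Matrix (Fin (n + 1)) (Fin (n + 1)) ℝ, B.det ≠ 0 ∧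
      congMat B * condCov P X t * (congMat B).transpose = peakMatrix ρ ρ₁ ρ₂ ρ₃ n ‖t‖ := by
    intro t ht
    obtain ⟨f, hf⟩ := exists_orthonormalBasis_first ht
    have hr : 0 < ‖t‖ := norm_pos_iff.2 ht
    have hκ : (Real.sqrt ‖t‖)⁻¹ ≠ 0 := (inv_pos.2 (Real.sqrt_pos.2 hr)).ne'
    -- The radial axis is scaled by ‖t‖^(-1/2), and the radial second derivative scales
    -- quadratically, hence is divided by ‖t‖.
    refine ⟨scaledMat (Real.sqrt ‖t‖)⁻¹ f, det_scaledMat_ne_zero hκ f, ?_⟩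
    rw [hcond, congMat_condGram hx hρ hX.rho_zero f hκ
      (by rw [inv_pow, inv_inv, Real.sq_sqrt hr.le]) hf (hadm.radial_pos _ hr).ne'
      (hadm.tang_pos _ hr).ne', peakMatrix, hadm.peakCoeff_of_pos hr]
  refine ⟨ρ₁, ρ₂, ρ₃, hadm, fun r hr => ?_, fun r hr hrd => ?_, fun t ht =>
    ⟨(hpd t ht).2, (hpd t ht).1, hpeak t ht⟩⟩
  · have hnorm : ‖r • (basisVec 0 : EuclideanSpace ℝ (Fin (n + 1)))‖ = r := by
      simp [norm_smul, basisVec, abs_of_pos hr]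
    have hne : r • (basisVec 0 : EuclideanSpace ℝ (Fin (n + 1))) ≠ 0 := by
      rw [← norm_pos_iff, hnorm]
      exact hr
    obtain ⟨B, hB, hBeq⟩ := hpeak _ hne
    rw [hnorm] at hBeq
    rw [← hBeq]
    exact posDef_congMat hB (hpd _ hne).2
  · have hr2 : r ^ 2 ≤ d ^ 2 := by gcongr
    have h := hsign (r ^ 2) ⟨by positivity, hr2⟩
    have hmem : r ^ 2 ∈ Set.Icc 0 (d ^ 2) := ⟨by positivity, hr2⟩
    rw [iteratedDerivWithin_Icc_eq hcd hd (by norm_num) hmem,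
      iteratedDerivWithin_Icc_eq hcd hd (by norm_num) hmem,
      iteratedDerivWithin_Icc_eq hcd hd (by norm_num) ⟨le_rfl, by positivity⟩] at h
    exact h

omit [IsProbabilityMeasure P] in
theorem critDensity_eq {t : EuclideanSpace ℝ (Fin (n + 1))} (hC : (condCov P X t).PosDef) (u : ℝ)
    (k : ℕ) : critDensity P X u k t = (P.real {ω | u < X 0 ω})⁻¹ *
    (gaussDensity (covMat P (fun i => partial1 X i 0) (fun i => partial1 X i 0)) 0)⁻¹ *
    gaussDensity (covMat P (gradVec X t) (gradVec X t)) 0 * critInt u k (condCov P X t) := by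
  rw [critInt_eq_of_posDef hC]
  rfl

theorem IsQualified.prefactor_pos (hX : IsQualified P X ρ) (u : ℝ)
    {t : EuclideanSpace ℝ (Fin (n + 1))} (hg : (covMat P (gradVec X t) (gradVec X t)).PosDef) :
    0 < (P.real {ω | u < X 0 ω})⁻¹ *
      (gaussDensity (covMat P (fun i => partial1 X i 0) (fun i => partial1 X i 0)) 0)⁻¹ *
      gaussDensity (covMat P (gradVec X t) (gradVec X t)) 0 := by
  have h0 : (covMat P (fun i => partial1 X i 0) (fun i => partial1 X i 0)).PosDef :=
    hg.submatrix (e := Sum.inr) Sum.inr_injective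
  have h1 := gaussDensity_zero_pos hg
  have h2 := gaussDensity_zero_pos h0
  have h3 := hX.prob_pos u
  positivity

theorem critRatio_nonneg {N : ℕ} (u : ℝ) (C : Matrix (MainIdx N) (MainIdx N) ℝ) :
    0 ≤ critRatio u C :=
  div_nonneg (Finset.sum_nonneg fun _ _ => critInt_nonneg _ _ _)
    (add_nonneg (critInt_nonneg _ _ _) (critInt_nonneg _ _ _))

/-- The prefactor and (det B)² are common to all indices and cancel in the quotient. -/
theorem IsQualified.psi_eq (hX : IsQualified P X ρ) (u : ℝ)
    {t : EuclideanSpace ℝ (Fin (n + 1))} (hC : (condCov P X t).PosDef)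
    (hg : (covMat P (gradVec X t) (gradVec X t)).PosDef)
    {B : Matrix (Fin (n + 1)) (Fin (n + 1)) ℝ} (hB : B.det ≠ 0) :
    psi P X u t = critRatio u (congMat B * condCov P X t * (congMat B).transpose) := by
  have hc := (hX.prefactor_pos u hg).ne'
  have hB2 : B.det ^ 2 ≠ 0 := pow_ne_zero 2 hB
  simp only [psi, critRatio, critDensity_eq hC, critInt_congruence hB (matri_congMat_mulVec B)
    (congMat_mulVec_inr B) hC.posSemidef, ← Finset.mul_sum, ← mul_add]
  rw [mul_div_mul_left _ _ hc, mul_div_mul_left _ _ hB2]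

end Reduction

end CritPair

/-! ### The main theorem. -/

theorem theorem2 {N : ℕ} {Ω : Type*} [MeasurableSpace Ω] (P : Measure Ω) [IsProbabilityMeasure P]
    (X : EuclideanSpace ℝ (Fin N) → Ω → ℝ) (ρ : ℝ → ℝ)
    (hX : CritPair.IsQualifiedPert P X ρ)
    (d : ℝ) (hd : 0 < d) (hsmooth : CritPair.SmoothCond ρ d) (hsign : CritPair.SignCond ρ d) :
    (∀ u > 0, ∀ t ≠ 0,
      0 < CritPair.critDensity P X u (N - 1) t + CritPair.critDensity P X u N t) ∧
    ∃ Ψ₀ : ℝ → ℝ,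
      (∀ u > 0,
        Tendsto (CritPair.psi P X u) (𝓝[≠] 0) (𝓝 (Ψ₀ u)) ∧
        Continuous (Function.update (CritPair.psi P X u) 0 (Ψ₀ u))) ∧
      ∃ M : ℝ → ℝ,
        (∀ u > 0, IsGreatest (Function.update (CritPair.psi P X u) 0 (Ψ₀ u) ''
          Metric.closedBall 0 d) (M u)) ∧
        Tendsto M atTop (𝓝 0) := by
  have hXq := hX.toIsQualified
  obtain ⟨n, rfl⟩ : ∃ n, N = n + 1 := ⟨N - 1, by have := hXq.two_le; omega⟩
  obtain ⟨ρ₁, ρ₂, ρ₃, hadm, hpos, hs, ht⟩ := hXq.exists_peakMatrix hd hsmooth hsign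
  refine ⟨fun u _ t h0 => ?_, fun u => CritPair.critRatio u (CritPair.peakMatrix ρ ρ₁ ρ₂ ρ₃ n 0),
    ?_⟩
  · obtain ⟨hC, hg, -⟩ := ht t h0
    rw [CritPair.critDensity_eq hC, CritPair.critDensity_eq hC, ← mul_add]
    exact mul_pos (hXq.prefactor_pos u hg) (add_pos_of_nonneg_of_pos
      (CritPair.critInt_nonneg _ _ _)
      (CritPair.critInt_pos_of_chargesMaxima (CritPair.chargesMaxima_of_posDef hC) u))
  -- One formula in ‖t‖ describes the extended function, so continuity of the ratio along
  -- `peakMatrix` yields the limit at 0 and continuity on the whole space together.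
  have hupd : ∀ u, Function.update (CritPair.psi P X u) 0
      (CritPair.critRatio u (CritPair.peakMatrix ρ ρ₁ ρ₂ ρ₃ n 0)) =
      fun t => CritPair.critRatio u (CritPair.peakMatrix ρ ρ₁ ρ₂ ρ₃ n ‖t‖) := by
    intro u
    funext t
    rcases eq_or_ne t 0 with rfl | h0
    · simp
    · obtain ⟨hC, hg, B, hB, hBeq⟩ := ht t h0
      rw [Function.update_of_ne h0, hXq.psi_eq u hC hg hB, hBeq]
  have hcont : ∀ u, Continuous fun t : EuclideanSpace ℝ (Fin (n + 1)) =>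
      CritPair.critRatio u (CritPair.peakMatrix ρ ρ₁ ρ₂ ρ₃ n ‖t‖) := by
    intro u
    have hc : Continuous fun t : EuclideanSpace ℝ (Fin (n + 1)) =>
        CritPair.peakMatrix ρ ρ₁ ρ₂ ρ₃ n ‖t‖ :=
      (hadm.continuousOn_peakMatrix n).comp_continuous continuous_norm fun t => norm_nonneg t
    refine continuous_iff_continuousAt.2 fun t => ?_
    exact CritPair.tendsto_critRatio (hc.tendsto t)
      (Eventually.of_forall fun t => hadm.posSemidef_peakMatrix hpos (norm_nonneg t))
      (hadm.chargesMaxima_peakMatrix hpos (norm_nonneg t)) u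
  refine ⟨fun u _ => ?_, fun u => sSup ((fun t : EuclideanSpace ℝ (Fin (n + 1)) =>
    CritPair.critRatio u (CritPair.peakMatrix ρ ρ₁ ρ₂ ρ₃ n ‖t‖)) '' Metric.closedBall 0 d), ?_⟩
  · rw [← continuousAt_update_same, hupd]
    exact ⟨(hcont u).continuousAt, hcont u⟩
  -- Compactness of the ball turns the supremum into a maximum, attained at some t to which the
  -- uniform exponential bound applies.
  have hgreat : ∀ u, IsGreatest ((fun t : EuclideanSpace ℝ (Fin (n + 1)) =>
      CritPair.critRatio u (CritPair.peakMatrix ρ ρ₁ ρ₂ ρ₃ n ‖t‖)) '' Metric.closedBall 0 d)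
      (sSup ((fun t : EuclideanSpace ℝ (Fin (n + 1)) =>
      CritPair.critRatio u (CritPair.peakMatrix ρ ρ₁ ρ₂ ρ₃ n ‖t‖)) '' Metric.closedBall 0 d)) :=
    fun u => ((isCompact_closedBall 0 d).image (hcont u)).isGreatest_sSup
      ((Metric.nonempty_closedBall.2 hd.le).image _)
  refine ⟨fun u _ => by rw [hupd]; exact hgreat u, ?_⟩
  obtain ⟨K, c, hK, hc, hbound⟩ := hadm.exists_peakBounds hpos hd.le hs
  obtain ⟨K', U, hKU⟩ := CritPair.PeakBounds.exists_critRatio_le n hc hK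
  have hexp : Tendsto (fun u : ℝ => K' * Real.exp (-u)) atTop (𝓝 0) := by
    simpa using (Real.tendsto_exp_neg_atTop_nhds_zero).const_mul K'
  refine squeeze_zero' (Eventually.of_forall fun u => ?_) ?_ hexp
  · obtain ⟨t, -, h⟩ := (hgreat u).1
    rw [← h]
    exact CritPair.critRatio_nonneg _ _
  · filter_upwards [eventually_ge_atTop U] with u hu
    obtain ⟨t, htb, h⟩ := (hgreat u).1
    rw [← h]
    exact hKU u hu _ (hbound _ ⟨norm_nonneg t, by simpa using htb⟩)
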